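/- **Setting (data).** Let $\mathcal V_{\rm all}$ be a finite set of vertices and $\mathcal G=(\mathcal V,\mathcal E)$ a directed graph with $\mathcal V\subseteq\mathcal V_{\rm all}$. Each $v\in\mathcal V_{\rm all}$ has a finite non-empty value set $\mathrm{VALS}(v)\subset\mathbb Z$ and a finite non-empty set $\mathrm{CONT}(v)$ of contextual tokens, the sets $\mathrm{CONT}(v)$ being pairwise disjoint. Each edge $e=(v_1,v_2)$ carries an operation $\mathrm{op}(e):\mathrm{VALS}(v_1)\to\mathrm{VALS}(v_2)$ of the form $q\mapsto q+a_e$, $a_e\in\mathbb Z$. Chains are lists $[v_1,\dots,v_n]$ of vertices of $\mathcal V$ with $(v_i,v_{i+1})\in\mathcal E$; the depth $N$ is the (finite) number of vertices of a longest chain. Tokens are the vertices, the contextual tokens, the values, and the special tokens "$=$", "$,$", "$?$" and the delimiter "$\backslash n$"; $\mathcal A$ is the (finite) set of tokens. A training vertex order is a chain of $M$ vertices ($1\le M<N$) interleaved with $M'$ distinct noise vertices of $\mathcal V_{\rm all}\setminus\mathcal V$; a test vertex order is a chain of $N$ vertices. Vertex orders are drawn from an arbitrary probability law $\mu$ on training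 orders, respectively $\nu$ on test orders. Given the order $v_1,\dots,v_L$, a sequence is sampled as follows: the first vertex from $\mathcal V$ and all noise vertices get independent uniform values from their value sets; each further vertex $v$ from $\mathcal V$ gets $\mathrm{op}((u,v))(q_u)$, where $u$ is the preceding chain vertex and $q_u$ its value; for each $v_i$ a number $l_i$ uniform on $\{1,\dots,|\mathrm{CONT}(v_i)|\}$ and then $l_i$ contextual tokens from $\mathrm{CONT}(v_i)$ without replacement are drawn. The sequence is written as the question $v_L\,{=}\,?$ followed by the comma-separated entries (contextual tokens of $v_i$) $v_i\,{=}\,q_i$. The $k$-shot input $\mathrm{inp}^k$ consists of $k$ independent sequences with the same vertex order, each followed by $\backslash n$, then the question and the first entry of a further independent sequence with that order and a comma; the label $\mathrm{lab}^k$ consists of the remaining entries of that last sequence. Call the laws of $(\mathrm{inp}^k,\mathrm{lab}^k)$ $\mathcal D^k_{\rm train}$ (order drawn from $\mu$) and $\mathcal D^k_{\rm test}$ (order drawn from $\nu$), and let $K$ be the maximal number of shots. **Model.** Fix $d_1$ and a context length $T$ at least the length of every sentence $\mathrm{inp}^k+\mathrm{lab}^k$ in the supports of $\mathcal D_{\rm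 train}^k$ ($1\le k\le K-1$) and $\mathcal D_{\rm test}^k$ ($1\le k\le K$). Fix token, positional and comprehensive embeddings $W_{\rm tok}(z),p_t,W_{\rm comp}(z,t)\in\mathbb R^{d_1}$ ($z\in\mathcal A$, $1\le t\le T$) which together form an orthonormal family; token $z$ at position $t$ is embedded as $x_t^{(0)}=(W_{\rm tok}(z)+p_t+W_{\rm comp}(z,t),0,0,0,0)\in\mathbb R^{5d_1}$. The Transformer has 2 layers and 4 heads per layer, $$x^{(l)}_t=x^{(l-1)}_t+\sum_{h=1}^{4}\sum_{i\le t}\sigma\Big(\big((W_K^{l,h}x^{(l-1)}_j)^\top W_Q^{l,h}x^{(l-1)}_t\big)_{j\le t}\Big)_i\,W_V^{l,h}x_i^{(l-1)},$$ and next-token distribution $P_\theta(\cdot\mid z_{1:t})=\sigma\big(W_{O_2}\mathrm{relu}(W_{O_1}x^{(2)}_t+W_B)\big)$ on $\mathcal A$ with hidden width $|\mathcal A|+d_2$, $d_2=|\mathcal V|+\sum_{(v_1,v_2)\in\mathcal E}|\mathrm{VALS}(v_1)|$. The parameter $\theta$ consists of all matrices $W_Q^{l,h},W_K^{l,h},W_V^{l,h},W_{O_1},W_{O_2}$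 and the vector $W_B$, and is otherwise unconstrained. Every softmax $\sigma$ in the model is $\sigma_\beta(x)_i=e^{\beta x_i}/\sum_j e^{\beta x_j}$ with the same sharpness $\beta\in\mathbb R$, or, for $\beta=\infty$, its limit $\sigma_\infty(x)=\mathrm{Uniform}(\arg\max x)$. Write $P_{\theta,\beta}$ for the resulting distribution. **Losses.** With $-\log 0=\infty$, $$\widehat L_{\rm train}^{\beta}(\theta)=\sum_{k=1}^{K-1}\mathbb E_{\mathcal D^k_{\rm train}}\sum_{t=1}^{|\mathrm{lab}^k|-1}-\log P_{\theta,\beta}\big(\mathrm{lab}^k_{t+1}\mid \mathrm{inp}^k+\mathrm{lab}^k_{1:t}\big),\qquad L^{k,\beta}_{\rm test}(\theta)=-\Pr_{\mathcal D^k_{\rm test}}\big[\mathrm{dec}(\mathrm{model}_{\theta,\beta}(\mathrm{inp}^k))=\mathrm{dec}(\mathrm{lab}^k)\big].$$ Here $\mathrm{dec}$ keeps the vertices and values of a token list, and $\mathrm{model}_{\theta,\beta}(\mathrm{inp}^k)$ is generated greedily (always a most likely next token, ties broken by some rule that may depend on the sentence) until a value of the vertex named in the question has been written or the context of length $T$ is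 full. Note that $L^{k,\beta}_{\rm test}\ge -1$ always. **Theorem.** There are parameters $\theta^*$ such that: 1. In the limit $\beta=\infty$, $\widehat L^{\infty}_{\rm train}(\theta^*)=\min_\theta\widehat L^{\infty}_{\rm train}(\theta)<\infty$, and for every tie-breaking rule and every $k=1,\dots,K$ the testing loss attains its optimum: $L^{k,\infty}_{\rm test}(\theta^*)=-1$. 2. For every $\varepsilon>0$ there is $\beta_0$ such that for all real $\beta\ge\beta_0$ $$\widehat L^{\beta}_{\rm train}(\theta^*)<\inf_\theta\widehat L^{\beta}_{\rm train}(\theta)+\varepsilon,$$ and for every tie-breaking rule and every $k=1,\dots,K$, $L^{k,\beta}_{\rm test}(\theta^*)=-1$. -/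

import Mathlib

open scoped ENNReal

noncomputable section

/-- Tokens: vertices, contextual tokens, values, and the special tokens
`=` (`eq`), `,` (`cm`), `?` (`qu`) and the delimiter (`dlm`) between two shots. -/
inductive Token (V C Q : Type) : Type
  | vtx (v : V)
  | ctx (c : C)
  | val (q : Q)
  | eq
  | cm
  | qu
  | dlm
  deriving DecidableEq, Fintype

/-- A causal structure. `V` is the alphabet of all vertices (those outside `verts` serve as noise),
`C` the set of contextual tokens, and the operation of the edge `e` is `q ↦ q + shift e`. -/
structure Causal (V C : Type) where
  verts : Finset V
  edges : Finset (V × V)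
  edges_verts : ∀ e ∈ edges, e.1 ∈ verts ∧ e.2 ∈ verts
  vals : V → Finset ℤ
  vals_nonempty : ∀ v, (vals v).Nonempty
  shift : V × V → ℤ
  shift_vals : ∀ e ∈ edges, ∀ q ∈ vals e.1, q + shift e ∈ vals e.2
  cont : V → Finset C
  cont_nonempty : ∀ v, (cont v).Nonempty
  cont_disjoint : ∀ u v, u ≠ v → Disjoint (cont u) (cont v)

/-- `Interleaving s t r`: `r` merges `s` and `t`, keeping the order within `s` and within `t`. -/
inductive Interleaving {α : Type} : List α → List α → List α → Prop
  | nil : Interleaving [] [] []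
  | left {s t r : List α} (a : α) (h : Interleaving s t r) : Interleaving (a :: s) t (a :: r)
  | right {s t r : List α} (a : α) (h : Interleaving s t r) : Interleaving s (a :: t) (a :: r)

namespace Causal

variable {V C : Type} [Fintype V] [DecidableEq V] (D : Causal V C)

/-- All integers that are a value of some vertex. -/
abbrev Value : Type := {q : ℤ // q ∈ Finset.univ.biUnion D.vals}

/-- The token alphabet of the task. -/
abbrev Tok : Type := Token V C D.Value

/-- The operation of an edge. For an edge `e` and `q` in the value set of its parent the first
branch applies, and the result lies in the value set of the child. -/
def op (e : V × V) (q : D.Value) : D.Value :=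
  if h : (q : ℤ) + D.shift e ∈ Finset.univ.biUnion D.vals then ⟨(q : ℤ) + D.shift e, h⟩ else q

/-- The value set of a vertex, as a set of elements of `D.Value`. -/
def valueSet (v : V) : Finset D.Value := Finset.univ.filter fun q => (q : ℤ) ∈ D.vals v

theorem valueSet_nonempty (v : V) : (D.valueSet v).Nonempty := by
  obtain ⟨q, hq⟩ := D.vals_nonempty v
  exact ⟨⟨q, Finset.mem_biUnion.2 ⟨v, Finset.mem_univ v, hq⟩⟩, by simp [valueSet, hq]⟩

/-- The chains of the causal graph. -/
def IsChain (s : List V) : Prop :=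
  (∀ v ∈ s, v ∈ D.verts) ∧ s.IsChain fun u v => (u, v) ∈ D.edges

/-- The depth of the graph: the number of vertices of a longest chain. -/
def IsDepth (N : ℕ) : Prop := IsGreatest {n | ∃ s, D.IsChain s ∧ s.length = n} N

/-- Vertex orders of training sequences: a chain of `M` vertices merged with `M'` distinct noise
vertices. -/
def IsTrainOrder (M M' : ℕ) (vs : List V) : Prop :=
  ∃ s t : List V, D.IsChain s ∧ s.length = M ∧ t.Nodup ∧ t.length = M' ∧
    (∀ v ∈ t, v ∉ D.verts) ∧ Interleaving s t vs

/-- Vertex orders of test sequences: chains of `N` vertices. -/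
def IsTestOrder (N : ℕ) (vs : List V) : Prop := D.IsChain vs ∧ vs.length = N

variable [DecidableEq C]

/-- `l` successive uniform draws without replacement from `S`. -/
def drawNoRepl : ℕ → Finset C → PMF (List C)
  | 0, _ => PMF.pure []
  | l + 1, S =>
    if h : S.Nonempty then
      (PMF.uniformOfFinset S h).bind fun c => (drawNoRepl l (S.erase c)).map fun cs => c :: cs
    else PMF.pure []

/-- Contextual tokens of `v`: their number is uniform on `{1, …, |cont v|}`, then they are drawn
from `cont v` without replacement. -/
def contextLaw (v : V) : PMF (List C) :=
  (PMF.uniformOfFinset (Finset.Icc 1 (D.cont v).card)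
    (Finset.nonempty_Icc.2 (Finset.card_pos.2 (D.cont_nonempty v)))).bind
      fun l => drawNoRepl l (D.cont v)

/-- Law of the value of `v`, where `prev` is the preceding graph vertex of the same sequence with
its value, if there is one. -/
def valueLaw (prev : Option (V × D.Value)) (v : V) : PMF D.Value :=
  match (if v ∈ D.verts then prev else none) with
  | some (u, q) => PMF.pure (D.op (u, v) q)
  | none => PMF.uniformOfFinset (D.valueSet v) (D.valueSet_nonempty v)

/-- One position of a sequence: contextual tokens, vertex, value. -/
abbrev Entry : Type := List C × V × D.Value

/-- Law of a sequence with the given vertex order; `prev` is as in `valueLaw`. -/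
def seqLawFrom : Option (V × D.Value) → List V → PMF (List D.Entry)
  | _, [] => PMF.pure []
  | prev, v :: vs =>
    (D.contextLaw v).bind fun cs =>
      (D.valueLaw prev v).bind fun q =>
        (seqLawFrom (if v ∈ D.verts then some (v, q) else prev) vs).map fun es => (cs, v, q) :: es

/-- Law of a sequence with vertex order `vs`. -/
def seqLaw (vs : List V) : PMF (List D.Entry) := D.seqLawFrom none vs

/-- `k` independent sequences with the same vertex order `vs`. -/
def shotsLaw (vs : List V) : ℕ → PMF (List (List D.Entry))
  | 0 => PMF.pure []
  | k + 1 => (D.seqLaw vs).bind fun s => (shotsLaw vs k).map fun ss => s :: ss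

/-- The tokens `c₁ … c_l v = q` of one entry. -/
def renderEntry (e : D.Entry) : List D.Tok :=
  e.1.map Token.ctx ++ [Token.vtx e.2.1, Token.eq, Token.val e.2.2]

/-- Entries separated by commas. -/
def renderEntries (es : List D.Entry) : List D.Tok :=
  List.intercalate [Token.cm] (es.map D.renderEntry)

/-- The question `v_L = ?` about the last vertex `v_L` of the order. -/
def header (vs : List V) : List D.Tok :=
  match vs.getLast? with
  | some g => [Token.vtx g, Token.eq, Token.qu]
  | none => []

/-- Complete example sequences, each followed by the delimiter. -/
def renderDoc (vs : List V) (ss : List (List D.Entry)) : List D.Tok :=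
  ss.flatMap fun s => D.header vs ++ D.renderEntries s ++ [Token.dlm]

/-- The processed input: the examples `ss`, then the question and the first entry of `s`,
closed by a comma. -/
def inputOf (vs : List V) (ss : List (List D.Entry)) (s : List D.Entry) : List D.Tok :=
  D.renderDoc vs ss ++ D.header vs ++ D.renderEntries (s.take 1) ++ [Token.cm]

/-- The processed label: the remaining entries of `s`. -/
def labelOf (s : List D.Entry) : List D.Tok := D.renderEntries (s.drop 1)

/-- Law of the `k`-shot pair (input, label) when the vertex order has law `μ`. -/
def pairLaw (μ : PMF (List V)) (k : ℕ) : PMF (List D.Tok × List D.Tok) :=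
  μ.bind fun vs =>
    (D.shotsLaw vs k).bind fun ss =>
      (D.seqLaw vs).map fun s => (D.inputOf vs ss s, D.labelOf s)

/-- The vertex-value information of a token list. -/
def dec (z : List D.Tok) : List D.Tok :=
  z.filter fun a => match a with
    | Token.vtx _ => true
    | Token.val _ => true
    | _ => false

/-- The number of graph vertices plus the number of pairs (edge, value of its parent). -/
def mlpExtra : ℕ := D.verts.card + ∑ e ∈ D.edges, (D.vals e.1).card

/-- The negative log-likelihood `- log p`, equal to `∞` at `p = 0`. -/
def nll (p : ℝ) : ℝ≥0∞ := if p ≤ 0 then ⊤ else ENNReal.ofReal (-Real.log p)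

/-- The few-shot training loss of a next-token predictor `P`. -/
def trainLoss (μ : PMF (List V)) (K : ℕ) (P : List D.Tok → D.Tok → ℝ) : ℝ≥0∞ :=
  ∑ k ∈ Finset.Ico 1 K, ∑' x : List D.Tok × List D.Tok, D.pairLaw μ k x *
    ∑ t ∈ Finset.Ico 1 x.2.length, nll (P (x.1 ++ x.2.take t) (x.2.getD t Token.cm))

end Causal

/-- The maximizers of `x`. -/
def argmaxSet {ι : Type} [Fintype ι] (x : ι → ℝ) : Finset ι :=
  open Classical in Finset.univ.filter fun i => ∀ j, x j ≤ x i

/-- Softmax at inverse temperature `β`. -/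
def softmaxAt (β : ℝ) (ι : Type) [Fintype ι] (x : ι → ℝ) (i : ι) : ℝ :=
  Real.exp (β * x i) / ∑ j, Real.exp (β * x j)

/-- The limit of `softmaxAt β` as `β → ∞`: the uniform distribution on the maximizers. -/
def hardmax (ι : Type) [Fintype ι] (x : ι → ℝ) (i : ι) : ℝ :=
  open Classical in if i ∈ argmaxSet x then ((argmaxSet x).card : ℝ)⁻¹ else 0

/-- A fixed choice of token, positional and comprehensive embeddings in `ℝ^d₁`, which together form
an orthonormal family on the context window of length `T`. -/
structure Embeddings (A : Type) (d₁ T : ℕ) where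
  tok : A → EuclideanSpace ℝ (Fin d₁)
  pos : ℕ → EuclideanSpace ℝ (Fin d₁)
  comp : A → ℕ → EuclideanSpace ℝ (Fin d₁)
  orthonormal : Orthonormal ℝ
    (Sum.elim tok (Sum.elim (fun t : Fin T => pos t) (fun p : A × Fin T => comp p.1 p.2)))

/-- Index set of the hidden states: five blocks of dimension `d₁`. -/
abbrev HiddenIdx (d₁ : ℕ) : Type := Fin 5 × Fin d₁

/-- Parameters of a Transformer with `L` layers, `H` heads per layer and MLP width `|A| + d₂`. -/
structure TransformerParams (A : Type) (d₁ L H d₂ : ℕ) where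
  WQ : Fin L → Fin H → Matrix (HiddenIdx d₁) (HiddenIdx d₁) ℝ
  WK : Fin L → Fin H → Matrix (HiddenIdx d₁) (HiddenIdx d₁) ℝ
  WV : Fin L → Fin H → Matrix (HiddenIdx d₁) (HiddenIdx d₁) ℝ
  WO1 : Matrix (A ⊕ Fin d₂) (HiddenIdx d₁) ℝ
  WB : A ⊕ Fin d₂ → ℝ
  WO2 : Matrix A (A ⊕ Fin d₂) ℝ

namespace Transformer

open Matrix

variable {A : Type} [Fintype A] {d₁ T L H d₂ : ℕ}

/-- The embedding of token `a` at position `t`: token, positional and comprehensive embedding are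
added in the first block, the other four blocks are zero. -/
def embed (E : Embeddings A d₁ T) (a : A) (t : ℕ) : HiddenIdx d₁ → ℝ := fun p =>
  if p.1 = 0 then E.tok a p.2 + E.pos t p.2 + E.comp a t p.2 else 0

/-- The embedded sentence, positions counted from `0` (zero beyond the end of the sentence). -/
def embedSentence (E : Embeddings A d₁ T) (z : List A) (t : ℕ) : HiddenIdx d₁ → ℝ :=
  match z[t]? with
  | some a => embed E a t
  | none => 0

/-- One layer of causal multi-head attention with residual connection. -/
def layer (sm : ∀ (ι : Type) [Fintype ι], (ι → ℝ) → ι → ℝ)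
    (WQ WK WV : Fin H → Matrix (HiddenIdx d₁) (HiddenIdx d₁) ℝ)
    (x : ℕ → HiddenIdx d₁ → ℝ) (t : ℕ) : HiddenIdx d₁ → ℝ :=
  x t + ∑ h : Fin H, ∑ i : Fin (t + 1),
    sm (Fin (t + 1)) (fun j => (WK h *ᵥ x j) ⬝ᵥ (WQ h *ᵥ x t)) i • (WV h *ᵥ x i)

/-- The hidden states after all layers. -/
def hidden (sm : ∀ (ι : Type) [Fintype ι], (ι → ℝ) → ι → ℝ) (E : Embeddings A d₁ T)
    (θ : TransformerParams A d₁ L H d₂) (z : List A) : ℕ → HiddenIdx d₁ → ℝ :=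
  (List.finRange L).foldl (fun x l => layer sm (θ.WQ l) (θ.WK l) (θ.WV l) x) (embedSentence E z)

/-- The two-layer ReLU output map. -/
def mlp (θ : TransformerParams A d₁ L H d₂) (x : HiddenIdx d₁ → ℝ) : A → ℝ :=
  θ.WO2 *ᵥ fun i => max ((θ.WO1 *ᵥ x + θ.WB) i) 0

/-- The next-token distribution after the sentence `z`; every softmax of the model is `sm`. -/
def nextDist (sm : ∀ (ι : Type) [Fintype ι], (ι → ℝ) → ι → ℝ) (E : Embeddings A d₁ T)
    (θ : TransformerParams A d₁ L H d₂) (z : List A) : A → ℝ :=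
  sm A (mlp θ (hidden sm E θ z (z.length - 1)))

end Transformer

namespace Causal

variable {V C : Type} [Fintype V] [DecidableEq V] [Fintype C] [DecidableEq C] (D : Causal V C)

/-- A rule that selects one token among several maximizers (it may look at the sentence). -/
def IsTieBreak (pick : List D.Tok → Finset D.Tok → D.Tok) : Prop :=
  ∀ z S, S.Nonempty → pick z S ∈ S

/-- The question has been answered: `out` ends in `v = q` with `v` the goal vertex, which is the
first token of the input `inp`. -/
def Answered (inp out : List D.Tok) : Prop :=
  ∃ g q, inp.head? = some (Token.vtx g) ∧ [Token.vtx g, Token.eq, Token.val q] <:+ out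

/-- Greedy decoding: append at most `n` further tokens to `out`, each a most likely next token, and
stop as soon as the question has been answered. -/
def greedyFrom (P : List D.Tok → D.Tok → ℝ) (pick : List D.Tok → Finset D.Tok → D.Tok)
    (inp : List D.Tok) : ℕ → List D.Tok → List D.Tok
  | 0, out => out
  | n + 1, out =>
    open Classical in
    if D.Answered inp out then out
    else greedyFrom P pick inp n (out ++ [pick (inp ++ out) (argmaxSet (P (inp ++ out)))])

/-- The sentence generated from `inp` within the context window of length `T`. -/
def generate (T : ℕ) (P : List D.Tok → D.Tok → ℝ)
    (pick : List D.Tok → Finset D.Tok → D.Tok) (inp : List D.Tok) : List D.Tok :=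
  D.greedyFrom P pick inp (T - inp.length) []

/-- The `k`-shot testing loss: minus the probability that the vertices and values of the generated
sentence are those of the label. -/
def testLoss (ν : PMF (List V)) (k T : ℕ) (P : List D.Tok → D.Tok → ℝ)
    (pick : List D.Tok → Finset D.Tok → D.Tok) : ℝ :=
  -((D.pairLaw ν k).toOuterMeasure
    {x | D.dec (D.generate T P pick x.1) = D.dec x.2}).toReal

end Causal

end

set_option linter.unusedSectionVars false

/-! The label, given the input, is generated by a tree of uniform choices: after any admissible
sentence the next token is uniform on a finite set `S` determined by that sentence. This holds even
for the contextual tokens. Because their number is uniform, after at least one draw the vertex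
itself (which ends the draws) and each unused contextual token are equally likely
(`expect_contextLaw`, `expect_drawUniform`). By Gibbs' inequality no next-token predictor has
smaller loss than one that is uniform on `S` at every node (`UniformTree.logCost_le`), and greedy
decoding whose maximizers lie in `S` ends at a leaf of the tree
(`UniformTree.exists_greedyFrom_eq`). It remains to find parameters whose hardmax output is exactly
uniform on `S`, for training and test orders alike; they never refer to the lengths of the orders.

These are `params`. Layer 1 attaches to each token the last vertex before or at it, with its
position. In layer 2 one head looks, after a comma, for contextual tokens that followed the same
vertex, and so finds the next vertex of the order; one collects the contextual tokens written since
the last vertex, so that the used ones can be suppressed; one finds the last value of a graph vertex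
together with that vertex. The hidden units of the MLP are AND gates, one for each token and one for
each pair (edge, value of its parent); the latter add weight to the value computed by the edge.

One case needs the structure of the graph. At the first graph vertex of a sequence the parent head
finds the last graph vertex of the preceding example. Finite depth excludes cycles, so no edge leads
from the last to the first vertex of a chain (`IsDepth.not_mem_edges`); no edge unit fires, and the
prediction is uniform on the value set, as it should be. Noise vertices have no incoming edges at
all. The law of the label is assembled in `IsPrompt.uniformTree_seqLawFrom`. In a test sequence the
first entry determines all vertices and values, so every leaf has the correct decoding
(`map_snd_eq_of_mem_support`).

For finite sharpness, each layer converges exponentially fast to its hardmax version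
(`expTendsto_nextDist`), and only finitely many sentences fit into the window. The lower bound holds
against arbitrary predictors, hence against every model at every finite sharpness, so the infimum at
`β` is at least the hardmax loss of `params`. -/

noncomputable section

/-! ### Exponentially fast convergence, and the limit from softmax to hardmax. -/

/-- `f β` converges to `a` exponentially fast as `β → ∞`. -/
def ExpTendsto (f : ℝ → ℝ) (a : ℝ) : Prop :=
  ∃ c : ℝ, 0 < c ∧ (fun β => f β - a) =O[Filter.atTop] fun β => Real.exp (-(c * β))

namespace ExpTendsto

open Filter Asymptotics Topology

theorem exp_isBigO_exp {c c' : ℝ} (h : c' ≤ c) :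
    (fun β => Real.exp (-(c * β))) =O[atTop] fun β => Real.exp (-(c' * β)) := by
  refine IsBigO.of_bound 1 ?_
  filter_upwards [eventually_ge_atTop 0] with β hβ
  rw [Real.norm_eq_abs, Real.norm_eq_abs, abs_of_pos (Real.exp_pos _), abs_of_pos (Real.exp_pos _),
    one_mul]
  exact Real.exp_le_exp.2 (by nlinarith)

theorem const (a : ℝ) : ExpTendsto (fun _ => a) a :=
  ⟨1, one_pos, by simpa using isBigO_zero _ _⟩

theorem add {f g : ℝ → ℝ} {a b : ℝ} (hf : ExpTendsto f a) (hg : ExpTendsto g b) :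
    ExpTendsto (fun β => f β + g β) (a + b) := by
  obtain ⟨c, hc, h1⟩ := hf
  obtain ⟨c', hc', h2⟩ := hg
  refine ⟨min c c', lt_min hc hc', ?_⟩
  have := (h1.trans (exp_isBigO_exp (min_le_left c c'))).add
    (h2.trans (exp_isBigO_exp (min_le_right c c')))
  exact this.congr_left fun β => by ring

theorem sum {ι : Type*} (s : Finset ι) {f : ι → ℝ → ℝ} {a : ι → ℝ}
    (h : ∀ i ∈ s, ExpTendsto (f i) (a i)) :
    ExpTendsto (fun β => ∑ i ∈ s, f i β) (∑ i ∈ s, a i) := by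
  classical
  induction s using Finset.induction_on with
  | empty => simpa using const 0
  | insert i s hi ih =>
    simp only [Finset.sum_insert hi]
    exact (h i (Finset.mem_insert_self i s)).add
      (ih fun j hj => h j (Finset.mem_insert_of_mem hj))

theorem tendsto_exp {c : ℝ} (hc : 0 < c) :
    Tendsto (fun β => Real.exp (-(c * β))) atTop (𝓝 0) :=
  Real.tendsto_exp_neg_atTop_nhds_zero.comp (tendsto_id.const_mul_atTop hc)

theorem tendsto {f : ℝ → ℝ} {a : ℝ} (hf : ExpTendsto f a) : Tendsto f atTop (𝓝 a) := by
  obtain ⟨c, hc, h⟩ := hf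
  simpa using (h.trans_tendsto (tendsto_exp hc)).add_const a

theorem mul {f g : ℝ → ℝ} {a b : ℝ} (hf : ExpTendsto f a) (hg : ExpTendsto g b) :
    ExpTendsto (fun β => f β * g β) (a * b) := by
  have hgb : g =O[atTop] fun _ => (1 : ℝ) := hg.tendsto.isBigO_one ℝ
  obtain ⟨c, hc, h1⟩ := hf
  obtain ⟨c', hc', h2⟩ := hg
  refine ⟨min c c', lt_min hc hc', ?_⟩
  have e1 := (h1.trans (exp_isBigO_exp (min_le_left c c'))).mul hgb
  have e2 := (h2.trans (exp_isBigO_exp (min_le_right c c'))).const_mul_left a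
  simp only [mul_one] at e1
  exact (e1.add e2).congr_left fun β => by ring

theorem of_abs_sub_le {f g : ℝ → ℝ} {a b K : ℝ} (hf : ExpTendsto f a)
    (h : ∀ᶠ β in atTop, |g β - b| ≤ K * |f β - a|) : ExpTendsto g b := by
  obtain ⟨c, hc, h1⟩ := hf
  exact ⟨c, hc, (IsBigO.of_bound K h).trans h1⟩

theorem max_zero {f : ℝ → ℝ} {a : ℝ} (hf : ExpTendsto f a) :
    ExpTendsto (fun β => max (f β) 0) (max a 0) :=
  hf.of_abs_sub_le (K := 1) (Eventually.of_forall fun β => by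
    simpa using abs_max_sub_max_le_abs (f β) a 0)

theorem inv {f : ℝ → ℝ} {a : ℝ} (hf : ExpTendsto f a) (ha : 0 < a) :
    ExpTendsto (fun β => (f β)⁻¹) a⁻¹ := by
  refine hf.of_abs_sub_le (K := (a / 2 * a)⁻¹) ?_
  filter_upwards [hf.tendsto.eventually_const_lt (half_lt_self ha)] with β hβ
  have hfp : 0 < f β := (half_pos ha).trans hβ
  rw [inv_sub_inv hfp.ne' ha.ne', abs_div, abs_of_pos (mul_pos hfp ha), abs_sub_comm,
    div_eq_inv_mul]
  gcongr

theorem exp_zero {f : ℝ → ℝ} (hf : ExpTendsto f 0) : ExpTendsto (fun β => Real.exp (f β)) 1 := by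
  refine hf.of_abs_sub_le (K := 2) ?_
  filter_upwards [hf.tendsto.abs.eventually_le_const (u := 1) (by simp)] with β hβ
  simpa using Real.abs_exp_sub_one_le hβ

/-- This is why a rate is carried along: the scores of the next softmax are multiplied by `β`, so
their errors must stay small after this multiplication. Half of the exponent pays for the factor
`β`. -/
theorem id_mul {f : ℝ → ℝ} (hf : ExpTendsto f 0) : ExpTendsto (fun β => β * f β) 0 := by
  obtain ⟨c, hc, h⟩ := hf
  refine ⟨c / 2, half_pos hc, ?_⟩
  simp only [sub_zero] at h ⊢
  have hid : (fun β : ℝ => β) =O[atTop] fun β => Real.exp (c / 2 * β) := by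
    simpa using (isLittleO_pow_exp_pos_mul_atTop 1 (half_pos hc)).isBigO
  exact (hid.mul h).congr_right fun β => by rw [← Real.exp_add]; ring_nf

end ExpTendsto

-- Dividing numerator and denominator by the exponential of the limiting maximum leaves weights that
-- tend to 1 on the maximizers of the limit and to 0 elsewhere.
open Filter in
theorem ExpTendsto.softmaxAt {ι : Type} [Fintype ι] {x : ℝ → ι → ℝ} {y : ι → ℝ}
    (h : ∀ i, ExpTendsto (fun β => x β i) (y i)) (i : ι) :
    ExpTendsto (fun β => softmaxAt β ι (x β) i) (hardmax ι y i) := by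
  classical
  have : Nonempty ι := ⟨i⟩
  obtain ⟨m, hm⟩ := Finite.exists_max y
  have hmem : ∀ j, j ∈ argmaxSet y ↔ y j = y m := fun j => by
    simp only [argmaxSet, Finset.mem_filter, Finset.mem_univ, true_and]
    exact ⟨fun hj => le_antisymm (hm j) (hj m), fun hj k => hj ▸ hm k⟩
  -- A maximizer has exponent `β` times an exponentially small error. Any other index eventually
  -- keeps half of its gap to the maximum, which gives the rate.
  have hw : ∀ j, ExpTendsto (fun β => Real.exp (β * (x β j - y m)))
      (if j ∈ argmaxSet y then 1 else 0) := by
    intro j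
    split_ifs with hj
    · rw [hmem] at hj
      refine (ExpTendsto.id_mul ?_).exp_zero
      simpa [hj, sub_eq_add_neg] using (h j).add (ExpTendsto.const (-y m))
    · have hlt : y j < y m := lt_of_le_of_ne (hm j) fun e => hj ((hmem j).2 e)
      refine ⟨(y m - y j) / 2, by linarith, Asymptotics.IsBigO.of_bound 1 ?_⟩
      filter_upwards [eventually_ge_atTop 0, (h j).tendsto.eventually_lt_const
        (show y j < (y m + y j) / 2 by linarith)] with β hβ hx
      rw [sub_zero, Real.norm_eq_abs, Real.norm_eq_abs, abs_of_pos (Real.exp_pos _),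
        abs_of_pos (Real.exp_pos _), one_mul]
      exact Real.exp_le_exp.2 (by nlinarith)
  have hcard : ∑ j, (if j ∈ argmaxSet y then (1 : ℝ) else 0) = (argmaxSet y).card := by simp
  have hpos : (0 : ℝ) < (argmaxSet y).card :=
    Nat.cast_pos.2 (Finset.card_pos.2 ⟨m, (hmem m).2 rfl⟩)
  have hs := ExpTendsto.sum Finset.univ fun j _ => hw j
  rw [hcard] at hs
  convert (hw i).mul (hs.inv hpos) using 1
  · funext β
    have e : ∀ j, Real.exp (β * x β j) = Real.exp (β * (x β j - y m)) * Real.exp (β * y m) :=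
      fun j => by rw [← Real.exp_add]; ring_nf
    simp only [_root_.softmaxAt, e, ← Finset.sum_mul]
    rw [mul_div_mul_right _ _ (Real.exp_pos _).ne', div_eq_mul_inv]
  · simp [hardmax]

/-! ### Convergence of the whole model as the sharpness grows. -/

namespace Transformer

open Matrix

variable {A : Type} [Fintype A] {d₁ T L H d₂ : ℕ}

theorem expTendsto_mulVec {m n : Type*} [Fintype n] (M : Matrix m n ℝ) {x : ℝ → n → ℝ}
    {y : n → ℝ} (h : ∀ i, ExpTendsto (fun β => x β i) (y i)) (i : m) :
    ExpTendsto (fun β => (M *ᵥ x β) i) ((M *ᵥ y) i) :=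
  ExpTendsto.sum _ fun j _ => (ExpTendsto.const (M i j)).mul (h j)

theorem expTendsto_layer (WQ WK WV : Fin H → Matrix (HiddenIdx d₁) (HiddenIdx d₁) ℝ)
    {x : ℝ → ℕ → HiddenIdx d₁ → ℝ} {y : ℕ → HiddenIdx d₁ → ℝ}
    (h : ∀ t p, ExpTendsto (fun β => x β t p) (y t p)) (t : ℕ) (p : HiddenIdx d₁) :
    ExpTendsto (fun β => layer (softmaxAt β) WQ WK WV (x β) t p)
      (layer hardmax WQ WK WV y t p) := by
  simp only [layer, Pi.add_apply, Finset.sum_apply, Pi.smul_apply, smul_eq_mul]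
  refine (h t p).add (ExpTendsto.sum _ fun k _ => ExpTendsto.sum _ fun i _ => ?_)
  exact (ExpTendsto.softmaxAt
    (x := fun β (j : Fin (t + 1)) => (WK k *ᵥ x β j) ⬝ᵥ (WQ k *ᵥ x β t))
    (y := fun j : Fin (t + 1) => (WK k *ᵥ y j) ⬝ᵥ (WQ k *ᵥ y t)) (fun j => ExpTendsto.sum _ fun q _ =>
    (expTendsto_mulVec (WK k) (h j) q).mul (expTendsto_mulVec (WQ k) (h t) q)) i).mul
    (expTendsto_mulVec (WV k) (h i) p)

theorem expTendsto_nextDist (E : Embeddings A d₁ T) (θ : TransformerParams A d₁ L H d₂)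
    (z : List A) (a : A) :
    ExpTendsto (fun β => nextDist (softmaxAt β) E θ z a) (nextDist hardmax E θ z a) := by
  refine ExpTendsto.softmaxAt (fun b => expTendsto_mulVec _ (fun i => ExpTendsto.max_zero ?_) b) a
  refine (expTendsto_mulVec _ (fun p => ?_) i).add (ExpTendsto.const _)
  -- The input must be allowed to depend on `β`, since the second layer already receives perturbed
  -- states.
  have key : ∀ (l : List (Fin L)) (x : ℝ → ℕ → HiddenIdx d₁ → ℝ) (y : ℕ → HiddenIdx d₁ → ℝ),
      (∀ t p, ExpTendsto (fun β => x β t p) (y t p)) → ∀ t p, ExpTendsto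
        (fun β => l.foldl (fun x l => layer (softmaxAt β) (θ.WQ l) (θ.WK l) (θ.WV l) x) (x β) t p)
        (l.foldl (fun x l => layer hardmax (θ.WQ l) (θ.WK l) (θ.WV l) x) y t p) := by
    intro l
    induction l with
    | nil => exact fun x y h => h
    | cons k l ih =>
      exact fun x y h => ih (fun β => layer (softmaxAt β) (θ.WQ k) (θ.WK k) (θ.WV k) (x β)) _
        (expTendsto_layer _ _ _ h)
  exact key _ (fun _ => embedSentence E z) _ (fun t p => ExpTendsto.const _) _ p

end Transformer

/-! ### Expectations of nonnegative functions. -/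

namespace PMF

variable {α β : Type}

/-- The expectation of a nonnegative function under a probability mass function. -/
def expect (p : PMF α) (f : α → ℝ≥0∞) : ℝ≥0∞ := ∑' x, p x * f x

theorem expect_pure (a : α) (f : α → ℝ≥0∞) : (pure a).expect f = f a := by
  classical
  rw [expect, tsum_eq_single a fun b hb => by simp [hb]]
  simp

theorem expect_bind (p : PMF α) (g : α → PMF β) (f : β → ℝ≥0∞) :
    (p.bind g).expect f = p.expect fun a => (g a).expect f := by
  simp only [expect, bind_apply, ← ENNReal.tsum_mul_left, ← ENNReal.tsum_mul_right]
  rw [ENNReal.tsum_comm]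
  simp only [mul_assoc]

theorem expect_map (p : PMF α) (g : α → β) (f : β → ℝ≥0∞) :
    (p.map g).expect f = p.expect fun a => f (g a) := by
  rw [map, expect_bind]
  simp only [Function.comp_apply, expect_pure]

theorem expect_mono (p : PMF α) {f g : α → ℝ≥0∞} (h : ∀ a ∈ p.support, f a ≤ g a) :
    p.expect f ≤ p.expect g := by
  refine ENNReal.tsum_le_tsum fun a => ?_
  by_cases ha : a ∈ p.support
  · exact mul_le_mul_right (h a ha) _
  · simp [(apply_eq_zero_iff p a).2 ha]

theorem expect_congr (p : PMF α) {f g : α → ℝ≥0∞} (h : ∀ a ∈ p.support, f a = g a) :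
    p.expect f = p.expect g :=
  le_antisymm (p.expect_mono fun a ha => (h a ha).le) (p.expect_mono fun a ha => (h a ha).ge)

theorem expect_const (p : PMF α) (c : ℝ≥0∞) : (p.expect fun _ => c) = c := by
  rw [expect, ENNReal.tsum_mul_right, p.tsum_coe, one_mul]

theorem expect_add (p : PMF α) (f g : α → ℝ≥0∞) :
    (p.expect fun a => f a + g a) = p.expect f + p.expect g := by
  simp only [expect, mul_add, ENNReal.tsum_add]

theorem expect_uniformOfFinset (s : Finset α) (hs : s.Nonempty) (f : α → ℝ≥0∞) :
    (uniformOfFinset s hs).expect f = (s.card : ℝ≥0∞)⁻¹ * ∑ a ∈ s, f a := by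
  rw [expect, tsum_eq_sum (s := s) fun b hb => by simp [hb], Finset.mul_sum]
  exact Finset.sum_congr rfl fun a ha => by simp [ha]

theorem expect_ne_zero_iff (p : PMF α) (f : α → ℝ≥0∞) :
    p.expect f ≠ 0 ↔ ∃ a ∈ p.support, f a ≠ 0 := by
  simp [expect, ENNReal.tsum_eq_zero, mem_support_iff]

end PMF

/-! ### Contextual tokens as successive uniform choices. -/

namespace Causal

section Context

variable {C : Type} [DecidableEq C]

/-- Draws without replacement from `S`, their number being uniform on `{0, …, |S|}`. -/
def drawUniform (S : Finset C) : PMF (List C) :=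
  (PMF.uniformOfFinset (Finset.range (S.card + 1)) Finset.nonempty_range_add_one).bind fun l =>
    drawNoRepl l S

theorem expect_drawNoRepl_succ (l : ℕ) {S : Finset C} (hS : S.Nonempty) (g : List C → ℝ≥0∞) :
    (drawNoRepl (l + 1) S).expect g =
      (S.card : ℝ≥0∞)⁻¹ * ∑ c ∈ S, (drawNoRepl l (S.erase c)).expect fun cs => g (c :: cs) := by
  rw [drawNoRepl, dif_pos hS, PMF.expect_bind, PMF.expect_uniformOfFinset]
  simp only [PMF.expect_map]

theorem expect_drawUniform_erase {S : Finset C} {c : C} (hc : c ∈ S) (g : List C → ℝ≥0∞) :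
    (drawUniform (S.erase c)).expect g =
      (S.card : ℝ≥0∞)⁻¹ * ∑ l ∈ Finset.range S.card, (drawNoRepl l (S.erase c)).expect g := by
  rw [drawUniform, PMF.expect_bind, PMF.expect_uniformOfFinset, Finset.card_erase_add_one hc,
    Finset.card_range]

/-- Summation over the number of draws is exchanged with the first draw: once `c` is drawn, the
number of further draws is again uniform from 0 up to the size of the remaining set. -/
theorem sum_expect_drawNoRepl_succ (S : Finset C) (g : List C → ℝ≥0∞) :
    ∑ l ∈ Finset.range S.card, (drawNoRepl (l + 1) S).expect g =
      ∑ c ∈ S, (drawUniform (S.erase c)).expect fun cs => g (c :: cs) := by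
  rcases S.eq_empty_or_nonempty with rfl | hS
  · simp
  simp only [expect_drawNoRepl_succ _ hS]
  rw [← Finset.mul_sum, Finset.sum_comm, Finset.mul_sum]
  exact Finset.sum_congr rfl fun c hc => (expect_drawUniform_erase hc _).symm

/-- Stopping at once has probability `1 / (|S| + 1)`, and so does each possible next token;
afterwards the situation repeats on the smaller set. Hence "stop or draw" is a single uniform
choice. -/
theorem expect_drawUniform (S : Finset C) (g : List C → ℝ≥0∞) :
    (drawUniform S).expect g = ((S.card + 1 : ℕ) : ℝ≥0∞)⁻¹ *
      (g [] + ∑ c ∈ S, (drawUniform (S.erase c)).expect fun cs => g (c :: cs)) := by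
  rw [drawUniform, PMF.expect_bind, PMF.expect_uniformOfFinset, Finset.card_range,
    Finset.sum_range_succ', sum_expect_drawNoRepl_succ, drawNoRepl, PMF.expect_pure,
    add_comm (g [])]

/-- The first draw is compulsory and so has no stopping option; the rest follows `drawUniform`. -/
theorem expect_contextLaw {V : Type} [DecidableEq V] (D : Causal V C) (v : V)
    (g : List C → ℝ≥0∞) :
    (D.contextLaw v).expect g = ((D.cont v).card : ℝ≥0∞)⁻¹ *
      ∑ c ∈ D.cont v, (drawUniform ((D.cont v).erase c)).expect fun cs => g (c :: cs) := by
  rw [contextLaw, PMF.expect_bind, PMF.expect_uniformOfFinset, ← sum_expect_drawNoRepl_succ,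
    Nat.card_Icc, Nat.add_sub_cancel, Finset.range_eq_Ico,
    Finset.sum_Ico_add' (fun l => (drawNoRepl l (D.cont v)).expect g) 0 _ 1, zero_add,
    Finset.sum_congr (s₂ := Finset.Ico 1 ((D.cont v).card + 1)) (by ext; simp)
      fun _ _ => rfl]

theorem mem_support_drawNoRepl {l : ℕ} {S : Finset C} {cs : List C}
    (h : cs ∈ (drawNoRepl l S).support) : cs.Nodup ∧ (∀ c ∈ cs, c ∈ S) := by
  induction l generalizing S cs with
  | zero => simp_all [drawNoRepl]
  | succ l ih =>
    rw [drawNoRepl] at h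
    split_ifs at h with hS
    · simp only [PMF.support_bind, PMF.support_map, Set.mem_iUnion, Set.mem_image,
        PMF.support_uniformOfFinset, Finset.mem_coe] at h
      obtain ⟨c, hc, cs', h', rfl⟩ := h
      obtain ⟨h1, h2⟩ := ih h'
      refine ⟨List.nodup_cons.2 ⟨fun hm => by simpa using h2 c hm, h1⟩, fun x hx => ?_⟩
      rcases List.mem_cons.1 hx with rfl | hx
      · exact hc
      · exact Finset.mem_of_mem_erase (h2 x hx)
    · simp_all

theorem mem_support_contextLaw {V : Type} [DecidableEq V] (D : Causal V C) {v : V} {cs : List C}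
    (h : cs ∈ (D.contextLaw v).support) : cs ≠ [] ∧ ∀ c ∈ cs, c ∈ D.cont v := by
  simp only [contextLaw, PMF.support_bind, Set.mem_iUnion, PMF.support_uniformOfFinset,
    Finset.mem_coe, Finset.mem_Icc] at h
  obtain ⟨l, hl, h⟩ := h
  refine ⟨?_, (mem_support_drawNoRepl h).2⟩
  rintro rfl
  obtain ⟨l, rfl⟩ : ∃ k, l = k + 1 := ⟨l - 1, by lia⟩
  rw [drawNoRepl, dif_pos (D.cont_nonempty v)] at h
  simp at h

end Context

/-! ### Log-likelihood along a sentence and the bound for one token. -/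

section Loss

variable {A : Type}

/-- The total negative log-likelihood of the continuation `y` of `pre` under `P`. -/
def logCost (P : List A → A → ℝ) : List A → List A → ℝ≥0∞
  | _, [] => 0
  | pre, a :: y => nll (P pre a) + logCost P (pre ++ [a]) y

theorem sum_nll_eq_logCost (P : List A → A → ℝ) (d : A) (pre y : List A) :
    ∑ t ∈ Finset.range y.length, nll (P (pre ++ y.take t) (y.getD t d)) = logCost P pre y := by
  induction y generalizing pre with
  | nil => simp [logCost]
  | cons a y ih =>
    rw [List.length_cons, Finset.sum_range_succ', logCost, ← ih, add_comm]
    simp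

/-- Gibbs' inequality for a uniform target. A vanishing `p a` makes the right side infinite;
otherwise `log x ≤ x - 1` is summed at `x = |S| * p a`. -/
theorem ofReal_log_card_le [Fintype A] {S : Finset A} (hS : S.Nonempty) {p : A → ℝ}
    (h0 : ∀ a, 0 ≤ p a) (h1 : ∑ a, p a ≤ 1) :
    ENNReal.ofReal (Real.log S.card) ≤ (S.card : ℝ≥0∞)⁻¹ * ∑ a ∈ S, nll (p a) := by
  by_cases hp : ∃ a ∈ S, p a ≤ 0
  · obtain ⟨a, ha, hpa⟩ := hp
    rw [ENNReal.sum_eq_top.2 ⟨a, ha, by simp [nll, hpa]⟩, ENNReal.mul_top (by simp)]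
    exact le_top
  push Not at hp
  have hc : (0 : ℝ) < S.card := Nat.cast_pos.2 hS.card_pos
  have hle : ∀ a, p a ≤ 1 := fun a =>
    (Finset.single_le_sum (fun b _ => h0 b) (Finset.mem_univ a)).trans h1
  have hsum : ∑ a ∈ S, nll (p a) = ENNReal.ofReal (∑ a ∈ S, -Real.log (p a)) := by
    rw [ENNReal.ofReal_sum_of_nonneg fun a _ => neg_nonneg.2 (Real.log_nonpos (h0 a) (hle a))]
    exact Finset.sum_congr rfl fun a ha => by simp [nll, hp a ha]
  rw [hsum, ← ENNReal.ofReal_natCast, ← ENNReal.ofReal_inv_of_pos hc,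
    ← ENNReal.ofReal_mul (inv_nonneg.2 hc.le)]
  refine ENNReal.ofReal_le_ofReal ?_
  rw [inv_mul_eq_div, le_div_iff₀ hc]
  have h2 : ∑ a ∈ S, (Real.log S.card + Real.log (p a)) ≤ ∑ a ∈ S, (S.card * p a - 1) :=
    Finset.sum_le_sum fun a ha => by
      rw [← Real.log_mul hc.ne' (hp a ha).ne']
      exact Real.log_le_sub_one_of_pos (mul_pos hc (hp a ha))
  have h3 : ∑ a ∈ S, p a ≤ 1 :=
    (Finset.sum_le_sum_of_subset_of_nonneg (Finset.subset_univ S) fun a _ _ => h0 a).trans h1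
  simp only [Finset.sum_add_distrib, Finset.sum_sub_distrib, Finset.sum_const, nsmul_eq_mul,
    ← Finset.mul_sum, mul_one] at h2
  rw [Finset.sum_neg_distrib]
  nlinarith

end Loss

end Causal

/-! ### Trees of uniform choices: optimal loss and greedy decoding. -/

/-- `UniformTree good pre Φ`: the functional `Φ` is the expectation for a random continuation of
`pre` each of whose tokens is uniform on a finite set `S`, given the sentence `z` before it, where
`good z S` holds. -/
inductive UniformTree {A : Type} (good : List A → Finset A → Prop) :
    List A → ((List A → ℝ≥0∞) → ℝ≥0∞) → Prop
  | done (pre : List A) : UniformTree good pre fun f => f []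
  | step (pre : List A) (S : Finset A) (hS : S.Nonempty) (h : good pre S)
      (Φ : A → (List A → ℝ≥0∞) → ℝ≥0∞) (hΦ : ∀ a ∈ S, UniformTree good (pre ++ [a]) (Φ a)) :
      UniformTree good pre fun f => (S.card : ℝ≥0∞)⁻¹ * ∑ a ∈ S, Φ a fun y => f (a :: y)

open Classical in
/-- The continuation `y` has positive probability. -/
def IsLeaf {A : Type} (Φ : (List A → ℝ≥0∞) → ℝ≥0∞) (y : List A) : Prop :=
  Φ (fun x => if x = y then 1 else 0) ≠ 0

namespace UniformTree

variable {A : Type} {good : List A → Finset A → Prop} {pre : List A}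
  {Φ : (List A → ℝ≥0∞) → ℝ≥0∞}

theorem isLeaf_done {y : List A} : IsLeaf (fun f : List A → ℝ≥0∞ => f []) y ↔ y = [] := by
  simp [IsLeaf, eq_comm]

open Classical in
theorem isLeaf_cons {S : Finset A} {Φ : A → (List A → ℝ≥0∞) → ℝ≥0∞} {a : A} (ha : a ∈ S)
    {y : List A} (h : IsLeaf (Φ a) y) :
    IsLeaf (fun f => (S.card : ℝ≥0∞)⁻¹ * ∑ a ∈ S, Φ a fun y => f (a :: y)) (a :: y) := by
  simp only [IsLeaf, mul_ne_zero_iff, ne_eq, ENNReal.inv_eq_zero, ENNReal.natCast_ne_top,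
    not_false_eq_true, true_and, Finset.sum_eq_zero_iff, not_forall]
  refine ⟨a, ha, ?_⟩
  convert h using 4
  exact if_congr (by simp) rfl rfl

theorem exists_isLeaf (h : UniformTree good pre Φ) : ∃ y, IsLeaf Φ y := by
  induction h with
  | done pre => exact ⟨[], isLeaf_done.2 rfl⟩
  | step pre S hS h Φ hΦ ih =>
    obtain ⟨a, ha⟩ := hS
    obtain ⟨y, hy⟩ := ih a ha
    exact ⟨a :: y, isLeaf_cons ha hy⟩

/-- The functional has total mass one. This suffices to split off the cost of the first token, which
is constant on the subtree below it. -/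
theorem map_const_add (h : UniformTree good pre Φ) (c : ℝ≥0∞) (f : List A → ℝ≥0∞) :
    Φ (fun y => c + f y) = c + Φ f := by
  induction h generalizing f with
  | done pre => rfl
  | step pre S hS h Φ hΦ ih =>
    beta_reduce
    rw [Finset.sum_congr rfl fun a ha => ih a ha fun y => f (a :: y), Finset.sum_add_distrib,
      mul_add, Finset.sum_const, nsmul_eq_mul, ← mul_assoc, ENNReal.inv_mul_cancel (by simpa using
        hS.ne_empty) (ENNReal.natCast_ne_top _), one_mul]

/-- At each node the uniform prediction costs exactly `log |S|`, the lower bound for any predictor;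
the subtrees are handled by induction. The bound on the leaves keeps all nodes within the window,
where `P₀` is known. -/
theorem logCost_le [Fintype A] (h : UniformTree good pre Φ) {T : ℕ} {P₀ P : List A → A → ℝ}
    (hP₀ : ∀ z S, z.length ≤ T → good z S → ∀ a ∈ S, P₀ z a = (S.card : ℝ)⁻¹)
    (h0 : ∀ z a, 0 ≤ P z a) (h1 : ∀ z, ∑ a, P z a ≤ 1)
    (hT : ∀ y, IsLeaf Φ y → pre.length + y.length ≤ T) :
    Φ (Causal.logCost P₀ pre) ≤ Φ (Causal.logCost P pre) := by
  induction h with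
  | done pre => rfl
  | step pre S hS h Φ hΦ ih =>
    have hpre : pre.length ≤ T := by
      obtain ⟨y, hy⟩ := exists_isLeaf (step pre S hS h Φ hΦ)
      exact (Nat.le_add_right _ _).trans (hT y hy)
    simp only [Causal.logCost]
    rw [Finset.sum_congr rfl fun a ha => (hΦ a ha).map_const_add _ _,
      Finset.sum_congr rfl fun a ha => (hΦ a ha).map_const_add (Causal.nll (P pre a)) _,
      Finset.sum_add_distrib, Finset.sum_add_distrib, mul_add, mul_add]
    refine add_le_add ?_ (mul_le_mul_right (Finset.sum_le_sum fun a ha => ih a ha fun y hy => ?_) _)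
    · have hc : (0 : ℝ) < S.card := Nat.cast_pos.2 hS.card_pos
      refine le_trans (le_of_eq ?_) (Causal.ofReal_log_card_le hS (h0 pre) (h1 pre))
      rw [Finset.sum_congr rfl fun a ha => by rw [hP₀ pre S hpre h a ha], Finset.sum_const,
        nsmul_eq_mul, ← mul_assoc, ENNReal.inv_mul_cancel (by simpa using hS.ne_empty)
        (ENNReal.natCast_ne_top _), one_mul, Causal.nll, if_neg (by simpa using hS.ne_empty), Real.log_inv,
        neg_neg]
    · have := hT _ (isLeaf_cons ha hy)
      simp only [List.length_append, List.length_cons, List.length_nil] at this ⊢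
      lia

end UniformTree

theorem argmaxSet_nonempty {ι : Type} [Fintype ι] [Nonempty ι] (x : ι → ℝ) :
    (argmaxSet x).Nonempty := by
  obtain ⟨m, hm⟩ := Finite.exists_max x
  exact ⟨m, by simpa [argmaxSet] using hm⟩

/-- Whatever the tie-breaking rule picks is a child of the current node, so decoding walks down the
tree. By `hans` the stopping test succeeds exactly at leaves. -/
theorem UniformTree.exists_greedyFrom_eq {V C : Type} [Fintype V] [DecidableEq V] [Fintype C]
    [DecidableEq C] {D : Causal V C} {good : List D.Tok → Finset D.Tok → Prop} {pre : List D.Tok}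
    {Φ : (List D.Tok → ℝ≥0∞) → ℝ≥0∞} (h : UniformTree good pre Φ) {T : ℕ}
    {P : List D.Tok → D.Tok → ℝ} (hP : ∀ z S, z.length ≤ T → S.Nonempty → good z S → argmaxSet (P z) ⊆ S)
    {pick : List D.Tok → Finset D.Tok → D.Tok} (hpick : D.IsTieBreak pick) {inp out : List D.Tok}
    (hpre : pre = inp ++ out) {n : ℕ} (hn : T ≤ pre.length + n)
    (hT : ∀ y, IsLeaf Φ y → pre.length + y.length ≤ T)
    (hans : ∀ y, IsLeaf Φ y → ∀ i ≤ y.length,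
      (D.Answered inp (out ++ y.take i) ↔ i = y.length)) :
    ∃ y, IsLeaf Φ y ∧ D.greedyFrom P pick inp n out = out ++ y := by
  induction h generalizing n out with
  | done pre =>
    refine ⟨[], isLeaf_done.2 rfl, ?_⟩
    have := hans [] (isLeaf_done.2 rfl) 0 le_rfl
    cases n with
    | zero => simp [Causal.greedyFrom]
    | succ n =>
      rw [Causal.greedyFrom, if_pos (by simpa using this)]
      simp
  | step pre S hS h Φ hΦ ih =>
    obtain ⟨b, hb⟩ := id hS
    obtain ⟨y, hy⟩ := (hΦ b hb).exists_isLeaf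
    have hlen := hT _ (isLeaf_cons hb hy)
    have hna := hans _ (isLeaf_cons hb hy) 0 (by simp)
    rw [List.length_cons] at hlen
    -- Some leaf lies strictly below this node and still fits into the window, so the token budget
    -- is not exhausted.
    obtain ⟨n, rfl⟩ : ∃ k, n = k + 1 := ⟨n - 1, by lia⟩
    have : Nonempty D.Tok := ⟨b⟩
    have ha := hP pre S (by lia) hS h (hpick pre _ (argmaxSet_nonempty (P pre)))
    set a := pick pre (argmaxSet (P pre)) with ha'
    rw [Causal.greedyFrom, if_neg (by simpa using hna), ← hpre, ← ha']
    obtain ⟨w, hw, hg⟩ := ih a ha (out := out ++ [a]) (n := n) (by rw [hpre, List.append_assoc])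
      (by simp only [List.length_append, List.length_cons, List.length_nil]; lia)
      (fun w hw => by
        have := hT _ (isLeaf_cons ha hw)
        simp only [List.length_append, List.length_cons, List.length_nil] at this ⊢
        lia)
      (fun w hw i hi => by
        have := hans _ (isLeaf_cons ha hw) (i + 1) (by simpa using hi)
        simpa using this)
    exact ⟨a :: w, isLeaf_cons ha hw, by rw [hg]; simp⟩

/-! ### Elementary properties of hardmax and softmax. -/

section Hardmax

variable {ι : Type} [Fintype ι]

theorem mem_argmaxSet {x : ι → ℝ} {i : ι} : i ∈ argmaxSet x ↔ ∀ j, x j ≤ x i := by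
  simp [argmaxSet]

theorem hardmax_of_notMem {x : ι → ℝ} {i : ι} (h : i ∉ argmaxSet x) : hardmax ι x i = 0 := by
  simp [hardmax, h]

theorem hardmax_of_mem {x : ι → ℝ} {i : ι} (h : i ∈ argmaxSet x) :
    hardmax ι x i = ((argmaxSet x).card : ℝ)⁻¹ := by
  simp [hardmax, h]

theorem hardmax_nonneg (x : ι → ℝ) (i : ι) : 0 ≤ hardmax ι x i := by
  rw [hardmax]
  split_ifs <;> positivity

theorem sum_hardmax [Nonempty ι] (x : ι → ℝ) : ∑ i, hardmax ι x i = 1 := by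
  classical
  have h : ((argmaxSet x).card : ℝ) ≠ 0 := by
    simpa using (argmaxSet_nonempty x).ne_empty
  simp [hardmax, h]

theorem softmaxAt_nonneg (β : ℝ) (x : ι → ℝ) (i : ι) : 0 ≤ softmaxAt β ι x i := by
  rw [softmaxAt]
  positivity

theorem sum_softmaxAt [Nonempty ι] (β : ℝ) (x : ι → ℝ) : ∑ i, softmaxAt β ι x i = 1 := by
  simp only [softmaxAt, ← Finset.sum_div]
  exact div_self (Finset.sum_pos (fun _ _ => Real.exp_pos _) Finset.univ_nonempty).ne'

theorem sum_hardmax_smul_eq [Nonempty ι] {M : Type*} [AddCommGroup M] [Module ℝ M] {x : ι → ℝ}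
    {f : ι → M} {c : M} (h : ∀ i ∈ argmaxSet x, f i = c) : ∑ i, hardmax ι x i • f i = c := by
  have : ∀ i, hardmax ι x i • f i = hardmax ι x i • c := fun i => by
    by_cases hi : i ∈ argmaxSet x
    · rw [h i hi]
    · simp [hardmax_of_notMem hi]
  rw [Finset.sum_congr rfl fun i _ => this i, ← Finset.sum_smul, sum_hardmax, one_smul]

theorem inv_card_le_hardmax {x : ι → ℝ} {i : ι} (h : i ∈ argmaxSet x) :
    ((Fintype.card ι : ℝ))⁻¹ ≤ hardmax ι x i := by
  rw [hardmax_of_mem h]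
  have : 0 < (argmaxSet x).card := Finset.card_pos.2 ⟨i, h⟩
  gcongr
  exact Finset.card_le_univ _

theorem argmaxSet_eq {x : ι → ℝ} {S : Finset ι} {m : ℝ} (hS : S.Nonempty)
    (h1 : ∀ i ∈ S, x i = m) (h2 : ∀ i, i ∉ S → x i < m) : argmaxSet x = S := by
  ext i
  rw [mem_argmaxSet]
  obtain ⟨s, hs⟩ := hS
  constructor
  · intro h
    by_contra hi
    exact absurd (h s) (not_le.2 (h1 s hs ▸ h2 i hi))
  · intro hi j
    rw [h1 i hi]
    by_cases hj : j ∈ S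
    · exact (h1 j hj).le
    · exact (h2 j hj).le

end Hardmax

/-! ### Reduction of the hidden states to token and position coordinates. -/

namespace Transformer

open Matrix

/-- Coordinates in which the hidden states are read off: five blocks of token and position
directions. -/
abbrev Coord (A : Type) (T : ℕ) : Type := Fin 5 × (A ⊕ Fin T)

variable {A : Type} [Fintype A] [DecidableEq A] {d₁ T L H d₂ : ℕ}

/-- The matrix with orthonormal columns that places the token and position directions of each
coordinate block into the corresponding block of the hidden space. -/
def frame (E : Embeddings A d₁ T) : Matrix (HiddenIdx d₁) (Coord A T) ℝ := fun p i =>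
  if p.1 = i.1 then Sum.elim E.tok (fun t : Fin T => E.pos t) i.2 p.2 else 0

theorem frame_transpose_mulVec_apply (E : Embeddings A d₁ T) (x : HiddenIdx d₁ → ℝ)
    (i : Coord A T) : ((frame E)ᵀ *ᵥ x) i =
      ∑ k, Sum.elim E.tok (fun t : Fin T => E.pos t) i.2 k * x (i.1, k) := by
  simp only [mulVec, dotProduct, transpose_apply, frame, Fintype.sum_prod_type, ite_mul, zero_mul]
  rw [Finset.sum_comm]
  simp

theorem sum_tok_pos_mul (E : Embeddings A d₁ T) (f g : A ⊕ Fin T ⊕ A × Fin T) :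
    ∑ k, (Sum.elim E.tok (Sum.elim (fun t : Fin T => E.pos t)
        (fun p : A × Fin T => E.comp p.1 p.2)) f) k *
      (Sum.elim E.tok (Sum.elim (fun t : Fin T => E.pos t)
        (fun p : A × Fin T => E.comp p.1 p.2)) g) k = if f = g then 1 else 0 := by
  rw [← orthonormal_iff_ite.1 E.orthonormal f g]
  simp [PiLp.inner_apply, mul_comm]

theorem elim_tok_pos_eq (E : Embeddings A d₁ T) (f : A ⊕ Fin T) :
    (Sum.elim E.tok (fun t : Fin T => E.pos t) f) =
      (Sum.elim E.tok (Sum.elim (fun t : Fin T => E.pos t)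
        (fun p : A × Fin T => E.comp p.1 p.2)) (f.elim .inl fun t => .inr (.inl t))) := by
  rcases f with f | f <;> rfl

theorem frame_transpose_mul_frame (E : Embeddings A d₁ T) : (frame E)ᵀ * frame E = 1 := by
  ext ⟨b, f⟩ ⟨b', g⟩
  change ((frame E)ᵀ *ᵥ fun p => frame E p (b', g)) (b, f) = _
  rw [frame_transpose_mulVec_apply]
  by_cases hb : b = b'
  · subst hb
    simp only [frame, if_true, elim_tok_pos_eq, sum_tok_pos_mul, one_apply]
    rcases f with f | f <;> rcases g with g | g <;> simp
  · simp [frame, hb, one_apply]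

/-- The comprehensive embedding is orthogonal to all columns of the frame and disappears. -/
theorem frame_transpose_mulVec_embed (E : Embeddings A d₁ T) (a : A) (t : Fin T) :
    (frame E)ᵀ *ᵥ embed E a t = Pi.single (0, .inl a) 1 + Pi.single (0, .inr t) 1 := by
  ext ⟨b, f⟩
  rw [frame_transpose_mulVec_apply]
  by_cases hb : b = 0
  · subst hb
    have h1 := sum_tok_pos_mul E (f.elim .inl fun t => .inr (.inl t)) (.inl a)
    have h2 := sum_tok_pos_mul E (f.elim .inl fun t => .inr (.inl t)) (.inr (.inl t))
    have h3 := sum_tok_pos_mul E (f.elim .inl fun t => .inr (.inl t)) (.inr (.inr (a, t)))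
    simp only [embed, if_true, mul_add, Finset.sum_add_distrib]
    rw [elim_tok_pos_eq]
    simp only [Sum.elim_inl, Sum.elim_inr] at h1 h2 h3
    rw [h1, h2, h3]
    rcases f with f | f <;> simp [Pi.single_apply]
  · simp [embed, hb]

/-- The attention layer in the read-off coordinates, with score matrices `S` and value matrices
`W`. -/
def readLayer (sm : ∀ (ι : Type) [Fintype ι], (ι → ℝ) → ι → ℝ)
    (S W : Fin H → Matrix (Coord A T) (Coord A T) ℝ) (r : ℕ → Coord A T → ℝ) (t : ℕ) :
    Coord A T → ℝ :=
  r t + ∑ h : Fin H, ∑ i : Fin (t + 1),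
    sm (Fin (t + 1)) (fun j => r j ⬝ᵥ (S h *ᵥ r t)) i • (W h *ᵥ r i)

/-- The parameters that act as prescribed on the read-off coordinates. -/
def liftParams (E : Embeddings A d₁ T) (S W : Fin L → Fin H → Matrix (Coord A T) (Coord A T) ℝ)
    (W₁ : Matrix (A ⊕ Fin d₂) (Coord A T) ℝ) (b : A ⊕ Fin d₂ → ℝ)
    (W₂ : Matrix A (A ⊕ Fin d₂) ℝ) : TransformerParams A d₁ L H d₂ where
  WQ l h := frame E * S l h * (frame E)ᵀ
  WK _ _ := frame E * (frame E)ᵀ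
  WV l h := frame E * W l h * (frame E)ᵀ
  WO1 := W₁ * (frame E)ᵀ
  WB := b
  WO2 := W₂

/-- The lifted matrices read the state only through the transposed frame and write only into its
range. As the columns are orthonormal, the recursion closes up in the coordinates. -/
theorem frame_transpose_mulVec_layer (sm : ∀ (ι : Type) [Fintype ι], (ι → ℝ) → ι → ℝ)
    (E : Embeddings A d₁ T) (S W : Fin L → Fin H → Matrix (Coord A T) (Coord A T) ℝ)
    (W₁ : Matrix (A ⊕ Fin d₂) (Coord A T) ℝ) (b : A ⊕ Fin d₂ → ℝ) (W₂ : Matrix A (A ⊕ Fin d₂) ℝ)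
    (l : Fin L) (x : ℕ → HiddenIdx d₁ → ℝ) (t : ℕ) :
    (frame E)ᵀ *ᵥ layer sm ((liftParams E S W W₁ b W₂).WQ l) ((liftParams E S W W₁ b W₂).WK l)
      ((liftParams E S W W₁ b W₂).WV l) x t =
      readLayer sm (S l) (W l) (fun j => (frame E)ᵀ *ᵥ x j) t := by
  have hU : ∀ v : Coord A T → ℝ, (frame E)ᵀ *ᵥ (frame E *ᵥ v) = v := fun v => by
    rw [mulVec_mulVec, frame_transpose_mul_frame, one_mulVec]
  have hdot : ∀ v w : Coord A T → ℝ, (frame E *ᵥ v) ⬝ᵥ (frame E *ᵥ w) = v ⬝ᵥ w := fun v w => by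
    rw [dotProduct_mulVec, vecMul_mulVec, frame_transpose_mul_frame, ← dotProduct_mulVec,
      one_mulVec]
  simp only [layer, readLayer, liftParams, mulVec_add, mulVec_sum, mulVec_smul, ← mulVec_mulVec,
    hU, hdot]

end Transformer

/-! ### Attention heads in coordinates; copying the last marked token. -/

namespace Transformer

open Matrix

variable {A : Type} [Fintype A] [DecidableEq A] {d₁ T L H d₂ : ℕ}

theorem mlp_hidden_liftParams (sm : ∀ (ι : Type) [Fintype ι], (ι → ℝ) → ι → ℝ)
    (E : Embeddings A d₁ T) (S W : Fin 2 → Fin H → Matrix (Coord A T) (Coord A T) ℝ)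
    (W₁ : Matrix (A ⊕ Fin d₂) (Coord A T) ℝ) (b : A ⊕ Fin d₂ → ℝ) (W₂ : Matrix A (A ⊕ Fin d₂) ℝ)
    (z : List A) (t : ℕ) :
    mlp (liftParams E S W W₁ b W₂) (hidden sm E (liftParams E S W W₁ b W₂) z t) =
      W₂ *ᵥ fun i => max ((W₁ *ᵥ readLayer sm (S 1) (W 1) (readLayer sm (S 0) (W 0)
        fun j => (frame E)ᵀ *ᵥ embedSentence E z j) t + b) i) 0 := by
  have h : (frame E)ᵀ *ᵥ hidden sm E (liftParams E S W W₁ b W₂) z t =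
      readLayer sm (S 1) (W 1) (readLayer sm (S 0) (W 0)
        fun j => (frame E)ᵀ *ᵥ embedSentence E z j) t := by
    have hl : List.finRange 2 = [0, 1] := rfl
    simp only [hidden, hl, List.foldl_cons, List.foldl_nil, frame_transpose_mulVec_layer]
  have h' : (liftParams E S W W₁ b W₂).WO1 = W₁ * (frame E)ᵀ := rfl
  rw [mlp, h', ← mulVec_mulVec, h]
  rfl

/-- The score matrix of an attention head. The score of a key with token `a` at position `p` for a
query with token `b` is `G a b + F p b`; the token and position in the second block of coordinates
are taken into account by `J`, by `l` if the two tokens agree, and by `m` if the positions do. -/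
def scoreMatrix (G : A → A → ℝ) (F : ℕ → A → ℝ) (J : A → A → ℝ) (l m : ℝ) :
    Matrix (Coord A T) (Coord A T) ℝ := fun i j =>
  match i, j with
  | (0, .inl a), (0, .inl b) => G a b
  | (0, .inr p), (0, .inl b) => F p b
  | (1, .inl a), (0, .inl b) => J a b
  | (1, .inl a), (1, .inl b) => if a = b then l else 0
  | (1, .inr p), (1, .inr q) => if p = q then m else 0
  | _, _ => 0

/-- The value matrix that maps the tokens of the first two blocks by `G` and `J` into block `b`. -/
def valueMatrix (b : Fin 5) (G J : A → A → ℝ) : Matrix (Coord A T) (Coord A T) ℝ := fun i j =>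
  match i, j with
  | (c, .inl x), (0, .inl a) => if c = b then G x a else 0
  | (c, .inl x), (1, .inl a) => if c = b then J x a else 0
  | _, _ => 0

/-- The value matrix that copies the first block into the second one. -/
def copyMatrix : Matrix (Coord A T) (Coord A T) ℝ := fun i j =>
  match i, j with
  | (1, f), (0, g) => if f = g then 1 else 0
  | _, _ => 0

/-- The rows `g b` read the tokens of block `b`. -/
def rowMatrix {R : Type} (g : Fin 5 → R → A → ℝ) : Matrix R (Coord A T) ℝ := fun i j =>
  match j with
  | (b, .inl a) => g b i a
  | _ => 0

/-- The coordinates of token `a` at position `p`. -/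
def tokenState (a : A) (p : Fin T) : Coord A T → ℝ :=
  Pi.single (0, .inl a) 1 + Pi.single (0, .inr p) 1

/-- The coordinates of token `a` at position `p` with token `l` at position `q` copied into the
second block. -/
def pairState (a : A) (p : Fin T) (l : A) (q : Fin T) : Coord A T → ℝ :=
  tokenState a p + (Pi.single (1, .inl l) 1 + Pi.single (1, .inr q) 1)

theorem tokenState_score (G : A → A → ℝ) (F : ℕ → A → ℝ) (J : A → A → ℝ) (l m : ℝ)
    (a a' : A) (p p' : Fin T) :
    tokenState a p ⬝ᵥ (scoreMatrix G F J l m *ᵥ tokenState a' p') = G a a' + F p a' := by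
  simp [tokenState, mulVec_add, scoreMatrix]

theorem pairState_score (G : A → A → ℝ) (F : ℕ → A → ℝ) (J : A → A → ℝ) (l m : ℝ)
    (a a' k k' : A) (p p' q q' : Fin T) :
    pairState a p k q ⬝ᵥ (scoreMatrix G F J l m *ᵥ pairState a' p' k' q') =
      G a a' + F p a' + J k a' + (if k = k' then l else 0) + (if q = q' then m else 0) := by
  simp [pairState, tokenState, mulVec_add, scoreMatrix]
  ring

theorem copyMatrix_mulVec_tokenState (a : A) (p : Fin T) :
    copyMatrix *ᵥ tokenState a p = Pi.single (1, .inl a) 1 + Pi.single (1, .inr p) 1 := by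
  ext ⟨b, f⟩
  simp only [tokenState, mulVec_add, mulVec_single_one, Pi.add_apply, col_apply]
  fin_cases b <;> simp [copyMatrix, Pi.single_apply]

theorem valueMatrix_mulVec_pairState (b c : Fin 5) (G J : A → A → ℝ) (a k x : A) (p q : Fin T) :
    (valueMatrix b G J *ᵥ pairState a p k q) (c, .inl x) = if c = b then G x a + J x k else 0 := by
  simp only [pairState, tokenState, mulVec_add, mulVec_single_one, Pi.add_apply, col_apply]
  simp only [valueMatrix]
  split_ifs <;> simp

theorem rowMatrix_mulVec {R : Type} (g : Fin 5 → R → A → ℝ) (r : Coord A T → ℝ) (i : R) :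
    (rowMatrix g *ᵥ r) i = ∑ b, ∑ x, g b i x * r (b, .inl x) := by
  simp [mulVec, dotProduct, rowMatrix, Fintype.sum_prod_type]

/-- The last position up to `t` at which `P` holds. -/
def lastPos (P : ℕ → Prop) (t : ℕ) : ℕ := @Nat.findGreatest P (Classical.decPred P) t

theorem lastPos_le (P : ℕ → Prop) (t : ℕ) : lastPos P t ≤ t :=
  @Nat.findGreatest_le _ (Classical.decPred P) t

theorem lastPos_spec {P : ℕ → Prop} (h : P 0) (t : ℕ) : P (lastPos P t) :=
  @Nat.findGreatest_spec _ P (Classical.decPred P) _ (Nat.zero_le t) h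

theorem le_lastPos {P : ℕ → Prop} {i t : ℕ} (hi : i ≤ t) (h : P i) : i ≤ lastPos P t :=
  @Nat.le_findGreatest _ _ (Classical.decPred P) _ hi h

-- Positions are smaller than `T`, so the bonus `T` puts every token satisfying `P` ahead of all
-- others, and the position term then selects the latest one. The maximizer is unique, so hardmax
-- copies a single state.
open Classical in
theorem readLayer_copy_last (P : A → Prop) {tok : ℕ → A} {n : ℕ} (hnT : n ≤ T) (h0 : P (tok 0))
    {r : ℕ → Coord A T → ℝ} (hr : ∀ j (hj : j < n), r j = tokenState (tok j) ⟨j, hj.trans_le hnT⟩)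
    {t : ℕ} (ht : t < n) :
    readLayer (H := 4) hardmax
      (fun _ => scoreMatrix (fun a _ => if P a then (T : ℝ) else 0) (fun p _ => p) 0 0 0)
      ![copyMatrix, 0, 0, 0] r t =
      pairState (tok t) ⟨t, ht.trans_le hnT⟩ (tok (lastPos (fun j => P (tok j)) t))
        ⟨lastPos (fun j => P (tok j)) t, (lastPos_le _ t).trans_lt (ht.trans_le hnT)⟩ := by
  set p := lastPos (fun j => P (tok j)) t with hp
  have hpt : p ≤ t := lastPos_le _ t
  have hPp : P (tok p) := lastPos_spec (P := fun j => P (tok j)) h0 t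
  rw [readLayer, Fin.sum_univ_four]
  simp only [cons_val, zero_mulVec, smul_zero, Finset.sum_const_zero, add_zero]
  rw [hr t ht, pairState]
  congr 1
  refine sum_hardmax_smul_eq fun i hi => ?_
  rw [mem_argmaxSet] at hi
  have hip := hi ⟨p, by lia⟩
  have hin : (i : ℕ) < n := by lia
  simp only [hr p (by lia), hr i hin, tokenState_score, hPp, if_true] at hip
  have hiT : (i : ℝ) < T := by exact_mod_cast hin.trans_le hnT
  have hp0 : (0 : ℝ) ≤ p := Nat.cast_nonneg p
  have hPi : P (tok i) := by
    by_contra hPi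
    rw [if_neg hPi] at hip
    linarith
  rw [if_pos hPi] at hip
  have hle : p ≤ i := by exact_mod_cast (add_le_add_iff_left (T : ℝ)).1 hip
  have hge : (i : ℕ) ≤ p := le_lastPos (P := fun j => P (tok j)) (by lia) hPi
  have e : (i : ℕ) = p := le_antisymm hge hle
  rw [hr i hin, copyMatrix_mulVec_tokenState]
  simp only [e, hp]

/-- The value read from block `b` after the second layer. -/
theorem readLayer_value {S W : Fin 4 → Matrix (Coord A T) (Coord A T) ℝ}
    {r : ℕ → Coord A T → ℝ} {tok lst : ℕ → A} {t : ℕ} {pos lpos : ∀ j, j ≤ t → Fin T}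
    (hr : ∀ j (hj : j ≤ t), r j = pairState (tok j) (pos j hj) (lst j) (lpos j hj))
    {b : Fin 4 → Fin 5} {G J : Fin 4 → A → A → ℝ}
    (hW : ∀ h, W h = valueMatrix (b h) (G h) (J h)) (c : Fin 5) (x : A) :
    readLayer hardmax S W r t (c, .inl x) =
      (if c = 0 ∧ x = tok t ∨ c = 1 ∧ x = lst t then 1 else 0) +
      ∑ h : Fin 4, if c = b h then ∑ i : Fin (t + 1),
        hardmax (Fin (t + 1)) (fun j => r j ⬝ᵥ (S h *ᵥ r t)) i * (G h x (tok i) + J h x (lst i))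
        else 0 := by
  have hrt : r t (c, .inl x) = if c = 0 ∧ x = tok t ∨ c = 1 ∧ x = lst t then 1 else 0 := by
    rw [hr t le_rfl]
    by_cases h0 : c = 0
    · simp [pairState, tokenState, Pi.single_apply, h0]
    · simp [pairState, tokenState, Pi.single_apply, h0]
  simp only [readLayer, Pi.add_apply, Finset.sum_apply, Pi.smul_apply, smul_eq_mul, hrt, hW]
  congr 1
  refine Finset.sum_congr rfl fun h _ => ?_
  have hi : ∀ i : Fin (t + 1), (valueMatrix (b h) (G h) (J h) *ᵥ r i) (c, .inl x) =
      if c = b h then G h x (tok i) + J h x (lst i) else 0 := fun i => by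
    rw [hr i (by lia), valueMatrix_mulVec_pairState]
  simp only [hi]
  split_ifs
  · rfl
  · simp

end Transformer

/-! ### The explicit parameters and their output. -/

namespace Causal

open Transformer Matrix

variable {V C : Type} [Fintype V] [DecidableEq V] [Fintype C] [DecidableEq C] (D : Causal V C)

/-- The token is a vertex. -/
def IsVtx (a : D.Tok) : Prop := ∃ v, a = Token.vtx v

/-- The token is a vertex of the graph. -/
def IsGraphVtx (a : D.Tok) : Prop := ∃ v ∈ D.verts, a = Token.vtx v

/-- The token is a contextual token. -/
def IsCtx (a : D.Tok) : Prop := ∃ c, a = Token.ctx c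

/-- The token is a value. -/
def IsVal (a : D.Tok) : Prop := ∃ q, a = Token.val q

/-- The two tokens are contextual tokens of the same vertex. -/
def SameContext (a b : D.Tok) : Prop :=
  ∃ v, ∃ c ∈ D.cont v, ∃ c' ∈ D.cont v, a = Token.ctx c ∧ b = Token.ctx c'

/-- The pairs of an edge and a value of its parent, which index hidden units. -/
def edgeValues : Finset (Σ _ : V × V, D.Value) := D.edges.sigma fun e => D.valueSet e.1

/-- The summand `D.verts.card` of the width is slack; surplus units belong to no pair and have
output weight zero. -/
theorem card_edgeValues_le : D.edgeValues.card ≤ D.mlpExtra := by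
  rw [edgeValues, Finset.card_sigma, mlpExtra]
  refine le_add_left (Finset.sum_le_sum fun e _ => ?_)
  refine Finset.card_le_card_of_injOn Subtype.val (fun q hq => ?_) Subtype.val_injective.injOn
  simpa [valueSet] using hq

/-- The edge and value to which a hidden unit responds. -/
def unitOf (k : Fin D.mlpExtra) : Option (Σ _ : V × V, D.Value) := D.edgeValues.toList[(k : ℕ)]?

theorem unitOf_mem {k : Fin D.mlpExtra} {x : Σ _ : V × V, D.Value} (h : D.unitOf k = some x) :
    x ∈ D.edgeValues := by
  simpa using List.mem_of_getElem? h

theorem exists_unitOf {x : Σ _ : V × V, D.Value} (hx : x ∈ D.edgeValues) :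
    ∃ k, D.unitOf k = some x := by
  obtain ⟨i, hi, h⟩ := List.getElem_of_mem (Finset.mem_toList.2 hx)
  refine ⟨⟨i, ?_⟩, ?_⟩
  · rw [Finset.length_toList] at hi
    exact hi.trans_le D.card_edgeValues_le
  · rw [unitOf, List.getElem?_eq_getElem hi, h]

open Classical in
/-- Weights of the current token in the hidden units. -/
def currentRow : D.Tok ⊕ Fin D.mlpExtra → D.Tok → ℝ
  | .inl (.vtx v), .ctx c => if c ∈ D.cont v then 1 else 0
  | .inl .eq, .vtx _ => 1
  | .inl .cm, .val _ => 1
  | .inl (.val _), .eq => 1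
  | .inr _, .eq => 1
  | .inl a, b => if D.SameContext a b then 1 else 0
  | _, _ => 0

/-- Weights of the last vertex in the hidden units. -/
def lastRow : D.Tok ⊕ Fin D.mlpExtra → D.Tok → ℝ
  | .inl (.val q), .vtx v => if q ∈ D.valueSet v then 1 else 0
  | .inr k, a => match D.unitOf k with
    | some x => if a = .vtx x.1.2 then 1 else 0
    | none => 0
  | _, _ => 0

/-- Weights of the parent vertex and its value in the hidden units. -/
def parentRow : D.Tok ⊕ Fin D.mlpExtra → D.Tok → ℝ
  | .inl _, _ => 0
  | .inr k, a => match D.unitOf k with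
    | some x => (if a = .vtx x.1.1 then 1 else 0) + if a = .val x.2 then 1 else 0
    | none => 0

/-- A weight `w` from each token to its own hidden unit. -/
def diagRow (w : ℝ) : D.Tok ⊕ Fin D.mlpExtra → D.Tok → ℝ
  | .inl a, b => if a = b then w else 0
  | .inr _, _ => 0

/-- Biases of the hidden units. -/
def bias : D.Tok ⊕ Fin D.mlpExtra → ℝ
  | .inl (.val _) => -1
  | .inl _ => 0
  | .inr _ => -3

/-- Each token collects its own hidden unit and those of the edges that compute it. -/
def outputMatrix : Matrix D.Tok (D.Tok ⊕ Fin D.mlpExtra) ℝ := fun a i =>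
  match i with
  | .inl b => if a = b then 1 else 0
  | .inr k => match D.unitOf k with
    | some x => if a = .val (D.op x.1 x.2) then 1 else 0
    | none => 0

open Classical in
/-- The attention scores of the second layer. The heads find the contextual tokens after the same
last vertex, the tokens after the same occurrence of a vertex, and the last value of a vertex of
the graph. -/
def scores (T : ℕ) : Fin 4 → Matrix (Coord D.Tok T) (Coord D.Tok T) ℝ :=
  ![scoreMatrix (fun a _ => if D.IsCtx a then 1 else 0)
      (fun p b => if p = 0 ∧ b ≠ .cm then 5 else 0) (fun _ _ => 0) 1 0,
    scoreMatrix (fun _ _ => 0) (fun p b => if p = 0 ∧ ¬ D.IsCtx b then 5 else 0)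
      (fun _ _ => 0) 0 1,
    scoreMatrix (fun a _ => if D.IsVal a then T else 0) (fun p _ => p)
      (fun l _ => if D.IsGraphVtx l then T else 0) 0 0, 0]

open Classical in
/-- The values of the current tokens in the heads of the second layer. -/
def headValue : Fin 4 → D.Tok → D.Tok → ℝ :=
  ![fun x a => if D.SameContext x a then 1 else 0,
    fun x a => if x = a ∧ D.IsCtx a then 1 else 0,
    fun x a => if x = a ∧ D.IsVal a then 1 else 0, 0]

open Classical in
/-- The values of the last vertices in the heads of the second layer. -/
def headVertexValue : Fin 4 → D.Tok → D.Tok → ℝ :=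
  ![0, 0, fun x l => if x = l ∧ D.IsVtx l then 1 else 0, 0]

open Classical in
/-- Parameters that implement in-context chain reasoning. -/
def params {d₁ T : ℕ} (E : Embeddings D.Tok d₁ T) : TransformerParams D.Tok d₁ 2 4 D.mlpExtra :=
  liftParams E
    ![fun _ => scoreMatrix (fun a _ => if D.IsVtx a then (T : ℝ) else 0) (fun p _ => p)
      (fun _ _ => 0) 0 0, D.scores T]
    ![![copyMatrix, 0, 0, 0],
      fun h => valueMatrix (![2, 3, 4, 4] h) (D.headValue h) (D.headVertexValue h)]
    (rowMatrix ![D.currentRow, D.lastRow, D.diagRow 1, D.diagRow (-T), D.parentRow])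
    D.bias D.outputMatrix

/-- The last vertex token up to position `t`. -/
def lastTok (tok : ℕ → D.Tok) (t : ℕ) : D.Tok := tok (lastPos (fun j => D.IsVtx (tok j)) t)

open Classical in
/-- Attention scores of the head that finds the successor of a vertex. -/
def nextScore (tok : ℕ → D.Tok) (t : ℕ) (j : Fin (t + 1)) : ℝ :=
  (if D.IsCtx (tok j) then 1 else 0) + (if (j : ℕ) = 0 ∧ tok t ≠ .cm then 5 else 0) +
    if D.lastTok tok j = D.lastTok tok t then 1 else 0

open Classical in
/-- Attention scores of the head that finds the contextual tokens already used. -/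
def usedScore (tok : ℕ → D.Tok) (t : ℕ) (j : Fin (t + 1)) : ℝ :=
  (if (j : ℕ) = 0 ∧ ¬ D.IsCtx (tok t) then 5 else 0) +
    if lastPos (fun j => D.IsVtx (tok j)) j = lastPos (fun j => D.IsVtx (tok j)) t then 1 else 0

open Classical in
/-- Attention scores of the head that finds the parent of a vertex. -/
def parentScore (T : ℕ) (tok : ℕ → D.Tok) (t : ℕ) (j : Fin (t + 1)) : ℝ :=
  (if D.IsVal (tok j) then (T : ℝ) else 0) + j +
    if D.IsGraphVtx (D.lastTok tok j) then (T : ℝ) else 0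

/-- Output of the head that finds the successor of a vertex. -/
def nextRead (tok : ℕ → D.Tok) (t : ℕ) (x : D.Tok) : ℝ :=
  ∑ i, hardmax _ (D.nextScore tok t) i * D.headValue 0 x (tok i)

/-- Output of the head that finds the contextual tokens already used. -/
def usedRead (tok : ℕ → D.Tok) (t : ℕ) (x : D.Tok) : ℝ :=
  ∑ i, hardmax _ (D.usedScore tok t) i * D.headValue 1 x (tok i)

/-- Output of the head that finds the parent of a vertex. -/
def parentRead (T : ℕ) (tok : ℕ → D.Tok) (t : ℕ) (x : D.Tok) : ℝ :=
  ∑ i, hardmax _ (D.parentScore T tok t) i *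
    (D.headValue 2 x (tok i) + D.headVertexValue 2 x (D.lastTok tok i))

/-- Activation of the hidden unit of a token. -/
def tokenUnit (T : ℕ) (tok : ℕ → D.Tok) (t : ℕ) (a : D.Tok) : ℝ :=
  max (D.currentRow (.inl a) (tok t) + D.lastRow (.inl a) (D.lastTok tok t) +
    D.nextRead tok t a - T * D.usedRead tok t a + D.bias (.inl a)) 0

/-- Activation of the hidden unit of an edge and a value of its parent. -/
def edgeUnit (T : ℕ) (tok : ℕ → D.Tok) (t : ℕ) (x : Σ _ : V × V, D.Value) : ℝ :=
  max ((if tok t = .eq then 1 else 0) + (if D.lastTok tok t = .vtx x.1.2 then 1 else 0) +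
    (D.parentRead T tok t (.vtx x.1.1) + D.parentRead T tok t (.val x.2)) - 3) 0

theorem currentRow_inr (k : Fin D.mlpExtra) (b : D.Tok) :
    D.currentRow (.inr k) b = if b = .eq then 1 else 0 := by
  cases b <;> simp [currentRow]

/-- From here on the network is replaced by explicit sums over positions; matrices and embeddings no
longer occur in the analysis of predictions. -/
theorem mlp_hidden_params {d₁ T : ℕ} (E : Embeddings D.Tok d₁ T) {z : List D.Tok} {tok : ℕ → D.Tok}
    (hzT : z.length ≤ T) (htok : ∀ j < z.length, z[j]? = some (tok j)) (h0 : D.IsVtx (tok 0))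
    {t : ℕ} (ht : t < z.length) (a : D.Tok) :
    mlp (D.params E) (hidden hardmax E (D.params E) z t) a = D.tokenUnit T tok t a +
      ∑ k, match D.unitOf k with
        | some x => if a = .val (D.op x.1 x.2) then D.edgeUnit T tok t x else 0
        | none => 0 := by
  classical
  have hr0 : ∀ j (hj : j < z.length), (frame E)ᵀ *ᵥ embedSentence E z j =
      tokenState (tok j) ⟨j, hj.trans_le hzT⟩ := fun j hj => by
    rw [embedSentence, htok j hj]
    exact frame_transpose_mulVec_embed E (tok j) ⟨j, hj.trans_le hzT⟩
  rw [params, mlp_hidden_liftParams]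
  simp only [cons_val_zero, cons_val_one]
  set r := readLayer (H := 4) hardmax
      (fun _ => scoreMatrix (fun a _ => if D.IsVtx a then (T : ℝ) else 0) (fun p _ => p)
        (fun _ _ => 0) 0 0)
      ![copyMatrix, 0, 0, 0] fun j => (frame E)ᵀ *ᵥ embedSentence E z j with hr
  have hr1 : ∀ j (hj : j ≤ t), r j = pairState (tok j) ⟨j, (hj.trans_lt ht).trans_le hzT⟩
      (D.lastTok tok j) ⟨lastPos (fun j => D.IsVtx (tok j)) j,
        ((lastPos_le _ j).trans_lt (hj.trans_lt ht)).trans_le hzT⟩ := fun j hj =>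
    readLayer_copy_last D.IsVtx hzT h0 hr0 (hj.trans_lt ht)
  -- The five blocks hold the current token, the last vertex, and the outputs of the first three
  -- heads. The fourth head shares the last block but has zero values.
  have hread : ∀ (c : Fin 5) x, readLayer hardmax (D.scores T) (fun h => valueMatrix
      (![2, 3, 4, 4] h) (D.headValue h) (D.headVertexValue h)) r t (c, .inl x) =
      ![if x = tok t then 1 else 0, if x = D.lastTok tok t then 1 else 0, D.nextRead tok t x,
        D.usedRead tok t x, D.parentRead T tok t x] c := by
    intro c x
    rw [readLayer_value hr1 fun h => rfl, Fin.sum_univ_four]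
    have hs : ∀ h, (fun j : Fin (t + 1) => r j ⬝ᵥ (D.scores T h *ᵥ r t)) =
        (![D.nextScore tok t, D.usedScore tok t, D.parentScore T tok t, 0] : Fin 4 → _) h := by
      intro h
      funext j
      rw [hr1 j (by lia), hr1 t le_rfl]
      fin_cases h
      · simp [scores, pairState_score, nextScore]
      · simp [scores, pairState_score, usedScore]
      · simp [scores, pairState_score, parentScore]
      · simp [scores]
    simp only [hs]
    fin_cases c <;> simp [nextRead, usedRead, parentRead, headVertexValue]
    simp [headValue]
  have hsum : ∀ i : D.Tok ⊕ Fin D.mlpExtra, (rowMatrix ![D.currentRow, D.lastRow, D.diagRow 1,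
      D.diagRow (-T), D.parentRow] *ᵥ readLayer hardmax (D.scores T) (fun h => valueMatrix
      (![2, 3, 4, 4] h) (D.headValue h) (D.headVertexValue h)) r t) i =
      D.currentRow i (tok t) + D.lastRow i (D.lastTok tok t) +
        ∑ x, D.diagRow 1 i x * D.nextRead tok t x + ∑ x, D.diagRow (-T) i x * D.usedRead tok t x +
        ∑ x, D.parentRow i x * D.parentRead T tok t x := fun i => by
    rw [rowMatrix_mulVec, Fin.sum_univ_five]
    simp only [hread]
    simp
  rw [mulVec, dotProduct, Fintype.sum_sum_type]
  simp only [Pi.add_apply, hsum]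
  congr 1
  · simp [outputMatrix, tokenUnit, diagRow, parentRow, sub_eq_add_neg]
  · refine Finset.sum_congr rfl fun k _ => ?_
    rcases hk : D.unitOf k with _ | x
    · simp [outputMatrix, hk]
    · simp [outputMatrix, hk, edgeUnit, diagRow, parentRow, currentRow_inr, lastRow, bias, add_mul,
        Finset.sum_add_distrib, sub_eq_add_neg]

end Causal

/-! ### The maximal logits after a vertex, a value, a comma and a contextual token. -/

namespace Causal

open Transformer Matrix

variable {V C : Type} [Fintype V] [DecidableEq V] [Fintype C] [DecidableEq C] (D : Causal V C)

/-- The model with parameters `params` predicts the uniform distribution on `S` after `z`. -/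
def PredictsUniform {d₁ T : ℕ} (E : Embeddings D.Tok d₁ T) (z : List D.Tok) (S : Finset D.Tok) :
    Prop :=
  ∀ a, nextDist hardmax E (D.params E) z a = if a ∈ S then (S.card : ℝ)⁻¹ else 0

/-- The last layer input for the token `a`. -/
def logit (T : ℕ) (tok : ℕ → D.Tok) (t : ℕ) (a : D.Tok) : ℝ :=
  D.tokenUnit T tok t a + ∑ k, match D.unitOf k with
    | some x => if a = .val (D.op x.1 x.2) then D.edgeUnit T tok t x else 0
    | none => 0

section

variable {D} {T : ℕ} {tok : ℕ → D.Tok} {t : ℕ}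

/-- Each attended position contributes at most one, since no token is both a value and a vertex. -/
theorem parentRead_le_one (x : D.Tok) : D.parentRead T tok t x ≤ 1 := by
  rw [parentRead, ← sum_hardmax (D.parentScore T tok t)]
  refine Finset.sum_le_sum fun i _ => mul_le_of_le_one_right (hardmax_nonneg _ _) ?_
  simp only [headValue, headVertexValue, cons_val]
  split_ifs with h1 h2 h2
  · obtain ⟨h, q, hq⟩ := h1
    obtain ⟨h', v, hv⟩ := h2
    rw [← h', h, hq] at hv
    simp at hv
  all_goals norm_num

/-- An edge unit is an AND gate with four inputs and bias -3; without the input for `=` it stays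
closed. -/
theorem edgeUnit_eq_zero (ht : tok t ≠ .eq) (x : Σ _ : V × V, D.Value) :
    D.edgeUnit T tok t x = 0 := by
  rw [edgeUnit, if_neg ht]
  refine max_eq_right ?_
  have h1 := parentRead_le_one (D := D) (T := T) (tok := tok) (t := t) (.vtx x.1.1)
  have h2 := parentRead_le_one (D := D) (T := T) (tok := tok) (t := t) (.val x.2)
  split_ifs <;> linarith

theorem logit_eq_tokenUnit (ht : tok t ≠ .eq) (a : D.Tok) :
    D.logit T tok t a = D.tokenUnit T tok t a := by
  rw [logit, add_eq_left]
  refine Finset.sum_eq_zero fun k _ => ?_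
  split
  · simp [edgeUnit_eq_zero ht]
  · rfl

/-- Attention sink: unless the query is a comma, position 0 scores at least 5 while all others score
at most 2. The token there is a vertex, on which this head has value zero. -/
theorem nextRead_eq_zero (h0 : D.IsVtx (tok 0)) (ht : tok t ≠ .cm) (x : D.Tok) :
    D.nextRead tok t x = 0 := by
  refine sum_hardmax_smul_eq (x := D.nextScore tok t) (f := fun i => D.headValue 0 x (tok i))
    fun i hi => ?_
  have h := mem_argmaxSet.1 hi 0
  have hi0 : (i : ℕ) = 0 := by
    by_contra hi0
    rw [nextScore, nextScore, if_pos (c := ((0 : Fin (t + 1)) : ℕ) = 0 ∧ tok t ≠ .cm) ⟨rfl, ht⟩,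
      if_neg (c := (i : ℕ) = 0 ∧ tok t ≠ .cm) fun h => hi0 h.1] at h
    split_ifs at h <;> norm_num at h
  obtain ⟨v, hv⟩ := h0
  simp [headValue, hi0, hv, SameContext]

/-- The same sink at position 0; here the competing scores are at most 1. -/
theorem usedRead_eq_zero (h0 : D.IsVtx (tok 0)) (ht : ¬ D.IsCtx (tok t)) (x : D.Tok) :
    D.usedRead tok t x = 0 := by
  refine sum_hardmax_smul_eq (x := D.usedScore tok t) (f := fun i => D.headValue 1 x (tok i))
    fun i hi => ?_
  have h := mem_argmaxSet.1 hi 0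
  have hi0 : (i : ℕ) = 0 := by
    by_contra hi0
    rw [usedScore, usedScore, if_pos (c := ((0 : Fin (t + 1)) : ℕ) = 0 ∧ ¬ D.IsCtx (tok t))
      ⟨rfl, ht⟩, if_neg (c := (i : ℕ) = 0 ∧ ¬ D.IsCtx (tok t)) fun h => hi0 h.1] at h
    split_ifs at h <;> norm_num at h
  obtain ⟨v, hv⟩ := h0
  simp [headValue, hi0, hv, IsCtx]

/-- With bias -1 the unit of a value needs both `=` and the last vertex, so away from `=` it stays
below the winning logit 1. The bound has the form that simplification leaves of this claim. -/
theorem lastRow_val_lt (q : D.Value) (l : D.Tok) : D.lastRow (.inl (.val q)) l < 1 + 1 := by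
  cases l <;> simp only [lastRow] <;> try norm_num
  split_ifs <;> norm_num

theorem argmaxSet_logit_vtx (h0 : D.IsVtx (tok 0)) {v : V} (ht : tok t = .vtx v) :
    argmaxSet (D.logit T tok t) = {.eq} := by
  refine argmaxSet_eq (m := 1) (Finset.singleton_nonempty _) (fun a ha => ?_) fun a ha => ?_ <;>
  rw [logit_eq_tokenUnit (by simp [ht]), tokenUnit, nextRead_eq_zero h0 (by simp [ht]),
    usedRead_eq_zero h0 (by simp [ht, IsCtx]), ht]
  · rw [Finset.mem_singleton.1 ha]
    simp [currentRow, lastRow, bias]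
  · cases a
    case val q => simpa [currentRow, bias, SameContext] using lastRow_val_lt q (D.lastTok tok t)
    all_goals simp_all [currentRow, lastRow, bias, SameContext]

theorem argmaxSet_logit_val (h0 : D.IsVtx (tok 0)) {q : D.Value} (ht : tok t = .val q) :
    argmaxSet (D.logit T tok t) = {.cm} := by
  refine argmaxSet_eq (m := 1) (Finset.singleton_nonempty _) (fun a ha => ?_) fun a ha => ?_ <;>
  rw [logit_eq_tokenUnit (by simp [ht]), tokenUnit, nextRead_eq_zero h0 (by simp [ht]),
    usedRead_eq_zero h0 (by simp [ht, IsCtx]), ht]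
  · rw [Finset.mem_singleton.1 ha]
    simp [currentRow, lastRow, bias]
  · cases a
    case val q => simpa [currentRow, bias, SameContext] using lastRow_val_lt q (D.lastTok tok t)
    all_goals simp_all [currentRow, lastRow, bias, SameContext]

/-- Contextual tokens behind the same vertex attain the top score 2. By `hall` all of them belong to
`v`, and each votes for the whole set `D.cont v`; hence the average of the votes is the indicator of
that set. -/
theorem argmaxSet_logit_cm (h0 : D.IsVtx (tok 0)) (ht : tok t = .cm) {v : V}
    (hex : ∃ j ≤ t, D.IsCtx (tok j) ∧ D.lastTok tok j = D.lastTok tok t)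
    (hall : ∀ j ≤ t, ∀ c, tok j = .ctx c → D.lastTok tok j = D.lastTok tok t → c ∈ D.cont v) :
    argmaxSet (D.logit T tok t) = (D.cont v).image .ctx := by
  classical
  have hread : ∀ x, D.nextRead tok t x = if x ∈ (D.cont v).image .ctx then 1 else 0 := by
    intro x
    refine sum_hardmax_smul_eq (x := D.nextScore tok t) (f := fun i => D.headValue 0 x (tok i))
      fun i hi => ?_
    obtain ⟨j, hj, hjc, hjl⟩ := hex
    have h := mem_argmaxSet.1 hi ⟨j, by lia⟩
    simp only [nextScore, ht, hjc, hjl] at h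
    have hi' : D.IsCtx (tok i) ∧ D.lastTok tok i = D.lastTok tok t := by
      simp at h
      split_ifs at h with h1 h2 h2 <;> first | exact ⟨h1, h2⟩ | norm_num at h
    obtain ⟨⟨c, hc⟩, hl⟩ := hi'
    have hcv := hall i (by lia) c hc hl
    rw [hc]
    refine if_congr ?_ rfl rfl
    simp only [SameContext, Finset.mem_image]
    constructor
    · rintro ⟨v', c', hc', c'', hc'', rfl, h⟩
      obtain rfl : c = c'' := by simpa using h
      obtain rfl : v' = v := by
        by_contra hv
        exact Finset.disjoint_left.1 (D.cont_disjoint _ _ hv) hc'' hcv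
      exact ⟨c', hc', rfl⟩
    · rintro ⟨c', hc', rfl⟩
      exact ⟨v, c', hc', c, hcv, rfl, rfl⟩
  refine argmaxSet_eq (m := 1) ((D.cont_nonempty v).image _) (fun a ha => ?_) fun a ha => ?_ <;>
  rw [logit_eq_tokenUnit (by simp [ht]), tokenUnit, hread,
    usedRead_eq_zero h0 (by simp [ht, IsCtx]), ht]
  · obtain ⟨c, hc, rfl⟩ := Finset.mem_image.1 ha
    simp [currentRow, lastRow, bias, SameContext, hc]
  · cases a
    case val q => simpa [currentRow, bias, SameContext] using lastRow_val_lt q (D.lastTok tok t)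
    all_goals simp_all [currentRow, lastRow, bias, SameContext]

theorem lastPos_eq_iff {P : ℕ → Prop} (h0 : P 0) {i t : ℕ} (hi : i ≤ t) :
    lastPos P i = lastPos P t ↔ lastPos P t ≤ i := by
  constructor
  · intro h
    exact h ▸ lastPos_le P i
  · intro h
    exact le_antisymm (le_lastPos ((lastPos_le P i).trans hi) (lastPos_spec h0 i))
      (le_lastPos h (lastPos_spec h0 t))

/-- The current token votes for its vertex and for all contextual tokens of that vertex. The used
ones, collected in `u`, are cancelled by the negative weight of the second head. -/
theorem argmaxSet_logit_ctx (h0 : D.IsVtx (tok 0)) (htT : t < T) {v : V} {c : C}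
    (ht : tok t = .ctx c) (hc : c ∈ D.cont v) {u : Finset C}
    (hu : ∀ c', c' ∈ u ↔ ∃ i ≤ t, lastPos (fun j => D.IsVtx (tok j)) t ≤ i ∧ tok i = .ctx c') :
    argmaxSet (D.logit T tok t) = insert (.vtx v) ((D.cont v \ u).image .ctx) := by
  have harg : ∀ i, i ∈ argmaxSet (D.usedScore tok t) ↔
      lastPos (fun j => D.IsVtx (tok j)) t ≤ i := by
    intro i
    rw [← lastPos_eq_iff (P := fun j => D.IsVtx (tok j)) h0 (show (i : ℕ) ≤ t by lia),
      mem_argmaxSet]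
    have hctx : D.IsCtx (tok t) := ⟨c, ht⟩
    simp only [usedScore, hctx, not_true_eq_false, and_false, if_false, zero_add]
    constructor
    · intro h
      have := h ⟨t, by lia⟩
      simp only [if_true] at this
      by_contra hi
      rw [if_neg hi] at this
      norm_num at this
    · intro h j
      rw [if_pos h]
      split_ifs <;> norm_num
  have hread0 : ∀ c' ∉ u, D.usedRead tok t (.ctx c') = 0 := by
    intro c' hc'
    refine sum_hardmax_smul_eq (x := D.usedScore tok t)
      (f := fun i => D.headValue 1 (.ctx c') (tok i)) fun i hi => ?_
    have : (.ctx c' : D.Tok) ≠ tok i := fun h =>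
      hc' ((hu c').2 ⟨i, by lia, (harg i).1 hi, h.symm⟩)
    simp [headValue, this]
  -- The head averages over at most `t + 1 ≤ T` positions, so one occurrence has weight at least `1
  -- / T`; the factor `T` raises it to the 1 needed for cancellation.
  have hread1 : ∀ c' ∈ u, 1 ≤ T * D.usedRead tok t (.ctx c') := by
    intro c' hc'
    obtain ⟨i, hi, hli, htok⟩ := (hu c').1 hc'
    have hmem := (harg ⟨i, by lia⟩).2 hli
    have h1 : ((t + 1 : ℕ) : ℝ)⁻¹ ≤ D.usedRead tok t (.ctx c') := by
      refine le_trans ?_ (Finset.single_le_sum (f := fun i => hardmax _ (D.usedScore tok t) i *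
        D.headValue 1 (.ctx c') (tok i)) (fun j _ => mul_nonneg (hardmax_nonneg _ _) ?_)
        (Finset.mem_univ (⟨i, by lia⟩ : Fin (t + 1))))
      · have := inv_card_le_hardmax hmem
        rw [Fintype.card_fin] at this
        simpa [headValue, htok, IsCtx] using this
      · simp only [headValue, cons_val]
        split_ifs <;> norm_num
    have hT : ((t + 1 : ℕ) : ℝ) ≤ T := by exact_mod_cast htT
    have hpos : (0 : ℝ) < (t + 1 : ℕ) := by positivity
    calc (1 : ℝ) = (t + 1 : ℕ) * ((t + 1 : ℕ) : ℝ)⁻¹ := (mul_inv_cancel₀ hpos.ne').symm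
      _ ≤ T * D.usedRead tok t (.ctx c') := by gcongr
  have hown : ∀ v', c ∈ D.cont v' ↔ v' = v := fun v' => by
    refine ⟨fun h => ?_, fun h => h ▸ hc⟩
    by_contra hv
    exact Finset.disjoint_left.1 (D.cont_disjoint _ _ hv) h hc
  have hread2 : ∀ a, ¬ D.IsCtx a → D.usedRead tok t a = 0 := by
    intro a ha
    refine sum_hardmax_smul_eq (x := D.usedScore tok t)
      (f := fun i => D.headValue 1 a (tok i)) fun i hi => ?_
    have : ¬ (a = tok i ∧ D.IsCtx (tok i)) := fun h => ha (h.1 ▸ h.2)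
    simp [headValue, this]
  refine argmaxSet_eq (m := 1) (Finset.insert_nonempty _ _) (fun a ha => ?_) fun a ha => ?_ <;>
  rw [logit_eq_tokenUnit (by simp [ht]), tokenUnit, nextRead_eq_zero h0 (by simp [ht]), ht]
  · rcases Finset.mem_insert.1 ha with rfl | ha
    · rw [hread2 _ (by simp [IsCtx])]
      simp [currentRow, lastRow, bias, hc]
    · obtain ⟨c', hc', rfl⟩ := Finset.mem_image.1 ha
      rw [Finset.mem_sdiff] at hc'
      rw [hread0 c' hc'.2]
      have : D.SameContext (.ctx c') (.ctx c) := ⟨v, c', hc'.1, c, hc, rfl, rfl⟩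
      simp [currentRow, lastRow, bias, this]
  · cases a
    case ctx c' =>
      refine lt_of_eq_of_lt (max_eq_right ?_) one_pos
      by_cases hcu : c' ∈ u
      · have := hread1 c' hcu
        simp only [currentRow, lastRow, bias]
        split_ifs <;> linarith
      · rw [hread0 c' hcu]
        have : ¬ D.SameContext (.ctx c') (.ctx c) := by
          rintro ⟨v', c₁, hc₁, c₂, hc₂, h1, h2⟩
          simp only [Token.ctx.injEq] at h1 h2
          subst h1 h2
          obtain rfl := (hown v').1 hc₂
          exact ha (Finset.mem_insert_of_mem (Finset.mem_image_of_mem _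
            (Finset.mem_sdiff.2 ⟨hc₁, hcu⟩)))
        simp [currentRow, lastRow, bias, this]
    case vtx v' =>
      rw [hread2 _ (by simp [IsCtx])]
      simp_all [currentRow, lastRow, bias]
    case val q =>
      rw [hread2 _ (by simp [IsCtx])]
      simpa [currentRow, bias, SameContext] using lastRow_val_lt q (D.lastTok tok t)
    all_goals
      rw [hread2 _ (by simp [IsCtx])]
      simp [currentRow, lastRow, bias, SameContext]

end

end Causal

/-! ### The maximal logits after `=`. -/

namespace Causal

open Transformer Matrix

variable {V C : Type} [Fintype V] [DecidableEq V] [Fintype C] [DecidableEq C] (D : Causal V C)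

theorem op_mem_valueSet {e : V × V} (he : e ∈ D.edges) {q : D.Value} (hq : q ∈ D.valueSet e.1) :
    D.op e q ∈ D.valueSet e.2 := by
  have hmem := D.shift_vals e he q (by simpa [valueSet] using hq)
  have hmem' : (q : ℤ) + D.shift e ∈ Finset.univ.biUnion D.vals :=
    Finset.mem_biUnion.2 ⟨e.2, Finset.mem_univ _, hmem⟩
  simp only [valueSet, Finset.mem_filter, Finset.mem_univ, true_and, op, dif_pos hmem']
  exact hmem

section

variable {D} {T : ℕ} {tok : ℕ → D.Tok} {t : ℕ}

/-- A value of a graph vertex collects both bonuses `T`, which beats one bonus plus a position below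
`T`. Among such values the latest has the largest score and is the only maximizer. -/
theorem parentRead_eq (htT : t < T) {u : V} (hu : u ∈ D.verts) {q : D.Value} {j : ℕ} (hj : j ≤ t)
    (hjq : tok j = .val q) (hju : D.lastTok tok j = .vtx u)
    (hlast : ∀ i, j < i → i ≤ t → ¬ (D.IsVal (tok i) ∧ D.IsGraphVtx (D.lastTok tok i)))
    (x : D.Tok) :
    D.parentRead T tok t x = (if x = .val q then 1 else 0) + if x = .vtx u then 1 else 0 := by
  classical
  refine sum_hardmax_smul_eq (x := D.parentScore T tok t)
    (f := fun i => D.headValue 2 x (tok i) + D.headVertexValue 2 x (D.lastTok tok i))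
    fun i hi => ?_
  have h := mem_argmaxSet.1 hi ⟨j, by lia⟩
  have hv : D.IsVal (tok j) := ⟨q, hjq⟩
  have hg : D.IsGraphVtx (D.lastTok tok j) := ⟨u, hu, hju⟩
  have hij : (i : ℕ) = j := by
    have hiT : (i : ℝ) < T := by exact_mod_cast (show (i : ℕ) < T by lia)
    have hj0 : (0 : ℝ) ≤ j := Nat.cast_nonneg j
    simp only [parentScore, hv, hg, if_true] at h
    by_cases hi' : D.IsVal (tok i) ∧ D.IsGraphVtx (D.lastTok tok i)
    · rw [if_pos hi'.1, if_pos hi'.2] at h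
      have hle : j ≤ (i : ℕ) := by
        have : (j : ℝ) ≤ (i : ℕ) := by linarith
        exact_mod_cast this
      by_contra hne
      exact hlast i (by lia) (by lia) hi'
    · exfalso
      split_ifs at h with h1 h2 h2
      · exact hi' ⟨h1, h2⟩
      all_goals linarith
  have hv' : D.IsVal (.val q) := ⟨q, rfl⟩
  have hu' : D.IsVtx (.vtx u) := ⟨u, rfl⟩
  simp [headValue, headVertexValue, hij, hjq, hju, hv', hu']

/-- The token units give 1 to every value of `v`. If `(u, v)` is an edge, its unit for `q` lifts the
computed value above the others; if not, no unit of positive output weight fires and the tie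
remains. -/
theorem argmaxSet_logit_eq (h0 : D.IsVtx (tok 0)) (htT : t < T) (ht : tok t = .eq) {u v : V}
    (hv : D.lastTok tok t = .vtx v) (hu : u ∈ D.verts) {q : D.Value} {j : ℕ} (hj : j ≤ t)
    (hjq : tok j = .val q) (hju : D.lastTok tok j = .vtx u)
    (hlast : ∀ i, j < i → i ≤ t → ¬ (D.IsVal (tok i) ∧ D.IsGraphVtx (D.lastTok tok i)))
    (hq : q ∈ D.valueSet u) :
    argmaxSet (D.logit T tok t) =
      if (u, v) ∈ D.edges then {.val (D.op (u, v) q)} else (D.valueSet v).image .val := by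
  classical
  have hunit : ∀ x, D.edgeUnit T tok t x = if x = ⟨(u, v), q⟩ then 1 else 0 := by
    rintro ⟨⟨u', v'⟩, q'⟩
    rw [edgeUnit, parentRead_eq htT hu hj hjq hju hlast, parentRead_eq htT hu hj hjq hju hlast, ht,
      hv]
    by_cases h1 : u' = u <;> by_cases h2 : v' = v <;> by_cases h3 : q' = q <;>
      simp [h1, h2, h3, eq_comm (a := v)] <;> norm_num
  have htoken : ∀ a, D.tokenUnit T tok t a = if a ∈ (D.valueSet v).image .val then 1 else 0 := by
    intro a
    rw [tokenUnit, nextRead_eq_zero h0 (by simp [ht]), usedRead_eq_zero h0 (by simp [ht, IsCtx]),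
      ht, hv]
    cases a <;> simp [currentRow, lastRow, bias, SameContext]
    split_ifs <;> simp
  have hlogit : ∀ a, D.logit T tok t a = (if a ∈ (D.valueSet v).image .val then 1 else 0) +
      ∑ k, if D.unitOf k = some ⟨(u, v), q⟩ ∧ a = .val (D.op (u, v) q) then (1 : ℝ) else 0 := by
    intro a
    rw [logit, htoken]
    congr 1
    refine Finset.sum_congr rfl fun k _ => ?_
    rcases D.unitOf k with _ | x
    · simp
    · by_cases hx : x = ⟨(u, v), q⟩
      · subst hx
        simp [hunit]
      · simp [hunit, hx]
  split_ifs with he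
  · have hop : (Token.val (D.op (u, v) q) : D.Tok) ∈ (D.valueSet v).image Token.val :=
      Finset.mem_image_of_mem _ (D.op_mem_valueSet he hq)
    -- The sum counts the units attached to this edge and value; only its positivity matters.
    refine argmaxSet_eq (m := 1 + ∑ k, if D.unitOf k = some ⟨(u, v), q⟩ then (1 : ℝ) else 0)
      (Finset.singleton_nonempty _) (fun a ha => ?_) fun a ha => ?_
    · rw [Finset.mem_singleton.1 ha, hlogit, if_pos hop]
      simp
    · obtain ⟨k, hk⟩ := D.exists_unitOf (x := ⟨(u, v), q⟩)
        (by simpa [edgeValues] using ⟨he, hq⟩)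
      have h1 : (0 : ℝ) < ∑ k, if D.unitOf k = some ⟨(u, v), q⟩ then (1 : ℝ) else 0 :=
        Finset.sum_pos' (fun k _ => by split_ifs <;> norm_num)
          ⟨k, Finset.mem_univ k, by simp [hk]⟩
      rw [Finset.mem_singleton] at ha
      rw [hlogit]
      simp only [ha, and_false, if_false, Finset.sum_const_zero, add_zero]
      split_ifs <;> linarith
  · have hno : ∀ k, D.unitOf k ≠ some ⟨(u, v), q⟩ := fun k hk => by
      have := D.unitOf_mem hk
      simp only [edgeValues, Finset.mem_sigma] at this
      exact he this.1
    refine argmaxSet_eq (m := 1) ((D.valueSet_nonempty v).image _) (fun a ha => ?_)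
      fun a ha => ?_ <;> rw [hlogit] <;> simp [hno, ha]

end

/-! ### The information found by the heads, expressed by folds over the sentence. -/

/-- The last vertex read so far, after the token `a`. -/
def scanVtx (o : Option V) : D.Tok → Option V
  | .vtx v => some v
  | _ => o

/-- The tokens of a list with the last vertex up to each of them. -/
def annotate : Option V → List D.Tok → List (D.Tok × Option V)
  | _, [] => []
  | o, a :: z => (a, D.scanVtx o a) :: annotate (D.scanVtx o a) z

theorem annotate_append (o : Option V) (y z : List D.Tok) :
    D.annotate o (y ++ z) = D.annotate o y ++ D.annotate (y.foldl D.scanVtx o) z := by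
  induction y generalizing o with
  | nil => rfl
  | cons a y ih => simp [annotate, ih]

theorem length_annotate (o : Option V) (z : List D.Tok) : (D.annotate o z).length = z.length := by
  induction z generalizing o with
  | nil => rfl
  | cons a z ih => simp [annotate, ih]

theorem getElem?_annotate (o : Option V) (z : List D.Tok) (j : ℕ) :
    (D.annotate o z)[j]? = z[j]?.map fun a => (a, (z.take (j + 1)).foldl D.scanVtx o) := by
  induction z generalizing o j with
  | nil => simp [annotate]
  | cons a z ih =>
    cases j with
    | zero => simp [annotate]
    | succ j => simp [annotate, ih]

/-- The last graph vertex with its value, updated by an annotated token. -/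
def scanParent (o : Option (V × D.Value)) : D.Tok × Option V → Option (V × D.Value)
  | (.val q, some u) => if u ∈ D.verts then some (u, q) else o
  | _ => o

/-- Locates the occurrence remembered by the fold: behind it no value of a graph vertex appears.
This is the form in which the parent head needs it. -/
theorem exists_of_foldl_scanParent {l : List (D.Tok × Option V)} {u : V} {q : D.Value}
    (h : l.foldl D.scanParent none = some (u, q)) :
    u ∈ D.verts ∧ ∃ X Y, l = X ++ (.val q, some u) :: Y ∧
      ∀ p ∈ Y, ∀ u' ∈ D.verts, p.2 = some u' → ¬ D.IsVal p.1 := by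
  induction l using List.reverseRecOn with
  | nil => simp at h
  | append_singleton l p ih =>
    rw [List.foldl_append, List.foldl_cons, List.foldl_nil] at h
    by_cases hp : ∃ u' ∈ D.verts, ∃ q', p = (.val q', some u')
    · obtain ⟨u', hu', q', rfl⟩ := hp
      simp only [scanParent, hu', if_true, Option.some.injEq, Prod.mk.injEq] at h
      obtain ⟨rfl, rfl⟩ := h
      exact ⟨hu', l, [], by simp, by simp⟩
    · have hs : D.scanParent (l.foldl D.scanParent none) p = l.foldl D.scanParent none := by
        unfold scanParent
        split
        · rw [if_neg fun hu => hp ⟨_, hu, _, rfl⟩]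
        · rfl
      rw [hs] at h
      obtain ⟨hu, X, Y, rfl, hY⟩ := ih h
      refine ⟨hu, X, Y ++ [p], by simp, fun p' hp' u' hu' hpu => ?_⟩
      rcases List.mem_append.1 hp' with hp' | hp'
      · exact hY p' hp' u' hu' hpu
      · rw [List.mem_singleton] at hp'
        subst hp'
        rintro ⟨q', hq'⟩
        exact hp ⟨u', hu', q', Prod.ext hq' hpu⟩

section Sentence

variable {D} {d₁ T : ℕ} {E : Embeddings D.Tok d₁ T} {z : List D.Tok}

/-- Identifies the vertex copied by the first layer with the result of the fold. Since the sentence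
begins with a vertex, the fold is never empty. -/
theorem lastTok_getD (h0 : ∃ g, z.head? = some (.vtx g)) {j : ℕ} (hj : j < z.length) :
    ∃ w, (z.take (j + 1)).foldl D.scanVtx none = some w ∧
      D.lastTok (fun j => z.getD j .cm) j = .vtx w := by
  induction j with
  | zero =>
    obtain ⟨g, hg⟩ := h0
    rcases z with _ | ⟨a, z⟩
    · simp at hg
    · obtain rfl : a = .vtx g := by simpa using hg
      exact ⟨g, by simp [scanVtx], by simp [lastTok, Nat.le_zero.1 (lastPos_le _ 0)]⟩
  | succ j ih =>
    obtain ⟨w, hw, hl⟩ := ih (by lia)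
    rw [List.take_add_one, List.foldl_append, hw, List.getElem?_eq_getElem hj]
    simp only [Option.toList_some, List.foldl_cons, List.foldl_nil]
    have hget : z.getD (j + 1) .cm = z[j + 1] := by simp [List.getD, hj]
    by_cases hv : D.IsVtx z[j + 1]
    · obtain ⟨w', hw'⟩ := hv
      refine ⟨w', by simp [hw', scanVtx], ?_⟩
      have : lastPos (fun j => D.IsVtx (z.getD j .cm)) (j + 1) = j + 1 :=
        le_antisymm (lastPos_le _ _) (le_lastPos le_rfl ⟨w', hget.trans hw'⟩)
      rw [lastTok, this, hget, hw']
    · refine ⟨w, ?_, ?_⟩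
      · unfold scanVtx
        split
        · exact absurd ⟨_, by assumption⟩ hv
        · rfl
      · rw [← hl, lastTok, lastTok]
        congr 1
        refine @Nat.findGreatest_of_not _ (Classical.decPred _) j ?_
        rwa [hget]

theorem predictsUniform_of_argmaxSet (h0 : ∃ g, z.head? = some (.vtx g)) (hT : z.length ≤ T)
    {S : Finset D.Tok}
    (hS : argmaxSet (D.logit T (fun j => z.getD j .cm) (z.length - 1)) = S) :
    D.PredictsUniform E z S := by
  classical
  intro a
  obtain ⟨g, hg⟩ := h0
  have hz : 0 < z.length := by
    rcases z with _ | _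
    · simp at hg
    · simp
  have hl : mlp (D.params E) (hidden hardmax E (D.params E) z (z.length - 1)) =
      D.logit T (fun j => z.getD j .cm) (z.length - 1) := by
    funext b
    have h0 : z.getD 0 .cm = .vtx g := by
      rw [List.head?_eq_getElem?] at hg
      simp [hg]
    exact D.mlp_hidden_params E hT (tok := fun j => z.getD j .cm)
      (fun j hj => by simp [hj]) ⟨g, h0⟩ (by lia) b
  rw [nextDist, hl, hardmax, hS]
  congr

end Sentence

end Causal

/-! ### Predictions in terms of the sentence alone. -/

namespace Causal

open Transformer Matrix

variable {V C : Type} [Fintype V] [DecidableEq V] [Fintype C] [DecidableEq C] (D : Causal V C)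

section Sentence

variable {D} {d₁ T : ℕ} {E : Embeddings D.Tok d₁ T} {z y : List D.Tok}

theorem isVtx_getD_zero (h0 : ∃ g, z.head? = some (.vtx g)) : D.IsVtx (z.getD 0 .cm) := by
  obtain ⟨g, hg⟩ := h0
  exact ⟨g, by rw [List.head?_eq_getElem?] at hg; simp [hg]⟩

theorem mem_annotate_iff (h0 : ∃ g, z.head? = some (.vtx g)) {a : D.Tok} {w : V} :
    (a, some w) ∈ D.annotate none z ↔ ∃ j < z.length, z.getD j .cm = a ∧
      D.lastTok (fun j => z.getD j .cm) j = .vtx w := by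
  rw [List.mem_iff_getElem?]
  refine exists_congr fun j => ?_
  rw [getElem?_annotate]
  by_cases hj : j < z.length
  · obtain ⟨w', hw', hl⟩ := lastTok_getD h0 hj
    rw [hw', hl]
    simp [hj]
  · simp [hj]

theorem getD_length_sub_one {a : D.Tok} (hz : z = y ++ [a]) : z.getD (z.length - 1) .cm = a := by
  simp [hz, List.getD]

theorem predictsUniform_vtx {v : V} (hz : z = y ++ [.vtx v]) (h0 : ∃ g, z.head? = some (.vtx g))
    (hT : z.length ≤ T) : D.PredictsUniform E z {.eq} :=
  predictsUniform_of_argmaxSet h0 hT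
    (argmaxSet_logit_vtx (isVtx_getD_zero h0) (getD_length_sub_one hz))

theorem predictsUniform_val {q : D.Value} (hz : z = y ++ [.val q])
    (h0 : ∃ g, z.head? = some (.vtx g)) (hT : z.length ≤ T) : D.PredictsUniform E z {.cm} :=
  predictsUniform_of_argmaxSet h0 hT
    (argmaxSet_logit_val (isVtx_getD_zero h0) (getD_length_sub_one hz))

theorem lastTok_length_sub_one (h0 : ∃ g, z.head? = some (.vtx g)) {w : V}
    (hw : z.foldl D.scanVtx none = some w) :
    D.lastTok (fun j => z.getD j .cm) (z.length - 1) = .vtx w := by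
  have hz : 0 < z.length := by
    rcases z with _ | _
    · simp at hw
    · simp
  obtain ⟨w', hw', hl⟩ := lastTok_getD h0 (j := z.length - 1) (by lia)
  rw [Nat.sub_add_cancel hz, List.take_length, hw] at hw'
  rw [hl, Option.some.inj hw']

theorem predictsUniform_cm (hz : z = y ++ [.cm]) (h0 : ∃ g, z.head? = some (.vtx g))
    (hT : z.length ≤ T) {v w : V} (hw : z.foldl D.scanVtx none = some w)
    (hex : ∃ c, (.ctx c, some w) ∈ D.annotate none z)
    (hall : ∀ c, (.ctx c, some w) ∈ D.annotate none z → c ∈ D.cont v) :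
    D.PredictsUniform E z ((D.cont v).image .ctx) := by
  have hlen : z.length = y.length + 1 := by simp [hz]
  refine predictsUniform_of_argmaxSet h0 hT (argmaxSet_logit_cm (isVtx_getD_zero h0)
    (getD_length_sub_one hz) ?_ fun j hj c hc hjl => ?_)
  · obtain ⟨c, hc⟩ := hex
    obtain ⟨j, hj, hjc, hjl⟩ := (mem_annotate_iff h0).1 hc
    exact ⟨j, by lia, ⟨c, hjc⟩, hjl.trans (lastTok_length_sub_one h0 hw).symm⟩
  · exact hall c ((mem_annotate_iff h0).2
      ⟨j, by lia, hc, hjl.trans (lastTok_length_sub_one h0 hw)⟩)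

theorem predictsUniform_eq (hz : z = y ++ [.eq]) (h0 : ∃ g, z.head? = some (.vtx g))
    (hT : z.length ≤ T) {u v : V} {q : D.Value} (hv : z.foldl D.scanVtx none = some v)
    (hu : (D.annotate none z).foldl D.scanParent none = some (u, q)) (hq : q ∈ D.valueSet u) :
    D.PredictsUniform E z
      (if (u, v) ∈ D.edges then {.val (D.op (u, v) q)} else (D.valueSet v).image .val) := by
  have hlen : z.length = y.length + 1 := by simp [hz]
  obtain ⟨hu', X, Y, hXY, hY⟩ := D.exists_of_foldl_scanParent hu
  have hat : ∀ j (hj : j < z.length), ∃ w, (X ++ (.val q, some u) :: Y)[j]? =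
      some (z.getD j .cm, some w) ∧ D.lastTok (fun j => z.getD j .cm) j = .vtx w := by
    intro j hj
    obtain ⟨w, hw, hl⟩ := lastTok_getD h0 hj
    refine ⟨w, ?_, hl⟩
    rw [← hXY, getElem?_annotate, hw]
    simp [hj]
  have hlenXY := congrArg List.length hXY
  rw [length_annotate, List.length_append, List.length_cons] at hlenXY
  obtain ⟨w, hw, hwl⟩ := hat X.length (by lia)
  simp only [List.getElem?_append_right le_rfl, Nat.sub_self,
    List.getElem?_cons_zero, Option.some.injEq, Prod.mk.injEq] at hw
  obtain ⟨hw1, rfl⟩ := hw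
  refine predictsUniform_of_argmaxSet h0 hT (argmaxSet_logit_eq (isVtx_getD_zero h0)
    (by lia) (getD_length_sub_one hz) (lastTok_length_sub_one h0 hv) hu' (j := X.length) (by lia)
    hw1.symm hwl ?_ hq)
  rintro i hi hit ⟨hval, u', hu', hul⟩
  obtain ⟨w', hw', hwl'⟩ := hat i (by lia)
  rw [hul, Token.vtx.injEq] at hwl'
  subst hwl'
  rw [List.getElem?_append_right hi.le, List.getElem?_cons, if_neg (by lia)] at hw'
  exact hY _ (List.mem_of_getElem? hw') u' hu' rfl hval

/-- The displayed `w` is the last vertex of the sentence, so the second head attends exactly to the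
stretch from `w` to the end; `u` consists of the contextual tokens in it. -/
theorem predictsUniform_ctx {X Y : List D.Tok} {w v : V} {c : C}
    (hz : z = X ++ .vtx w :: (Y ++ [.ctx c])) (h0 : ∃ g, z.head? = some (.vtx g))
    (hT : z.length ≤ T) (hY : ∀ v', .vtx v' ∉ Y) (hc : c ∈ D.cont v) {u : Finset C}
    (hu : ∀ c', c' ∈ u ↔ .ctx c' ∈ Y ++ [.ctx c]) :
    D.PredictsUniform E z (insert (.vtx v) ((D.cont v \ u).image .ctx)) := by
  have hlen : z.length = X.length + Y.length + 2 := by simp [hz]; lia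
  have hget : ∀ k, z.getD (X.length + k) .cm = (.vtx w :: (Y ++ [.ctx c])).getD k .cm := by
    intro k
    simp [hz, List.getD, List.getElem?_append_right]
  have hX : D.IsVtx (z.getD X.length .cm) := ⟨w, by simpa using hget 0⟩
  have hin : ∀ k, k < Y.length + 1 → ∃ a ∈ Y ++ [.ctx c], z.getD (X.length + (k + 1)) .cm = a := by
    intro k hk
    refine ⟨(Y ++ [.ctx c])[k]'(by simpa using hk), List.getElem_mem _, ?_⟩
    rw [hget, List.getD_cons_succ, List.getD_eq_getElem]
  have hlast : lastPos (fun j => D.IsVtx (z.getD j .cm)) (z.length - 1) = X.length := by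
    refine le_antisymm ?_ (le_lastPos (by lia) hX)
    by_contra hlt
    have hle := lastPos_le (fun j => D.IsVtx (z.getD j .cm)) (z.length - 1)
    obtain ⟨v', hv'⟩ := lastPos_spec (P := fun j => D.IsVtx (z.getD j .cm)) (isVtx_getD_zero h0)
      (z.length - 1)
    set p := lastPos (fun j => D.IsVtx (z.getD j .cm)) (z.length - 1)
    obtain ⟨k, hk⟩ : ∃ k, p = X.length + (k + 1) := ⟨p - X.length - 1, by lia⟩
    obtain ⟨a, ha, hka⟩ := hin k (by lia)
    rw [hk, hka] at hv'
    subst hv'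
    simp only [List.mem_append, List.mem_singleton, reduceCtorEq, or_false] at ha
    exact hY v' ha
  have htok : z.getD (z.length - 1) .cm = .ctx c := by
    rw [show z.length - 1 = X.length + (Y.length + 1) by lia, hget]
    simp
  refine predictsUniform_of_argmaxSet h0 hT (argmaxSet_logit_ctx (isVtx_getD_zero h0) (by lia)
    htok hc fun c' => ?_)
  rw [hu, hlast]
  constructor
  · intro h
    obtain ⟨k, hk, hkc⟩ := List.getElem_of_mem h
    have hk' : k < Y.length + 1 := by simpa using hk
    refine ⟨X.length + (k + 1), by lia, by lia, ?_⟩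
    rw [hget, List.getD_cons_succ, List.getD_eq_getElem _ _ hk, hkc]
  · rintro ⟨i, hi, hXi, hic⟩
    obtain ⟨k, rfl⟩ := Nat.exists_eq_add_of_le hXi
    rcases k with _ | k
    · rw [hget] at hic
      simp at hic
    · obtain ⟨a, ha, hka⟩ := hin k (by lia)
      rwa [← hic, hka]

end Sentence

end Causal

/-! ### Vertex orders and acyclicity from finite depth. -/

namespace Causal

variable {V C : Type} [Fintype V] [DecidableEq V] (D : Causal V C)

/-- The part of a vertex order that lies in the graph. -/
def graphPart (vs : List V) : List V := vs.filter fun v => v ∈ D.verts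

/-- What training orders and test orders have in common. -/
structure IsOrder (vs : List V) : Prop where
  nodup : vs.Nodup
  isChain : (D.graphPart vs).IsChain fun u v => (u, v) ∈ D.edges
  ne_nil : D.graphPart vs ≠ []
  not_mem_edges : ∀ u ∈ (D.graphPart vs).getLast?, ∀ v ∈ (D.graphPart vs).head?,
    (u, v) ∉ D.edges

variable {D} {N : ℕ}

/-- An edge from the last to the first vertex would allow the chain to be repeated arbitrarily
often. -/
theorem IsDepth.not_mem_edges (hN : D.IsDepth N) {s : List V} (hs : D.IsChain s) :
    ∀ u ∈ s.getLast?, ∀ v ∈ s.head?, (u, v) ∉ D.edges := by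
  intro u hu v hv he
  have hs0 : s ≠ [] := by rintro rfl; simp at hv
  have key : ∀ n : ℕ, D.IsChain (List.replicate n s).flatten := by
    intro n
    induction n with
    | zero => exact ⟨by simp, by simp⟩
    | succ n ih =>
      rw [List.replicate_succ, List.flatten_cons]
      refine ⟨fun x hx => (List.mem_append.1 hx).elim (hs.1 x) (ih.1 x), ?_⟩
      refine List.isChain_append.2 ⟨hs.2, ih.2, fun x hx y hy => ?_⟩
      obtain rfl : x = u := Option.some.inj (hx.symm.trans hu)
      cases n with
      | zero => simp at hy
      | succ n =>
        rw [List.replicate_succ, List.flatten_cons, List.head?_append_of_ne_nil _ hs0] at hy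
        obtain rfl : y = v := Option.some.inj (hy.symm.trans hv)
        exact he
  -- Already `N + 1` copies of a nonempty chain are longer than `N`.
  have hle := hN.2 ⟨_, key (N + 1), rfl⟩
  have hpos : 0 < s.length := List.length_pos_of_ne_nil hs0
  simp at hle
  nlinarith

/-- The part of the chain from one occurrence of a vertex up to just before the next would be a
chain closed by an edge. -/
theorem IsDepth.nodup (hN : D.IsDepth N) {s : List V} (hs : D.IsChain s) : s.Nodup := by
  induction s with
  | nil => exact List.nodup_nil
  | cons a s ih =>
    refine List.nodup_cons.2 ⟨fun ha => ?_,
      ih ⟨fun v hv => hs.1 v (List.mem_cons_of_mem _ hv), hs.2.tail⟩⟩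
    obtain ⟨A, B, rfl⟩ := List.append_of_mem ha
    have hc := List.isChain_append.1 (show (a :: A ++ a :: B).IsChain _ from hs.2)
    have hlast : (a :: A).getLast? = some ((a :: A).getLast (by simp)) :=
      List.getLast?_eq_getLast_of_ne_nil _
    refine hN.not_mem_edges (s := a :: A) ⟨fun v hv => hs.1 v (by simp at hv ⊢; tauto), hc.1⟩
      _ hlast a rfl (hc.2.2 _ hlast a rfl)

theorem _root_.Interleaving.mem_iff {α : Type} {s t r : List α} (h : Interleaving s t r) (a : α) :
    a ∈ r ↔ a ∈ s ∨ a ∈ t := by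
  induction h with
  | nil => simp
  | left b h ih => simp [ih, or_assoc]
  | right b h ih => simp [ih, or_left_comm]

theorem _root_.Interleaving.nodup {α : Type} {s t r : List α} (h : Interleaving s t r) (hs : s.Nodup)
    (ht : t.Nodup) (hst : ∀ a ∈ s, a ∉ t) : r.Nodup := by
  induction h with
  | nil => simp
  | left b h ih =>
    rw [List.nodup_cons] at hs ⊢
    refine ⟨fun hb => ?_, ih hs.2 ht fun a ha => hst a (List.mem_cons_of_mem _ ha)⟩
    rcases (h.mem_iff b).1 hb with hb | hb
    · exact hs.1 hb
    · exact hst b List.mem_cons_self hb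
  | right b h ih =>
    rw [List.nodup_cons] at ht ⊢
    refine ⟨fun hb => ?_, ih hs ht.2 fun a ha hat => hst a ha (List.mem_cons_of_mem _ hat)⟩
    rcases (h.mem_iff b).1 hb with hb | hb
    · exact hst b hb List.mem_cons_self
    · exact ht.1 hb

theorem _root_.Interleaving.graphPart_eq {s t r : List V} (h : Interleaving s t r)
    (hs : ∀ v ∈ s, v ∈ D.verts) (ht : ∀ v ∈ t, v ∉ D.verts) : D.graphPart r = s := by
  induction h with
  | nil => rfl
  | left b h ih =>
    rw [graphPart, List.filter_cons_of_pos (by simpa using hs b List.mem_cons_self)]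
    exact congrArg _ (ih (fun v hv => hs v (List.mem_cons_of_mem _ hv)) ht)
  | right b h ih =>
    rw [graphPart, List.filter_cons_of_neg (by simpa using ht b List.mem_cons_self)]
    exact ih hs fun v hv => ht v (List.mem_cons_of_mem _ hv)

theorem IsTrainOrder.isOrder (hN : D.IsDepth N) {M M' : ℕ} (hM : 1 ≤ M) {vs : List V}
    (h : D.IsTrainOrder M M' vs) : D.IsOrder vs := by
  obtain ⟨s, t, hs, hsM, ht, -, htv, hst⟩ := h
  have hg : D.graphPart vs = s := hst.graphPart_eq hs.1 htv
  refine ⟨hst.nodup (hN.nodup hs) ht fun a ha hat => htv a hat (hs.1 a ha), hg ▸ hs.2, ?_,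
    hg ▸ hN.not_mem_edges hs⟩
  rw [hg]
  rintro rfl
  simp at hsM
  lia

theorem IsTestOrder.graphPart_eq {vs : List V} (h : D.IsTestOrder N vs) : D.graphPart vs = vs :=
  List.filter_eq_self.2 fun v hv => by simpa using h.1.1 v hv

theorem IsTestOrder.isOrder (hN : D.IsDepth N) (h1 : 1 ≤ N) {vs : List V}
    (h : D.IsTestOrder N vs) : D.IsOrder vs := by
  have hg := h.graphPart_eq
  refine ⟨hN.nodup h.1, by rw [hg]; exact h.1.2, ?_, by rw [hg]; exact hN.not_mem_edges h.1⟩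
  rw [hg]
  rintro rfl
  have := h.2
  simp at this
  lia

/-- Used to identify the successor found in the examples with the vertex that has to come next. -/
theorem eq_of_append_cons_cons_eq {α : Type} {A B A' B' : List α} {a b b' : α}
    (hn : (A ++ a :: b :: B).Nodup) (h : A ++ a :: b :: B = A' ++ a :: b' :: B') : b = b' := by
  induction A generalizing A' with
  | nil =>
    cases A' with
    | nil => simp at h; exact h.1
    | cons x A' =>
      simp only [List.nil_append, List.cons_append, List.cons.injEq] at h
      obtain ⟨rfl, h⟩ := h
      simp [h] at hn
  | cons x A ih =>
    cases A' with
    | nil =>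
      simp only [List.nil_append, List.cons_append, List.cons.injEq] at h
      obtain ⟨rfl, h⟩ := h
      simp at hn
    | cons y A' =>
      simp only [List.cons_append, List.cons.injEq, List.nodup_cons] at h hn
      exact ih hn.2 h.2

end Causal

/-! ### Folds and annotations of rendered sequences. -/

namespace Causal

variable {V C : Type} [Fintype V] [DecidableEq V] [Fintype C] [DecidableEq C] (D : Causal V C)

/-- Entries, each followed by a comma. -/
def renderClosed (es : List D.Entry) : List D.Tok :=
  es.flatMap fun e => D.renderEntry e ++ [.cm]

/-- Entries, each preceded by a comma. -/
def renderRest (es : List D.Entry) : List D.Tok :=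
  es.flatMap fun e => .cm :: D.renderEntry e

theorem renderEntries_cons (e : D.Entry) (es : List D.Entry) :
    D.renderEntries (e :: es) = D.renderEntry e ++ D.renderRest es := by
  induction es generalizing e with
  | nil => simp [renderEntries, renderRest]
  | cons e' es ih =>
    rw [renderEntries, List.map_cons, List.map_cons, List.intercalate_cons_cons, ← List.map_cons]
    have := ih e'
    rw [renderEntries] at this
    rw [this]
    simp [renderRest]

theorem renderRest_cons (e : D.Entry) (es : List D.Entry) :
    D.renderRest (e :: es) = .cm :: D.renderEntries (e :: es) := by
  simp [renderEntries_cons, renderRest]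

theorem renderClosed_cons (e : D.Entry) (es : List D.Entry) :
    D.renderClosed (e :: es) = D.renderEntry e ++ (.cm :: D.renderClosed es) := by
  simp [renderClosed]

theorem renderClosed_append (es es' : List D.Entry) :
    D.renderClosed (es ++ es') = D.renderClosed es ++ D.renderClosed es' := by
  simp [renderClosed]

theorem renderClosed_eq {es : List D.Entry} (h : es ≠ []) :
    D.renderClosed es = D.renderEntries es ++ [.cm] := by
  induction es with
  | nil => exact absurd rfl h
  | cons e es ih =>
    rw [renderClosed_cons, renderEntries_cons]
    rcases es with _ | ⟨e', es⟩
    · simp [renderClosed, renderRest]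
    · rw [ih (by simp), renderRest_cons]
      simp

/-- An entry with the right contextual tokens and a possible value. -/
structure IsEntry (e : D.Entry) : Prop where
  ctx_ne_nil : e.1 ≠ []
  ctx_mem : ∀ c ∈ e.1, c ∈ D.cont e.2.1
  val_mem : e.2.2 ∈ D.valueSet e.2.1

/-- The last graph vertex and its value after an entry. -/
def nextParent (p : Option (V × D.Value)) (e : D.Entry) : Option (V × D.Value) :=
  if e.2.1 ∈ D.verts then some (e.2.1, e.2.2) else p

variable {D}

theorem foldl_scanVtx_map_ctx (o : Option V) (cs : List C) :
    (cs.map Token.ctx).foldl D.scanVtx o = o := by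
  induction cs with
  | nil => rfl
  | cons c cs ih => simpa [scanVtx] using ih

theorem foldl_scanVtx_renderEntry (o : Option V) (e : D.Entry) :
    (D.renderEntry e).foldl D.scanVtx o = some e.2.1 := by
  simp [renderEntry, foldl_scanVtx_map_ctx, scanVtx]

theorem foldl_scanVtx_renderClosed_concat (o : Option V) (es : List D.Entry) (e : D.Entry) :
    (D.renderClosed (es ++ [e])).foldl D.scanVtx o = some e.2.1 := by
  simp [renderClosed, foldl_scanVtx_renderEntry, scanVtx]

theorem annotate_map_ctx (o : Option V) (cs : List C) :
    D.annotate o (cs.map Token.ctx) = cs.map fun c => (.ctx c, o) := by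
  induction cs with
  | nil => rfl
  | cons c cs ih => simpa [annotate, scanVtx] using ih

theorem annotate_renderEntry (o : Option V) (e : D.Entry) :
    D.annotate o (D.renderEntry e) = e.1.map (fun c => (.ctx c, o)) ++
      [(.vtx e.2.1, some e.2.1), (.eq, some e.2.1), (.val e.2.2, some e.2.1)] := by
  simp [renderEntry, annotate_append, annotate_map_ctx, annotate, scanVtx]

theorem foldl_scanParent_eq_self (p : Option (V × D.Value)) (o : Option V) {z : List D.Tok}
    (h : ∀ q, .val q ∉ z) : (D.annotate o z).foldl D.scanParent p = p := by
  induction z generalizing o with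
  | nil => rfl
  | cons a z ih =>
    have ha : D.scanParent p (a, D.scanVtx o a) = p := by
      cases a
      case val q => exact absurd List.mem_cons_self (h q)
      all_goals rfl
    rw [annotate, List.foldl_cons, ha]
    exact ih _ fun q hq => h q (List.mem_cons_of_mem _ hq)

theorem foldl_scanParent_renderEntry (p : Option (V × D.Value)) (o : Option V) (e : D.Entry) :
    (D.annotate o (D.renderEntry e)).foldl D.scanParent p = D.nextParent p e := by
  have h := foldl_scanParent_eq_self p o (z := e.1.map Token.ctx) (by simp)
  rw [annotate_map_ctx] at h
  rw [annotate_renderEntry, List.foldl_append, h]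
  rfl

theorem foldl_scanParent_renderClosed (p : Option (V × D.Value)) (o : Option V)
    (es : List D.Entry) :
    (D.annotate o (D.renderClosed es)).foldl D.scanParent p = es.foldl D.nextParent p := by
  induction es generalizing p o with
  | nil => rfl
  | cons e es ih =>
    rw [renderClosed_cons, annotate_append, List.foldl_append, foldl_scanParent_renderEntry,
      annotate, List.foldl_cons, ih]
    rfl

theorem foldl_scanParent_renderEntries (p : Option (V × D.Value)) (o : Option V)
    (es : List D.Entry) :
    (D.annotate o (D.renderEntries es)).foldl D.scanParent p = es.foldl D.nextParent p := by
  rw [← foldl_scanParent_renderClosed p o]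
  rcases es with _ | ⟨e, es⟩
  · rfl
  · rw [renderClosed_eq D (List.cons_ne_nil e es), annotate_append, List.foldl_append]
    rfl

theorem header_eq {vs : List V} {g : V} (hg : vs.getLast? = some g) :
    D.header vs = [.vtx g, .eq, .qu] := by
  rw [header, hg]

theorem foldl_scanParent_renderDoc (p : Option (V × D.Value)) (o : Option V) (vs : List V)
    (ss : List (List D.Entry)) :
    (D.annotate o (D.renderDoc vs ss)).foldl D.scanParent p = ss.flatten.foldl D.nextParent p := by
  have hh : ∀ q, (.val q : D.Tok) ∉ D.header vs := fun q => by
    rw [header]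
    split <;> simp
  induction ss generalizing p o with
  | nil => rfl
  | cons s ss ih =>
    rw [renderDoc, List.flatMap_cons, ← renderDoc, annotate_append, annotate_append,
      annotate_append, List.foldl_append, List.foldl_append, List.foldl_append,
      foldl_scanParent_eq_self _ _ hh, foldl_scanParent_renderEntries, ih,
      foldl_scanParent_eq_self _ _ (by simp), List.flatten_cons, ← List.foldl_append]

theorem mem_annotate_renderEntries_iff {o : Option V} {es : List D.Entry} {c : C}
    {w : Option V} : (.ctx c, w) ∈ D.annotate o (D.renderEntries es) ↔
      (.ctx c, w) ∈ D.annotate o (D.renderClosed es) := by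
  rcases es with _ | ⟨e, es⟩
  · rfl
  · rw [renderClosed_eq D (List.cons_ne_nil e es), annotate_append]
    simp [annotate]

theorem mem_annotate_renderDoc_iff {o : Option V} {vs : List V} {g : V}
    (hg : vs.getLast? = some g) {ss : List (List D.Entry)} {c : C} {w : Option V} :
    (.ctx c, w) ∈ D.annotate o (D.renderDoc vs ss) ↔
      ∃ s ∈ ss, (.ctx c, w) ∈ D.annotate (some g) (D.renderClosed s) := by
  induction ss generalizing o with
  | nil => simp [renderDoc, annotate]
  | cons s ss ih =>
    rw [renderDoc, List.flatMap_cons, ← renderDoc, annotate_append, annotate_append,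
      annotate_append, List.mem_append, List.mem_append, List.mem_append, ih, header_eq hg]
    simp [annotate, scanVtx, mem_annotate_renderEntries_iff]

/-- The contextual tokens of an entry stand behind the vertex of the entry before it. For the first
entry this role is played by `x`, the vertex read before the entries begin. -/
theorem exists_infix_of_mem_annotate {x w : V} {s : List D.Entry} (hs : ∀ e ∈ s, D.IsEntry e)
    {c : C} (h : (.ctx c, some w) ∈ D.annotate (some x) (D.renderClosed s)) :
    ∃ v, [w, v] <:+: x :: s.map (·.2.1) ∧ c ∈ D.cont v := by
  induction s generalizing x with
  | nil => simp [renderClosed, annotate] at h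
  | cons e s ih =>
    rw [renderClosed_cons, annotate_append, annotate_renderEntry, foldl_scanVtx_renderEntry,
      annotate] at h
    simp only [List.mem_append, List.mem_map, Prod.mk.injEq, Token.ctx.injEq, Option.some.injEq,
      List.mem_cons, reduceCtorEq, false_and, List.not_mem_nil, or_false, false_or] at h
    rcases h with ⟨c', hc', rfl, rfl⟩ | h
    · exact ⟨e.2.1, ⟨[], s.map (·.2.1), by simp⟩, (hs e List.mem_cons_self).ctx_mem _ hc'⟩
    · obtain ⟨v, hv, hc⟩ := ih (fun e he => hs e (List.mem_cons_of_mem _ he)) h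
      exact ⟨v, List.infix_cons hv, hc⟩

theorem mem_annotate_of_append {o : Option V} {s₁ s₂ : List D.Entry} {e e' : D.Entry} {c : C}
    (hc : c ∈ e'.1) :
    (.ctx c, some e.2.1) ∈ D.annotate o (D.renderClosed (s₁ ++ e :: e' :: s₂)) := by
  rw [renderClosed_append, annotate_append, List.mem_append]
  right
  rw [renderClosed_cons, annotate_append, foldl_scanVtx_renderEntry, List.mem_append]
  right
  rw [annotate, List.mem_cons]
  right
  rw [renderClosed_cons, annotate_append, annotate_renderEntry]
  simp [scanVtx, hc]

theorem foldl_nextParent_eq_or (p : Option (V × D.Value)) (es : List D.Entry) :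
    es.foldl D.nextParent p = (es.foldl D.nextParent none).or p := by
  induction es using List.reverseRecOn with
  | nil => rfl
  | append_singleton es e ih =>
    simp only [List.foldl_append, List.foldl_cons, List.foldl_nil, nextParent]
    split_ifs
    · rfl
    · exact ih

theorem foldl_nextParent_eq_some {es : List D.Entry} (hes : ∀ e ∈ es, D.IsEntry e) {u : V}
    {q : D.Value} (h : es.foldl D.nextParent none = some (u, q)) :
    u ∈ (D.graphPart (es.map (·.2.1))).getLast? ∧ q ∈ D.valueSet u := by
  induction es using List.reverseRecOn with
  | nil => simp at h
  | append_singleton es e ih =>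
    simp only [List.foldl_append, List.foldl_cons, List.foldl_nil, nextParent] at h
    split_ifs at h with he
    · simp only [Option.some.injEq, Prod.mk.injEq] at h
      obtain ⟨rfl, rfl⟩ := h
      refine ⟨?_, (hes e (by simp)).val_mem⟩
      simp [graphPart, he]
    · obtain ⟨h1, h2⟩ := ih (fun e he => hes e (List.mem_append_left _ he)) h
      refine ⟨?_, h2⟩
      simpa [graphPart, he] using h1

theorem foldl_nextParent_eq_none {es : List D.Entry} (h : es.foldl D.nextParent none = none) :
    D.graphPart (es.map (·.2.1)) = [] := by
  induction es using List.reverseRecOn with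
  | nil => rfl
  | append_singleton es e ih =>
    simp only [List.foldl_append, List.foldl_cons, List.foldl_nil, nextParent] at h
    split_ifs at h with he
    simpa [graphPart, he] using ih h

end Causal

/-! ### Building trees: the contextual tokens of one entry. -/

namespace UniformTree

variable {A : Type} {good : List A → Finset A → Prop} {pre : List A}

theorem singleton {a : A} {Φ : (List A → ℝ≥0∞) → ℝ≥0∞} (h : good pre {a})
    (hΦ : UniformTree good (pre ++ [a]) Φ) :
    UniformTree good pre fun f => Φ fun y => f (a :: y) := by
  convert step pre {a} (Finset.singleton_nonempty a) h (fun _ => Φ)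
    (fun b hb => by rwa [Finset.mem_singleton.1 hb]) using 2 with f
  simp

theorem uniform [DecidableEq A] {ι : Type} {g : ι → A} (hg : Function.Injective g) {S : Finset ι}
    (hS : S.Nonempty) {Φ : ι → (List A → ℝ≥0∞) → ℝ≥0∞} (h : good pre (S.image g))
    (hΦ : ∀ i ∈ S, UniformTree good (pre ++ [g i]) (Φ i)) :
    UniformTree good pre fun f => (S.card : ℝ≥0∞)⁻¹ * ∑ i ∈ S, Φ i fun y => f (g i :: y) := by
  have : Nonempty ι := ⟨hS.choose⟩
  have hinv : ∀ i, Function.invFun g (g i) = i := Function.leftInverse_invFun hg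
  convert step pre (S.image g) (hS.image g) h (fun a => Φ (Function.invFun g a))
    (fun a ha => ?_) using 2 with f
  · rw [Finset.card_image_of_injective S hg, Finset.sum_image hg.injOn]
    simp only [hinv]
  · obtain ⟨i, hi, rfl⟩ := Finset.mem_image.1 ha
    rw [hinv]
    exact hΦ i hi

end UniformTree

namespace Causal

variable {V C : Type} [Fintype V] [DecidableEq V] [Fintype C] [DecidableEq C] {D : Causal V C}

section Context

variable {good : List D.Tok → Finset D.Tok → Prop} {pre : List D.Tok} {v : V}
  {Φ : (List D.Tok → ℝ≥0∞) → ℝ≥0∞}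

/-- Induction on the set of unused tokens; `expect_drawUniform` supplies the node. The law `Φ` of
what follows the vertex does not depend on the draws, only its prefix does. -/
theorem uniformTree_drawUniform
    (hgood : ∀ cs : List C, cs ≠ [] → (∀ c ∈ cs, c ∈ D.cont v) →
      good (pre ++ cs.map .ctx) (insert (.vtx v) ((D.cont v \ cs.toFinset).image .ctx)))
    (hΦ : ∀ cs : List C, cs ≠ [] → (∀ c ∈ cs, c ∈ D.cont v) →
      UniformTree good (pre ++ cs.map .ctx ++ [.vtx v]) Φ)
    (S : Finset C) (cs : List C) (hcs : cs ≠ []) (hv : ∀ c ∈ cs, c ∈ D.cont v)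
    (hS : S = D.cont v \ cs.toFinset) :
    UniformTree good (pre ++ cs.map .ctx) fun f =>
      (drawUniform S).expect fun cs' => Φ fun y => f (cs'.map .ctx ++ .vtx v :: y) := by
  induction S using Finset.strongInduction generalizing cs with
  | H S ih =>
    have hnot : (.vtx v : D.Tok) ∉ S.image Token.ctx := by simp
    convert UniformTree.step (pre ++ cs.map .ctx) (insert (.vtx v) (S.image .ctx))
      (Finset.insert_nonempty _ _) (hS ▸ hgood cs hcs hv)
      -- The children are the vertex and the unused contextual tokens; the default branch serves the
      -- vertex.
      (fun a => match a with
        | .ctx c => fun f => (drawUniform (S.erase c)).expect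
            fun cs' => Φ fun y => f (cs'.map .ctx ++ .vtx v :: y)
        | _ => Φ) (fun a ha => ?_) using 2 with f
    · rw [expect_drawUniform, Finset.card_insert_of_notMem hnot, Finset.sum_insert hnot,
        Finset.card_image_of_injective S fun a b h => by simpa using h,
        Finset.sum_image fun a _ b _ h => by simpa using h]
      rfl
    · rcases Finset.mem_insert.1 ha with rfl | ha
      · exact hΦ cs hcs hv
      · obtain ⟨c, hc, rfl⟩ := Finset.mem_image.1 ha
        have hc' := hc
        rw [hS, Finset.mem_sdiff] at hc'
        have := ih (S.erase c) (Finset.erase_ssubset hc) (cs ++ [c]) (by simp)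
          (fun x hx => (List.mem_append.1 hx).elim (hv x) fun hx => by
            rw [List.mem_singleton.1 hx]; exact hc'.1)
          (by rw [hS]; ext x; simp; tauto)
        simpa using this

theorem uniformTree_contextLaw (hgood₀ : good pre ((D.cont v).image .ctx))
    (hgood : ∀ cs : List C, cs ≠ [] → (∀ c ∈ cs, c ∈ D.cont v) →
      good (pre ++ cs.map .ctx) (insert (.vtx v) ((D.cont v \ cs.toFinset).image .ctx)))
    (hΦ : ∀ cs : List C, cs ≠ [] → (∀ c ∈ cs, c ∈ D.cont v) →
      UniformTree good (pre ++ cs.map .ctx ++ [.vtx v]) Φ) :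
    UniformTree good pre fun f =>
      (D.contextLaw v).expect fun cs => Φ fun y => f (cs.map .ctx ++ .vtx v :: y) := by
  simp only [expect_contextLaw]
  refine UniformTree.uniform (g := Token.ctx)
    (Φ := fun c f => (drawUniform ((D.cont v).erase c)).expect
      fun cs' => Φ fun y => f (cs'.map .ctx ++ .vtx v :: y))
    (fun a b h => by simpa using h) (D.cont_nonempty v) hgood₀ fun c hc => ?_
  exact uniformTree_drawUniform hgood hΦ _ [c] (by simp) (by simpa using hc)
    (by ext x; simp; tauto)

end Context

/-! ### The label as a tree of uniform choices, given a prompt. -/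

/-- Examples for the vertex order `vs`, whose last vertex is `g`. -/
structure IsPrompt (D : Causal V C) (vs : List V) (g : V) (ss : List (List D.Entry)) : Prop where
  order : D.IsOrder vs
  goal : vs.getLast? = some g
  ne_nil : ss ≠ []
  map_eq : ∀ s ∈ ss, s.map (·.2.1) = vs
  isEntry : ∀ s ∈ ss, ∀ e ∈ s, D.IsEntry e

/-- The sentence formed by the examples `ss`, the question and the closed entries `es`. -/
def context (vs : List V) (ss : List (List D.Entry)) (es : List D.Entry) : List D.Tok :=
  D.renderDoc vs ss ++ D.header vs ++ D.renderClosed es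

namespace IsPrompt

variable {vs vs₂ : List V} {g v : V} {ss : List (List D.Entry)} {es : List D.Entry}
  {d₁ T : ℕ} {E : Embeddings D.Tok d₁ T}

theorem head?_context_append (h : IsPrompt D vs g ss) (y : List D.Tok) :
    (context vs ss es ++ y).head? = some (.vtx g) := by
  rw [context, header_eq h.goal]
  rcases ss with _ | ⟨s, ss⟩
  · simp [renderDoc]
  · simp [renderDoc, header_eq h.goal]

theorem head?_append (h : IsPrompt D vs g ss) (y : List D.Tok) :
    ∃ g, (context vs ss es ++ y).head? = some (.vtx g) :=
  ⟨g, h.head?_context_append y⟩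

theorem foldl_scanParent (ss : List (List D.Entry)) (es : List D.Entry) {y : List D.Tok}
    (hy : ∀ q, .val q ∉ y) :
    (D.annotate none (context vs ss es ++ y)).foldl D.scanParent none =
      (es.foldl D.nextParent none).or (ss.flatten.foldl D.nextParent none) := by
  have hh : ∀ q, (.val q : D.Tok) ∉ D.header vs := fun q => by
    rw [header]
    split <;> simp
  rw [context, annotate_append, annotate_append, annotate_append, List.foldl_append,
    List.foldl_append, List.foldl_append, foldl_scanParent_renderDoc,
    foldl_scanParent_eq_self _ _ hh, foldl_scanParent_renderClosed, foldl_scanParent_eq_self _ _ hy,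
    foldl_nextParent_eq_or]

/-- A complete example contains the transition from the last written vertex to `v`, so the head
finds something; as the order has no repetitions, all it finds belongs to `v`. -/
theorem predictsUniform_context (h : IsPrompt D vs g ss) (hes : ∀ e ∈ es, D.IsEntry e)
    (hne : es ≠ []) (hvs : es.map (·.2.1) ++ v :: vs₂ = vs)
    (hT : (context vs ss es).length ≤ T) :
    D.PredictsUniform E (context vs ss es) ((D.cont v).image .ctx) := by
  have h0 := h.head?_append (es := es) []
  rw [List.append_nil] at h0
  obtain ⟨es₀, e, rfl⟩ : ∃ es₀ e, es = es₀ ++ [e] :=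
    ⟨_, _, (List.dropLast_append_getLast hne).symm⟩
  have hvs' : es₀.map (·.2.1) ++ e.2.1 :: v :: vs₂ = vs := by simpa using hvs
  have hnd := h.order.nodup
  rw [← hvs'] at hnd
  -- The question puts `g` in front of the first entry of each sequence and so creates a false
  -- transition out of `g`. It does no harm: `g` is the last vertex of the order, whereas `e.2.1` is
  -- followed by `v`.
  have hinfix : ∀ v', [e.2.1, v'] <:+: g :: vs → v = v' := by
    intro v' hv'
    rcases List.infix_cons_iff.1 hv' with hv' | ⟨A, B, hAB⟩
    · have hg : e.2.1 = g := (List.cons_prefix_cons.1 hv').1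
      have hg' := h.goal
      rw [← hvs', List.getLast?_append_of_ne_nil _ (by simp), List.getLast?_cons_cons] at hg'
      have hmem := List.mem_of_getLast? hg'
      rw [← hg] at hmem
      exact absurd hmem (List.nodup_cons.1 (List.nodup_append.1 hnd).2.1).1
    · refine eq_of_append_cons_cons_eq (A' := A) (B' := B) hnd ?_
      rw [hvs', ← hAB]
      simp
  refine predictsUniform_cm (w := e.2.1)
    (y := D.renderDoc vs ss ++ D.header vs ++ D.renderClosed es₀ ++ D.renderEntry e) ?_ h0 hT ?_ ?_
    fun c hc => ?_
  · simp [context, renderClosed]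
  · rw [context, List.foldl_append, foldl_scanVtx_renderClosed_concat]
  · obtain ⟨s, hs⟩ := List.exists_mem_of_ne_nil _ h.ne_nil
    have hm := h.map_eq s hs
    rw [← hvs'] at hm
    obtain ⟨s₁, s', rfl, -, hm⟩ := List.map_eq_append_iff.1 hm
    obtain ⟨a, s', rfl, ha, hm⟩ := List.map_eq_cons_iff.1 hm
    obtain ⟨b, s₂, rfl, hb, -⟩ := List.map_eq_cons_iff.1 hm
    obtain ⟨c, hc⟩ := List.exists_mem_of_ne_nil _ (h.isEntry _ hs b (by simp)).ctx_ne_nil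
    refine ⟨c, ?_⟩
    rw [context, annotate_append, annotate_append, List.mem_append, List.mem_append,
      mem_annotate_renderDoc_iff h.goal]
    exact Or.inl (Or.inl ⟨_, hs, ha ▸ mem_annotate_of_append hc⟩)
  · rw [context, annotate_append, annotate_append, List.mem_append, List.mem_append,
      mem_annotate_renderDoc_iff h.goal, header_eq h.goal] at hc
    rcases hc with (⟨s, hs, hc⟩ | hc) | hc
    · obtain ⟨v', hv', hcv⟩ := exists_infix_of_mem_annotate (h.isEntry s hs) hc
      rw [h.map_eq s hs] at hv'
      rwa [hinfix v' hv']
    · simp [annotate] at hc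
    · simp only [List.foldl_append, List.foldl_cons, List.foldl_nil, scanVtx] at hc
      obtain ⟨v', hv', hcv⟩ := exists_infix_of_mem_annotate hes hc
      rw [hinfix v' (hv'.trans ⟨[], v :: vs₂, by simp [← hvs']⟩)]
      exact hcv

theorem predictsUniform_map_ctx (h : IsPrompt D vs g ss) (hne : es ≠ []) {cs : List C}
    (hcs : cs ≠ []) (hv : ∀ c ∈ cs, c ∈ D.cont v)
    (hT : (context vs ss es ++ cs.map Token.ctx).length ≤ T) :
    D.PredictsUniform E (context vs ss es ++ cs.map .ctx)
      (insert (.vtx v) ((D.cont v \ cs.toFinset).image .ctx)) := by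
  have h0 := h.head?_append (es := es) (cs.map .ctx)
  obtain ⟨es₀, e, rfl⟩ : ∃ es₀ e, es = es₀ ++ [e] :=
    ⟨_, _, (List.dropLast_append_getLast hne).symm⟩
  obtain ⟨cs₀, c, rfl⟩ : ∃ cs₀ c, cs = cs₀ ++ [c] :=
    ⟨_, _, (List.dropLast_append_getLast hcs).symm⟩
  refine predictsUniform_ctx (w := e.2.1) (c := c)
    (X := D.renderDoc vs ss ++ D.header vs ++ D.renderClosed es₀ ++ e.1.map Token.ctx)
    (Y := .eq :: .val e.2.2 :: .cm :: cs₀.map Token.ctx) ?_ h0 hT (by simp) (hv c (by simp)) fun c' => ?_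
  · simp [context, renderClosed, renderEntry]
  · simp [or_comm]

/-- At least one complete example precedes, and each contains a graph vertex; hence the parent head
always has a target, even before the current sequence provides one. -/
theorem exists_parent (h : IsPrompt D vs g ss) :
    ∃ u q, ss.flatten.foldl D.nextParent none = some (u, q) ∧
      u ∈ (D.graphPart vs).getLast? ∧ q ∈ D.valueSet u := by
  obtain ⟨ss₀, s, rfl⟩ : ∃ ss₀ s, ss = ss₀ ++ [s] :=
    ⟨_, _, (List.dropLast_append_getLast h.ne_nil).symm⟩
  have hs : s ∈ ss₀ ++ [s] := by simp
  rw [List.flatten_concat, List.foldl_append, foldl_nextParent_eq_or]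
  rcases hp : s.foldl D.nextParent none with _ | ⟨u, q⟩
  · have := foldl_nextParent_eq_none hp
    rw [h.map_eq s hs] at this
    exact absurd this h.order.ne_nil
  · obtain ⟨h1, h2⟩ := foldl_nextParent_eq_some (h.isEntry s hs) hp
    rw [h.map_eq s hs] at h1
    exact ⟨u, q, rfl, h1, h2⟩

theorem mem_edges (h : IsPrompt D vs g ss) (hes : ∀ e ∈ es, D.IsEntry e)
    (hvs : es.map (·.2.1) ++ v :: vs₂ = vs) (hv : v ∈ D.verts) {u : V} {q : D.Value}
    (hu : es.foldl D.nextParent none = some (u, q)) : (u, v) ∈ D.edges := by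
  have hc := h.order.isChain
  rw [← hvs, graphPart, List.filter_append, List.isChain_append] at hc
  exact hc.2.2 u (foldl_nextParent_eq_some hes hu).1 v (by simp [hv])

/-- The vertex `v` is then the first graph vertex of the order, and acyclicity excludes an edge into
it from the last one, which the head finds in the preceding example. -/
theorem not_mem_edges (h : IsPrompt D vs g ss) (hvs : es.map (·.2.1) ++ v :: vs₂ = vs)
    (hv : v ∈ D.verts) (hn : es.foldl D.nextParent none = none) {u : V}
    (hu : u ∈ (D.graphPart vs).getLast?) : (u, v) ∉ D.edges := by
  refine h.order.not_mem_edges u hu v ?_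
  rw [← hvs, graphPart, List.filter_append, ← graphPart, foldl_nextParent_eq_none hn]
  simp [hv]

/-- The prediction after `=` matches the sampling rule in all three cases: a graph vertex with a
parent in the current sequence, the first graph vertex, and a noise vertex. -/
theorem uniformTree_valueLaw (h : IsPrompt D vs g ss) (hes : ∀ e ∈ es, D.IsEntry e)
    (hvs : es.map (·.2.1) ++ v :: vs₂ = vs) {cs : List C}
    {Φ : D.Value → (List D.Tok → ℝ≥0∞) → ℝ≥0∞}
    {good : List D.Tok → Finset D.Tok → Prop}
    (hgood : ∀ z S, (z.length ≤ T → D.PredictsUniform E z S) → good z S)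
    (hΦ : ∀ q ∈ D.valueSet v,
      UniformTree good (context vs ss es ++ cs.map .ctx ++ [.vtx v] ++ [.eq] ++ [.val q]) (Φ q)) :
    UniformTree good (context vs ss es ++ cs.map .ctx ++ [.vtx v] ++ [.eq]) fun f =>
      (D.valueLaw (es.foldl D.nextParent none) v).expect fun q => Φ q fun y => f (.val q :: y) := by
  set z := context vs ss es ++ cs.map .ctx ++ [.vtx v] ++ [.eq] with hz
  have hz' : z = context vs ss es ++ (cs.map .ctx ++ [.vtx v, .eq]) := by simp [hz]
  have h0 : ∃ g, z.head? = some (.vtx g) := hz' ▸ h.head?_append _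
  have hp := foldl_scanParent (D := D) (vs := vs) ss es (y := cs.map .ctx ++ [.vtx v, .eq]) (by simp)
  rw [← hz'] at hp
  have hgood' : ∀ u q, (es.foldl D.nextParent none).or (ss.flatten.foldl D.nextParent none) =
      some (u, q) → q ∈ D.valueSet u → good z (if (u, v) ∈ D.edges then {.val (D.op (u, v) q)}
        else (D.valueSet v).image .val) := fun u q hu hq =>
    hgood z _ fun hT => predictsUniform_eq hz h0 hT (by simp [hz, scanVtx]) (hp.trans hu) hq
  have huniform : good z ((D.valueSet v).image .val) → UniformTree good z fun f =>
      (PMF.uniformOfFinset (D.valueSet v) (D.valueSet_nonempty v)).expect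
        fun q => Φ q fun y => f (.val q :: y) := fun hg => by
    simp only [PMF.expect_uniformOfFinset]
    exact UniformTree.uniform (fun a b h => by simpa using h) (D.valueSet_nonempty v) hg hΦ
  obtain ⟨u', q', hp', hu', hq'⟩ := h.exists_parent
  by_cases hv : v ∈ D.verts
  · rcases hu : es.foldl D.nextParent none with _ | ⟨u, q⟩
    · have := hgood' u' q' (by rw [hu, hp']; rfl) hq'
      rw [if_neg (h.not_mem_edges hvs hv hu hu')] at this
      simpa only [valueLaw, hv, if_true] using huniform this
    · have he := h.mem_edges hes hvs hv hu
      have hq := (foldl_nextParent_eq_some hes hu).2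
      have := hgood' u q (by rw [hu]; rfl) hq
      rw [if_pos he] at this
      simp only [valueLaw, hv, if_true, PMF.expect_pure]
      exact UniformTree.singleton this (hΦ _ (D.op_mem_valueSet he hq))
  -- No edge enters a noise vertex, so it is irrelevant which parent the head finds.
  · have hne : ∀ u, (u, v) ∉ D.edges := fun u he => hv (D.edges_verts _ he).2
    obtain ⟨u, q, hu, hq⟩ : ∃ u q, (es.foldl D.nextParent none).or
        (ss.flatten.foldl D.nextParent none) = some (u, q) ∧ q ∈ D.valueSet u := by
      rcases hu : es.foldl D.nextParent none with _ | ⟨u, q⟩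
      · exact ⟨u', q', by rw [hp']; rfl, hq'⟩
      · exact ⟨u, q, rfl, (foldl_nextParent_eq_some hes hu).2⟩
    have := hgood' u q hu hq
    rw [if_neg (hne u)] at this
    simpa only [valueLaw, hv, if_false] using huniform this

theorem ne_nil_of_mem_support_seqLawFrom {p : Option (V × D.Value)} {es' : List D.Entry}
    (h : es' ∈ (D.seqLawFrom p (v :: vs₂)).support) : es' ≠ [] := by
  simp only [seqLawFrom, PMF.support_bind, PMF.support_map, Set.mem_iUnion, Set.mem_image] at h
  obtain ⟨_, _, _, _, _, _, rfl⟩ := h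
  simp

/-- Induction on the vertices still to be written. Each step concatenates the choice of contextual
tokens and vertex, a forced `=`, the choice of the value and, unless the order is finished, a forced
comma. -/
theorem uniformTree_seqLawFrom (h : IsPrompt D vs g ss) {good : List D.Tok → Finset D.Tok → Prop}
    (hgood : ∀ z S, (z.length ≤ T → D.PredictsUniform E z S) → good z S) (vs₂ : List V)
    (es : List D.Entry) (hes : ∀ e ∈ es, D.IsEntry e) (hne : es ≠ [])
    (hvs : es.map (·.2.1) ++ vs₂ = vs) :
    UniformTree good (context vs ss es) fun f =>
      (D.seqLawFrom (es.foldl D.nextParent none) vs₂).expect fun es' => f (D.renderEntries es') := by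
  induction vs₂ generalizing es with
  | nil =>
    simp only [seqLawFrom, PMF.expect_pure]
    exact UniformTree.done _
  | cons v vs₂ ih =>
    have key := uniformTree_contextLaw (pre := context vs ss es) (v := v) (good := good)
      (Φ := fun f => (D.valueLaw (es.foldl D.nextParent none) v).expect fun q =>
        (D.seqLawFrom (if v ∈ D.verts then some (v, q) else es.foldl D.nextParent none) vs₂).expect
          fun es' => f (.eq :: .val q :: D.renderRest es'))
      (hgood _ _ fun hT => h.predictsUniform_context hes hne hvs hT)
      (fun cs hcs hv => hgood _ _ fun hT => h.predictsUniform_map_ctx hne hcs hv hT)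
      (fun cs hcs hv => ?_)
    · convert key using 2 with f
      simp only [seqLawFrom, PMF.expect_bind, PMF.expect_map, renderEntries_cons, renderEntry,
        List.append_assoc, List.cons_append, List.nil_append]
    · have hx : context vs ss es ++ cs.map .ctx ++ [.vtx v] =
          (context vs ss es ++ cs.map .ctx) ++ [.vtx v] := rfl
      refine UniformTree.singleton (Φ := fun f =>
        (D.valueLaw (es.foldl D.nextParent none) v).expect fun q => (D.seqLawFrom
          (if v ∈ D.verts then some (v, q) else es.foldl D.nextParent none) vs₂).expect
          fun es' => f (.val q :: D.renderRest es'))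
        (hgood _ _ fun hT => predictsUniform_vtx hx ?_ hT) ?_
      · rw [List.append_assoc]
        exact h.head?_append _
      refine h.uniformTree_valueLaw hes hvs hgood (Φ := fun q f => (D.seqLawFrom
          (if v ∈ D.verts then some (v, q) else es.foldl D.nextParent none) vs₂).expect
          fun es' => f (D.renderRest es')) fun q hq => ?_
      rcases vs₂ with _ | ⟨v', vs₂⟩
      · simp only [seqLawFrom, PMF.expect_pure]
        exact UniformTree.done _
      · have hes' : ∀ e ∈ es ++ [(cs, v, q)], D.IsEntry e := fun e he => by
          rcases List.mem_append.1 he with he | he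
          · exact hes e he
          · rw [List.mem_singleton.1 he]
            exact ⟨hcs, hv, hq⟩
        have := ih (es ++ [(cs, v, q)]) hes' (by simp) (by simp [← hvs])
        have hctx : context vs ss (es ++ [(cs, v, q)]) =
            context vs ss es ++ cs.map .ctx ++ [.vtx v] ++ [.eq] ++ [.val q] ++ [.cm] := by
          simp [context, renderClosed, renderEntry]
        rw [hctx] at this
        have := UniformTree.singleton (hgood _ _ fun hT => predictsUniform_val rfl (by
          simp only [List.append_assoc]
          exact h.head?_append _) hT) this
        convert this using 2 with f
        rw [List.foldl_append]
        -- The leading comma splits off only when further entries exist, which is guaranteed on the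
        -- support.
        refine PMF.expect_congr _ fun es' hes' => ?_
        obtain ⟨e, es', rfl⟩ := List.exists_cons_of_ne_nil (ne_nil_of_mem_support_seqLawFrom hes')
        rw [renderRest_cons]

end IsPrompt

end Causal

/-! ### Supports of the laws and optimality of the training loss. -/

namespace Causal

variable {V C : Type} [Fintype V] [DecidableEq V] [Fintype C] [DecidableEq C] {D : Causal V C}

theorem mem_support_seqLawFrom_cons {p : Option (V × D.Value)} {v : V} {vs : List V}
    {es : List D.Entry} : es ∈ (D.seqLawFrom p (v :: vs)).support ↔
      ∃ cs ∈ (D.contextLaw v).support, ∃ q ∈ (D.valueLaw p v).support,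
        ∃ es' ∈ (D.seqLawFrom (D.nextParent p (cs, v, q)) vs).support, es = (cs, v, q) :: es' := by
  simp only [seqLawFrom, PMF.support_bind, PMF.support_map, Set.mem_iUnion, Set.mem_image,
    exists_prop, nextParent, eq_comm (a := es)]

theorem mem_support_seqLawFrom {vs : List V} {p : Option (V × D.Value)} {es : List D.Entry}
    (h : es ∈ (D.seqLawFrom p vs).support)
    (hp : ∀ u q, p = some (u, q) → q ∈ D.valueSet u ∧
      ∀ v ∈ (D.graphPart vs).head?, (u, v) ∈ D.edges)
    (hc : (D.graphPart vs).IsChain fun u v => (u, v) ∈ D.edges) :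
    es.map (·.2.1) = vs ∧ ∀ e ∈ es, D.IsEntry e := by
  induction vs generalizing p es with
  | nil =>
    simp only [seqLawFrom, PMF.support_pure, Set.mem_singleton_iff] at h
    simp [h]
  | cons v vs ih =>
    obtain ⟨cs, hcs, q, hq, es', hes', rfl⟩ := mem_support_seqLawFrom_cons.1 h
    have hqv : q ∈ D.valueSet v := by
      unfold valueLaw at hq
      split at hq
      case h_1 u q' he =>
        split_ifs at he with hv
        obtain ⟨h1, h2⟩ := hp u q' he
        simp only [PMF.support_pure, Set.mem_singleton_iff] at hq
        rw [hq]
        exact D.op_mem_valueSet (h2 v (by simp [graphPart, hv])) h1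
      case h_2 => simpa using hq
    have hcs' := D.mem_support_contextLaw hcs
    have hrest := ih hes' (fun u q' hu => ?_) ?_
    · refine ⟨by simp [hrest.1], fun e he => ?_⟩
      rcases List.mem_cons.1 he with rfl | he
      · exact ⟨hcs'.1, hcs'.2, hqv⟩
      · exact hrest.2 e he
    · by_cases hv : v ∈ D.verts
      · simp only [nextParent, hv, if_true, Option.some.injEq, Prod.mk.injEq] at hu
        obtain ⟨rfl, rfl⟩ := hu
        refine ⟨hqv, fun v' hv' => ?_⟩
        rw [graphPart, List.filter_cons_of_pos (by simpa using hv), List.isChain_cons] at hc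
        exact hc.1 v' hv'
      · simp only [nextParent, hv, if_false] at hu
        obtain ⟨h1, h2⟩ := hp u q' hu
        refine ⟨h1, fun v' hv' => h2 v' ?_⟩
        rwa [graphPart, List.filter_cons_of_neg (by simpa using hv)]
    · rw [graphPart, List.filter_cons] at hc
      split_ifs at hc
      · exact hc.tail
      · exact hc

/-- Without noise vertices, each value is the image of the preceding one under the edge operation;
only the contextual tokens remain random. -/
theorem map_snd_eq_of_mem_support {vs : List V} (hvs : ∀ v ∈ vs, v ∈ D.verts) {u : V}
    {q : D.Value} {es es' : List D.Entry} (h : es ∈ (D.seqLawFrom (some (u, q)) vs).support)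
    (h' : es' ∈ (D.seqLawFrom (some (u, q)) vs).support) :
    es.map Prod.snd = es'.map Prod.snd := by
  induction vs generalizing u q es es' with
  | nil =>
    simp only [seqLawFrom, PMF.support_pure, Set.mem_singleton_iff] at h h'
    rw [h, h']
  | cons v vs ih =>
    have hv := hvs v List.mem_cons_self
    obtain ⟨cs, -, q₁, hq₁, es₁, hes₁, rfl⟩ := mem_support_seqLawFrom_cons.1 h
    obtain ⟨cs', -, q₂, hq₂, es₂, hes₂, rfl⟩ := mem_support_seqLawFrom_cons.1 h'
    simp only [valueLaw, hv, if_true, PMF.support_pure, Set.mem_singleton_iff] at hq₁ hq₂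
    subst hq₁ hq₂
    simp only [nextParent, hv, if_true] at hes₁ hes₂
    simp [ih (fun v hv => hvs v (List.mem_cons_of_mem _ hv)) hes₁ hes₂]

theorem mem_support_shotsLaw {vs : List V} {k : ℕ} {ss : List (List D.Entry)}
    (h : ss ∈ (D.shotsLaw vs k).support) :
    ss.length = k ∧ ∀ s ∈ ss, s ∈ (D.seqLaw vs).support := by
  induction k generalizing ss with
  | zero =>
    simp only [shotsLaw, PMF.support_pure, Set.mem_singleton_iff] at h
    simp [h]
  | succ k ih =>
    simp only [shotsLaw, PMF.support_bind, PMF.support_map, Set.mem_iUnion, Set.mem_image,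
      exists_prop] at h
    obtain ⟨s, hs, ss', hss', rfl⟩ := h
    obtain ⟨h1, h2⟩ := ih hss'
    exact ⟨by simp [h1], by simpa using ⟨hs, h2⟩⟩

theorem IsOrder.mem_support_seqLaw {vs : List V} (h : D.IsOrder vs) {s : List D.Entry}
    (hs : s ∈ (D.seqLaw vs).support) : s.map (·.2.1) = vs ∧ ∀ e ∈ s, D.IsEntry e :=
  mem_support_seqLawFrom hs (by simp) h.isChain

theorem IsOrder.isPrompt {vs : List V} (h : D.IsOrder vs) {k : ℕ} (hk : 1 ≤ k)
    {ss : List (List D.Entry)} (hss : ss ∈ (D.shotsLaw vs k).support) :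
    ∃ g, D.IsPrompt vs g ss := by
  have hvs : vs ≠ [] := by
    rintro rfl
    exact h.ne_nil rfl
  obtain ⟨h1, h2⟩ := mem_support_shotsLaw hss
  refine ⟨vs.getLast hvs, h, List.getLast?_eq_getLast_of_ne_nil hvs, ?_,
    fun s hs => (h.mem_support_seqLaw (h2 s hs)).1, fun s hs => (h.mem_support_seqLaw (h2 s hs)).2⟩
  rintro rfl
  simp at h1
  lia

theorem mem_support_pairLaw {μ : PMF (List V)} {k : ℕ} {x : List D.Tok × List D.Tok} :
    x ∈ (D.pairLaw μ k).support ↔ ∃ vs ∈ μ.support, ∃ ss ∈ (D.shotsLaw vs k).support,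
      ∃ s ∈ (D.seqLaw vs).support, x = (D.inputOf vs ss s, D.labelOf s) := by
  simp only [pairLaw, PMF.support_bind, PMF.support_map, Set.mem_iUnion, Set.mem_image,
    exists_prop, eq_comm (a := x)]

theorem inputOf_cons (vs : List V) (ss : List (List D.Entry)) (e : D.Entry) (es : List D.Entry) :
    D.inputOf vs ss (e :: es) = context vs ss [e] := by
  simp [inputOf, context, renderClosed, renderEntries]

theorem labelOf_cons (e : D.Entry) (es : List D.Entry) :
    D.labelOf (e :: es) = D.renderEntries es := by
  simp [labelOf]

/-- The negative log-likelihood of all tokens of `y` but the first, as a continuation of `pre`. -/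
def tailCost {A : Type} (P : List A → A → ℝ) (pre : List A) : List A → ℝ≥0∞
  | [] => 0
  | a :: y => logCost P (pre ++ [a]) y

theorem sum_nll_eq_tailCost {A : Type} (P : List A → A → ℝ) (d : A) (pre y : List A) :
    ∑ t ∈ Finset.Ico 1 y.length, nll (P (pre ++ y.take t) (y.getD t d)) = tailCost P pre y := by
  cases y with
  | nil => simp [tailCost]
  | cons a y =>
    rw [tailCost, ← sum_nll_eq_logCost P d, List.length_cons, Finset.sum_Ico_eq_sum_range,
      Nat.add_sub_cancel]
    refine Finset.sum_congr rfl fun t _ => ?_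
    rw [add_comm 1 t]
    simp

/-- The training loss does not charge the first token of the label, so `logCost_le` is applied to
the subtrees below the root. -/
theorem _root_.UniformTree.tailCost_le {A : Type} [Fintype A] {good : List A → Finset A → Prop}
    {pre : List A} {Φ : (List A → ℝ≥0∞) → ℝ≥0∞} (h : UniformTree good pre Φ) {T : ℕ}
    {P₀ P : List A → A → ℝ}
    (hP₀ : ∀ z S, z.length ≤ T → good z S → ∀ a ∈ S, P₀ z a = (S.card : ℝ)⁻¹)
    (h0 : ∀ z a, 0 ≤ P z a) (h1 : ∀ z, ∑ a, P z a ≤ 1)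
    (hT : ∀ y, IsLeaf Φ y → pre.length + y.length ≤ T) :
    Φ (tailCost P₀ pre) ≤ Φ (tailCost P pre) := by
  cases h with
  | done => rfl
  | step _ S hS h Φ hΦ =>
    refine mul_le_mul_right (Finset.sum_le_sum fun a ha => ?_) _
    refine (hΦ a ha).logCost_le hP₀ h0 h1 fun y hy => ?_
    have := hT _ (UniformTree.isLeaf_cons ha hy)
    simp only [List.length_append, List.length_cons, List.length_nil] at this ⊢
    lia

theorem isLeaf_expect_iff {α A : Type} (p : PMF α) (g : α → List A) (y : List A) :
    IsLeaf (fun f => p.expect fun a => f (g a)) y ↔ ∃ a ∈ p.support, g a = y := by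
  rw [IsLeaf, PMF.expect_ne_zero_iff]
  simp

theorem trainLoss_eq (μ : PMF (List V)) (K : ℕ) (P : List D.Tok → D.Tok → ℝ) :
    D.trainLoss μ K P = ∑ k ∈ Finset.Ico 1 K, μ.expect fun vs => (D.shotsLaw vs k).expect fun ss =>
      (D.seqLaw vs).expect fun s => tailCost P (D.inputOf vs ss s) (D.labelOf s) := by
  refine Finset.sum_congr rfl fun k _ => ?_
  change (D.pairLaw μ k).expect _ = _
  simp only [sum_nll_eq_tailCost]
  simp only [pairLaw, PMF.expect_bind, PMF.expect_map]

section Train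

variable {d₁ T : ℕ} {E : Embeddings D.Tok d₁ T}

theorem nextDist_eq_of_predictsUniform {z : List D.Tok} {S : Finset D.Tok}
    (h : D.PredictsUniform E z S) {a : D.Tok} (ha : a ∈ S) :
    Transformer.nextDist hardmax E (D.params E) z a = (S.card : ℝ)⁻¹ := by
  rw [h a, if_pos ha]

/-- The competitor is any family of nonnegative weights of total mass at most one. This covers
hardmax models, softmax models at every sharpness and the uniform predictor at once. -/
theorem trainLoss_params_le {μ : PMF (List V)} {K : ℕ} (hμ : ∀ vs ∈ μ.support, D.IsOrder vs)
    (hT : ∀ k, 1 ≤ k → k < K → ∀ x ∈ (D.pairLaw μ k).support, x.1.length + x.2.length ≤ T)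
    {P : List D.Tok → D.Tok → ℝ} (h0 : ∀ z a, 0 ≤ P z a) (h1 : ∀ z, ∑ a, P z a ≤ 1) :
    D.trainLoss μ K (Transformer.nextDist hardmax E (D.params E)) ≤ D.trainLoss μ K P := by
  rw [trainLoss_eq, trainLoss_eq]
  refine Finset.sum_le_sum fun k hk => ?_
  rw [Finset.mem_Ico] at hk
  refine PMF.expect_mono _ fun vs hvs => PMF.expect_mono _ fun ss hss => ?_
  obtain ⟨g, hpr⟩ := (hμ vs hvs).isPrompt hk.1 hss
  rcases vs with _ | ⟨v, vs⟩
  · simpa using hpr.goal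
  simp only [seqLaw, seqLawFrom, PMF.expect_bind, PMF.expect_map, inputOf_cons, labelOf_cons]
  -- The first entry belongs to the input; given the examples and this entry, the label is the tree
  -- of the remaining vertices.
  refine PMF.expect_mono _ fun cs hcs => PMF.expect_mono _ fun q hq => ?_
  have hsupp : ∀ es ∈ (D.seqLawFrom (D.nextParent none (cs, v, q)) vs).support,
      (cs, v, q) :: es ∈ (D.seqLaw (v :: vs)).support := fun es hes =>
    mem_support_seqLawFrom_cons.2 ⟨cs, hcs, q, hq, es, hes, rfl⟩
  have hentry : D.IsEntry (cs, v, q) := by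
    obtain ⟨es, hes⟩ := (D.seqLawFrom (D.nextParent none (cs, v, q)) vs).support_nonempty
    exact ((hμ _ hvs).mem_support_seqLaw (hsupp es hes)).2 _ List.mem_cons_self
  have htree := hpr.uniformTree_seqLawFrom (E := E)
    (good := fun z S => z.length ≤ T → D.PredictsUniform E z S) (fun _ _ h => h) vs [(cs, v, q)]
    (by simpa using hentry) (by simp) (by simp)
  refine htree.tailCost_le (T := T) (fun z S hz hS a ha => nextDist_eq_of_predictsUniform (hS hz) ha)
    h0 h1 fun y hy => ?_
  obtain ⟨es, hes, rfl⟩ := (isLeaf_expect_iff _ _ _).1 hy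
  have := hT k hk.1 hk.2 _ (mem_support_pairLaw.2 ⟨_, hvs, ss, hss, _, hsupp es hes, rfl⟩)
  rwa [inputOf_cons, labelOf_cons] at this

end Train

/-- Two predictors with close losses on each token have close training losses. -/
theorem trainLoss_le_add {μ : PMF (List V)} {K T : ℕ} {δ : ℝ≥0∞}
    (hT : ∀ k, 1 ≤ k → k < K → ∀ x ∈ (D.pairLaw μ k).support, x.1.length + x.2.length ≤ T)
    {P Q : List D.Tok → D.Tok → ℝ}
    (h : ∀ z, z.length ≤ T → ∀ a, nll (P z a) ≤ nll (Q z a) + δ) :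
    D.trainLoss μ K P ≤ D.trainLoss μ K Q + K * (T * δ) := by
  have hk : ∀ k ∈ Finset.Ico 1 K, (D.pairLaw μ k).expect (fun x => ∑ t ∈ Finset.Ico 1 x.2.length,
      nll (P (x.1 ++ x.2.take t) (x.2.getD t Token.cm))) ≤
      (D.pairLaw μ k).expect (fun x => ∑ t ∈ Finset.Ico 1 x.2.length,
        nll (Q (x.1 ++ x.2.take t) (x.2.getD t Token.cm))) + T * δ := by
    intro k hk
    rw [Finset.mem_Ico] at hk
    conv_rhs => rw [← (D.pairLaw μ k).expect_const (T * δ), ← PMF.expect_add]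
    refine PMF.expect_mono _ fun x hx => ?_
    have hx := hT k hk.1 hk.2 x hx
    refine (Finset.sum_le_sum fun t _ => h _ ?_ _).trans ?_
    · rw [List.length_append, List.length_take]
      lia
    · rw [Finset.sum_add_distrib, Finset.sum_const, nsmul_eq_mul]
      gcongr
      rw [Nat.card_Ico]
      lia
  refine (Finset.sum_le_sum hk).trans ?_
  rw [Finset.sum_add_distrib, Finset.sum_const, nsmul_eq_mul]
  refine add_le_add le_rfl ?_
  gcongr
  rw [Nat.card_Ico]
  lia

end Causal

/-! ### Greedy decoding, the testing loss and finite sharpness. -/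

namespace Causal

open Transformer Filter

variable {V C : Type} [Fintype V] [DecidableEq V] [Fintype C] [DecidableEq C] {D : Causal V C}

theorem dec_append (y z : List D.Tok) : D.dec (y ++ z) = D.dec y ++ D.dec z :=
  List.filter_append ..

theorem dec_renderEntry (e : D.Entry) : D.dec (D.renderEntry e) = [.vtx e.2.1, .val e.2.2] := by
  have h : D.dec (e.1.map Token.ctx) = [] := by simp [dec]
  rw [renderEntry, dec_append, h]
  rfl

theorem dec_renderEntries (es : List D.Entry) :
    D.dec (D.renderEntries es) =
      (es.map Prod.snd).flatMap fun p => [.vtx p.1, .val p.2] := by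
  induction es with
  | nil => rfl
  | cons e es ih =>
    rw [renderEntries_cons, dec_append, dec_renderEntry, List.map_cons, List.flatMap_cons, ← ih]
    congr 1
    rcases es with _ | ⟨e', es⟩
    · rfl
    · rw [renderRest_cons]
      rfl

theorem renderEntries_concat (es : List D.Entry) (e : D.Entry) :
    D.renderEntries (es ++ [e]) = D.renderClosed es ++ D.renderEntry e := by
  have h := D.renderClosed_eq (es := es ++ [e]) (by simp)
  rw [renderClosed_append, renderClosed_cons] at h
  have h' : (D.renderClosed es ++ D.renderEntry e) ++ [.cm] = D.renderEntries (es ++ [e]) ++ [.cm] := by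
    rw [← h]
    simp [renderClosed]
  exact (List.append_cancel_right h').symm

/-- As the vertices do not repeat, the goal vertex occurs only in the last entry; the stopping
pattern can therefore be complete only at the very end. -/
theorem answered_take_iff {inp : List D.Tok} {g : V} (hinp : inp.head? = some (.vtx g))
    {es : List D.Entry} (hg : (es.map (·.2.1)).getLast? = some g) (hnd : (es.map (·.2.1)).Nodup)
    {i : ℕ} (hi : i ≤ (D.renderEntries es).length) :
    D.Answered inp ((D.renderEntries es).take i) ↔ i = (D.renderEntries es).length := by
  obtain ⟨es₀, e, rfl⟩ : ∃ es₀ e, es = es₀ ++ [e] := by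
    refine ⟨_, _, (List.dropLast_append_getLast (l := es) ?_).symm⟩
    rintro rfl
    simp at hg
  obtain rfl : e.2.1 = g := by simpa using hg
  have hy : D.renderEntries (es₀ ++ [e]) =
      (D.renderClosed es₀ ++ e.1.map .ctx) ++ .vtx e.2.1 :: [.eq, .val e.2.2] := by
    rw [renderEntries_concat, renderEntry, List.append_assoc]
  have hnot : (.vtx e.2.1 : D.Tok) ∉ D.renderClosed es₀ ++ e.1.map .ctx := by
    intro hm
    simp only [List.map_append, List.map_cons, List.map_nil, List.nodup_append, List.mem_map] at hnd
    simp only [renderClosed, renderEntry, List.mem_append, List.mem_flatMap, List.mem_map,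
      List.mem_cons, Token.vtx.injEq, reduceCtorEq, and_false, exists_false, false_or, or_false,
      List.not_mem_nil] at hm
    obtain ⟨e', he', h⟩ := hm
    exact hnd.2.2 _ ⟨e', he', rfl⟩ _ (List.mem_singleton_self _) h.symm
  constructor
  · rintro ⟨g', q, hg', A, hA⟩
    rw [hinp] at hg'
    obtain rfl : e.2.1 = g' := by simpa using hg'
    have hsplit : D.renderEntries (es₀ ++ [e]) =
        A ++ .vtx e.2.1 :: ([.eq, .val q] ++ (D.renderEntries (es₀ ++ [e])).drop i) := by
      conv_lhs => rw [← List.take_append_drop i (D.renderEntries (es₀ ++ [e])), ← hA]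
      simp
    have := hy.symm.trans hsplit
    rw [List.append_cons_inj_of_notMem hnot (by simp)] at this
    have hnil : (D.renderEntries (es₀ ++ [e])).drop i = [] := by
      have hlen := congrArg List.length this.2.2
      simp only [List.length_append, List.length_cons, List.length_nil] at hlen
      exact List.eq_nil_of_length_eq_zero (by lia)
    rw [List.drop_eq_nil_iff] at hnil
    lia
  · rintro rfl
    rw [List.take_length]
    exact ⟨e.2.1, e.2.2, hinp, _, hy.symm⟩

section Test

variable {d₁ T : ℕ} {E : Embeddings D.Tok d₁ T}

theorem PredictsUniform.argmaxSet_eq {z : List D.Tok} {S : Finset D.Tok} (hS : S.Nonempty)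
    (h : D.PredictsUniform E z S) :
    argmaxSet (nextDist hardmax E (D.params E) z) = S := by
  refine _root_.argmaxSet_eq (m := (S.card : ℝ)⁻¹) hS (fun a ha => by rw [h a, if_pos ha])
    fun a ha => ?_
  rw [h a, if_neg ha]
  have := hS.card_pos
  positivity

/-- The generated sentence is a leaf, that is, a possible label with the same first entry. Its
contextual tokens may differ from those of the true label, but its vertices and values may not. -/
theorem testLoss_eq_neg_one {N : ℕ} (hN : D.IsDepth N) (h2 : 2 ≤ N) {ν : PMF (List V)}
    (hν : ∀ vs ∈ ν.support, D.IsTestOrder N vs) {k : ℕ} (hk : 1 ≤ k)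
    (hT : ∀ x ∈ (D.pairLaw ν k).support, x.1.length + x.2.length ≤ T)
    {P : List D.Tok → D.Tok → ℝ}
    (hP : ∀ z, z.length ≤ T →
      argmaxSet (P z) ⊆ argmaxSet (nextDist hardmax E (D.params E) z))
    {pick : List D.Tok → Finset D.Tok → D.Tok} (hpick : D.IsTieBreak pick) :
    D.testLoss ν k T P pick = -1 := by
  suffices h : (D.pairLaw ν k).support ⊆
      {x | D.dec (D.generate T P pick x.1) = D.dec x.2} by
    rw [testLoss, (PMF.toOuterMeasure_apply_eq_one_iff _ _).2 h, ENNReal.toReal_one]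
  intro x hx
  obtain ⟨vs, hvs, ss, hss, s, hs, rfl⟩ := mem_support_pairLaw.1 hx
  have hord := (hν vs hvs).isOrder hN (by lia)
  obtain ⟨g, hpr⟩ := hord.isPrompt hk hss
  have hverts := (hν vs hvs).1.1
  have hlen := (hν vs hvs).2
  rcases vs with _ | ⟨v, _ | ⟨v₂, vs⟩⟩
  · simp at hlen; lia
  · simp at hlen; lia
  obtain ⟨cs, hcs, q, hq, es, hes, rfl⟩ := mem_support_seqLawFrom_cons.1 hs
  have hsupp : ∀ es ∈ (D.seqLawFrom (D.nextParent none (cs, v, q)) (v₂ :: vs)).support,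
      (cs, v, q) :: es ∈ (D.seqLaw (v :: v₂ :: vs)).support := fun es hes =>
    mem_support_seqLawFrom_cons.2 ⟨cs, hcs, q, hq, es, hes, rfl⟩
  have hentry : D.IsEntry (cs, v, q) := (hord.mem_support_seqLaw hs).2 _ List.mem_cons_self
  have htree := hpr.uniformTree_seqLawFrom (E := E)
    (good := fun z S => z.length ≤ T → D.PredictsUniform E z S) (fun _ _ h => h) (v₂ :: vs)
    [(cs, v, q)] (by simpa using hentry) (by simp) (by simp)
  have hleaf : ∀ y, IsLeaf (fun f => (D.seqLawFrom (D.nextParent none (cs, v, q))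
      (v₂ :: vs)).expect fun es' => f (D.renderEntries es')) y →
      (context (v :: v₂ :: vs) ss [(cs, v, q)]).length + y.length ≤ T := fun y hy => by
    obtain ⟨es', hes', rfl⟩ := (isLeaf_expect_iff _ _ _).1 hy
    have := hT _ (mem_support_pairLaw.2 ⟨_, hvs, ss, hss, _, hsupp es' hes', rfl⟩)
    rwa [inputOf_cons, labelOf_cons] at this
  have hhead : (context (v :: v₂ :: vs) ss [(cs, v, q)]).head? = some (.vtx g) := by
    simpa using hpr.head?_context_append (es := [(cs, v, q)]) []
  obtain ⟨y, hy, hgen⟩ := htree.exists_greedyFrom_eq (T := T) (P := P)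
    (fun z S hz hS hzS => (hP z hz).trans ((hzS hz).argmaxSet_eq hS).subset) hpick
    (inp := context (v :: v₂ :: vs) ss [(cs, v, q)]) (out := []) (by simp)
    (n := T - (context (v :: v₂ :: vs) ss [(cs, v, q)]).length) (by lia) hleaf
    (fun y hy i hi => by
      obtain ⟨es', hes', rfl⟩ := (isLeaf_expect_iff _ _ _).1 hy
      have hmap := (hord.mem_support_seqLaw (hsupp es' hes')).1
      simp only [List.map_cons, List.cons.injEq, true_and] at hmap
      have hgoal := hpr.goal
      rw [List.getLast?_cons_cons, ← hmap] at hgoal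
      exact answered_take_iff hhead hgoal (hmap ▸ (List.nodup_cons.1 hord.nodup).2) hi)
  obtain ⟨es', hes', rfl⟩ := (isLeaf_expect_iff _ _ _).1 hy
  have hnp : D.nextParent none (cs, v, q) = some (v, q) :=
    if_pos (hverts v List.mem_cons_self)
  have hin : D.inputOf (v :: v₂ :: vs) ss ((cs, v, q) :: es) =
      context (v :: v₂ :: vs) ss [(cs, v, q)] := inputOf_cons ..
  have hout : D.generate T P pick (D.inputOf (v :: v₂ :: vs) ss ((cs, v, q) :: es)) =
      D.renderEntries es' := by
    rw [hin, generate, hgen, List.nil_append]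
  rw [hnp] at hes
  rw [List.foldl_cons, List.foldl_nil, hnp] at hes'
  rw [Set.mem_ofPred_eq, hout, labelOf_cons, dec_renderEntries, dec_renderEntries,
    map_snd_eq_of_mem_support (fun x hx => hverts x (List.mem_cons_of_mem _ hx)) hes' hes]


end Test

section Limit

variable {d₁ T L H d₂ : ℕ} (E : Embeddings D.Tok d₁ T) (θ : TransformerParams D.Tok d₁ L H d₂)

/-- Strict inequalities between limits persist, uniformly over the finitely many sentences that fit.
Ties of the limit may be broken at finite `β`, so only an inclusion can be claimed. -/
theorem eventually_argmaxSet_subset :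
    ∀ᶠ β in atTop, ∀ z : List D.Tok, z.length ≤ T →
      argmaxSet (nextDist (softmaxAt β) E θ z) ⊆ argmaxSet (nextDist hardmax E θ z) := by
  refine ((List.finite_length_le D.Tok T).eventually_all).2 fun z _ => ?_
  have h : ∀ a b, nextDist hardmax E θ z a < nextDist hardmax E θ z b →
      ∀ᶠ β in atTop, nextDist (softmaxAt β) E θ z a < nextDist (softmaxAt β) E θ z b :=
    fun a b hab => (expTendsto_nextDist E θ z a).tendsto.eventually_lt
      (expTendsto_nextDist E θ z b).tendsto hab
  have h' : ∀ᶠ β in atTop, ∀ a b, nextDist hardmax E θ z a < nextDist hardmax E θ z b →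
      nextDist (softmaxAt β) E θ z a < nextDist (softmaxAt β) E θ z b := by
    simpa only [eventually_all, eventually_imp_distrib_left] using h
  filter_upwards [h'] with β hβ a ha
  rw [mem_argmaxSet] at ha ⊢
  intro b
  by_contra hb
  exact absurd (ha b) (not_le.2 (hβ a b (not_le.1 hb)))

/-- Where the limiting probability vanishes the right side is infinite; elsewhere the logarithm is
continuous. -/
theorem eventually_nll_le {δ : ℝ} (hδ : 0 < δ) :
    ∀ᶠ β in atTop, ∀ z : List D.Tok, z.length ≤ T → ∀ a,
      nll (nextDist (softmaxAt β) E θ z a) ≤ nll (nextDist hardmax E θ z a) + ENNReal.ofReal δ := by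
  refine ((List.finite_length_le D.Tok T).eventually_all).2 fun z _ => ?_
  refine eventually_all.2 fun a => ?_
  by_cases hp : nextDist hardmax E θ z a ≤ 0
  · simp [nll, hp]
  have ht := (expTendsto_nextDist E θ z a).tendsto
  filter_upwards [ht.eventually_const_lt (not_le.1 hp),
    ((ht.log (not_le.1 hp).ne').neg).eventually_lt_const (lt_add_of_pos_right _ hδ)] with β h1 h2
  rw [nll, if_neg (not_le.2 h1), nll, if_neg hp]
  exact (ENNReal.ofReal_le_ofReal h2.le).trans ENNReal.ofReal_add_le

end Limit

instance : Nonempty D.Tok := ⟨.cm⟩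

/-- Comparison with the constant weight 1, which is not a distribution but has loss zero. -/
theorem trainLoss_const_ne_top {μ : PMF (List V)} {K T : ℕ}
    (hT : ∀ k, 1 ≤ k → k < K → ∀ x ∈ (D.pairLaw μ k).support, x.1.length + x.2.length ≤ T)
    {p : ℝ} (hp : 0 < p) : D.trainLoss μ K (fun _ _ => p) ≠ ⊤ := by
  have h := trainLoss_le_add hT (P := fun _ _ => p) (Q := fun _ _ => 1)
    (δ := ENNReal.ofReal (-Real.log p)) fun z _ a => by
      simp [nll, not_le.2 hp]
  have h1 : D.trainLoss μ K (fun _ _ => 1) = 0 := by simp [trainLoss, nll]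
  refine ne_top_of_le_ne_top ?_ h
  rw [h1, zero_add]
  exact ENNReal.mul_ne_top (ENNReal.natCast_ne_top _)
    (ENNReal.mul_ne_top (ENNReal.natCast_ne_top _) ENNReal.ofReal_ne_top)

end Causal

end

/-! ### The theorem. -/

open Causal in
theorem mainTheorem1 {V C : Type} [Fintype V] [DecidableEq V] [Fintype C] [DecidableEq C]
    (D : Causal V C) (N M M' K : ℕ) (hN : D.IsDepth N) (hM : 1 ≤ M) (hMN : M < N)
    (μ ν : PMF (List V))
    (hμ : ∀ vs ∈ μ.support, D.IsTrainOrder M M' vs)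
    (hν : ∀ vs ∈ ν.support, D.IsTestOrder N vs)
    (d₁ T : ℕ) (E : Embeddings D.Tok d₁ T)
    (hTtrain : ∀ k, 1 ≤ k → k < K → ∀ x ∈ (D.pairLaw μ k).support,
      x.1.length + x.2.length ≤ T)
    (hTtest : ∀ k, 1 ≤ k → k ≤ K → ∀ x ∈ (D.pairLaw ν k).support,
      x.1.length + x.2.length ≤ T) :
    ∃ θ : TransformerParams D.Tok d₁ 2 4 D.mlpExtra,
      (D.trainLoss μ K (Transformer.nextDist hardmax E θ) ≠ ⊤ ∧
        (∀ θ' : TransformerParams D.Tok d₁ 2 4 D.mlpExtra,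
          D.trainLoss μ K (Transformer.nextDist hardmax E θ) ≤
            D.trainLoss μ K (Transformer.nextDist hardmax E θ')) ∧
        ∀ pick, D.IsTieBreak pick → ∀ k, 1 ≤ k → k ≤ K →
          D.testLoss ν k T (Transformer.nextDist hardmax E θ) pick = -1) ∧
      ∀ ε : ℝ, 0 < ε → ∃ β₀ : ℝ, ∀ β : ℝ, β₀ ≤ β →
        D.trainLoss μ K (Transformer.nextDist (softmaxAt β) E θ) <
          (⨅ θ' : TransformerParams D.Tok d₁ 2 4 D.mlpExtra,
            D.trainLoss μ K (Transformer.nextDist (softmaxAt β) E θ')) + ENNReal.ofReal ε ∧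
        ∀ pick, D.IsTieBreak pick → ∀ k, 1 ≤ k → k ≤ K →
          D.testLoss ν k T (Transformer.nextDist (softmaxAt β) E θ) pick = -1 := by
  have hord : ∀ vs ∈ μ.support, D.IsOrder vs := fun vs hvs => (hμ vs hvs).isOrder hN hM
  have hcard : (0 : ℝ) < Fintype.card D.Tok := by exact_mod_cast Fintype.card_pos
  have hfin : D.trainLoss μ K (Transformer.nextDist hardmax E (D.params E)) ≠ ⊤ :=
    ne_top_of_le_ne_top (trainLoss_const_ne_top hTtrain (inv_pos.2 hcard))
      (trainLoss_params_le hord hTtrain (fun _ _ => (inv_pos.2 hcard).le) fun _ => by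
        simp)
  refine ⟨D.params E, ⟨hfin, fun θ' => ?_, fun pick hpick k hk hkK => ?_⟩, fun ε hε => ?_⟩
  · exact trainLoss_params_le hord hTtrain (fun _ _ => hardmax_nonneg _ _)
      fun _ => (sum_hardmax _).le
  · exact testLoss_eq_neg_one hN (by lia) hν hk (hTtest k hk hkK) (fun _ _ => subset_rfl) hpick
  -- Fewer than `K` values of `k` with at most `T` tokens each cost at most `K * T * δ`, which is
  -- less than `ε`; the summand 1 avoids division by zero.
  · set δ : ℝ := ε / (2 * (K * T + 1)) with hδ
    have hδ0 : 0 < δ := by positivity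
    obtain ⟨β₀, h⟩ := Filter.eventually_atTop.1
      ((eventually_nll_le E (D.params E) hδ0).and (eventually_argmaxSet_subset E (D.params E)))
    refine ⟨β₀, fun β hβ => ⟨?_, fun pick hpick k hk hkK =>
      testLoss_eq_neg_one hN (by lia) hν hk (hTtest k hk hkK) (h β hβ).2 hpick⟩⟩
    have hle := trainLoss_le_add hTtrain (h β hβ).1
    -- Every model at sharpness `β` is an admissible competitor of the hardmax model, so the infimum
    -- at `β` needs no separate analysis.
    have hinf : D.trainLoss μ K (Transformer.nextDist hardmax E (D.params E)) ≤
        ⨅ θ' : TransformerParams D.Tok d₁ 2 4 D.mlpExtra,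
          D.trainLoss μ K (Transformer.nextDist (softmaxAt β) E θ') :=
      le_iInf fun θ' => trainLoss_params_le hord hTtrain (fun _ _ => softmaxAt_nonneg _ _ _)
        fun _ => (sum_softmaxAt _ _).le
    have hsmall : (K : ℝ≥0∞) * (T * ENNReal.ofReal δ) < ENNReal.ofReal ε := by
      rw [← ENNReal.ofReal_natCast, ← ENNReal.ofReal_natCast, ← ENNReal.ofReal_mul (by positivity),
        ← ENNReal.ofReal_mul (by positivity), ENNReal.ofReal_lt_ofReal_iff hε, hδ, ← mul_assoc,
        mul_div_assoc', div_lt_iff₀ (by positivity)]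
      have : (0 : ℝ) ≤ K * T := by positivity
      nlinarith
    exact hle.trans_lt ((ENNReal.add_lt_add_left hfin hsmall).trans_le (add_le_add hinf le_rfl))
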